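/- Let $k$ and $K$ be fields, and let $G=G_\infty=\bigcup_n G_n$, where $G_n$ is one of $GL_n(k)$, $SL_n(k)$, $SO_{2n}(k)$, $SO_{2n+1}(k)$, $Sp_{2n}(k)$ (the same family for all $n$), naturally embedded into $G_{n+1}$. The orthogonal groups are those of the split quadratic forms $\sum x_ix_{-i}$ and $\sum x_ix_{-i}+x_0^2$; if $\operatorname{char} k=2$, then $SO_{2n}(k)$ is the kernel of the Dickson invariant. $G$ acts on coordinates indexed by $1,2,3,\dots$ for $GL$ and $SL$, by $\mathbb Z\setminus\{0\}$ for $SO_{2n}$ and $Sp_{2n}$, and by $\mathbb Z$ for $SO_{2n+1}$, where the coordinates $i$ and $-i$ are paired by the form. Let $T$ be the subgroup of diagonal elements of $G$, $N=N_G(T)$, $B$ the subgroup of upper triangular elements (for the usual order of the integers), and $U$ the subgroup of upper unitriangular elements, so that $U$ is the kernel of the natural homomorphism $B\to T$. Let $s_i\in N/T$ be the simple reflections with respect to $B$, given by the permutations of the coordinates that exchange $j$ and $j+1$ ($j\ge 1$) and, outside of $GL$ and $SL$, also $-j$ and $-j-1$, together with the permutation exchanging $1$ and $-1$ for $SO_{2n+1}$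 and $Sp_{2n}$, respectively the one exchanging $1$ with $-2$ and $2$ with $-1$ for $SO_{2n}$. For each $i$ choose a representative $n_i\in N$ of $s_i$, that is, an element of $G$ that permutes the coordinate lines as $s_i$ does. Let $U_i$ (resp. $U_i'$) be the subgroup of all $u\in U$ such that $n_iun_i^{-1}$ is lower unitriangular (resp. lies in $U$). Then every $u\in U$ is uniquely of the form $u=u_i'u_i$ with $u_i'\in U_i'$, $u_i\in U_i$, and for every $1\neq u_i\in U_i$ there is a unique $x\in U_i$ such that $n_iu_in_i^{-1}=xn_ity$ for some $t\in T$, $y\in U_i$. Let $\mathrm{St}=KU\xi$ be the free $KU$-module of rank one generated by $\xi$. There is exactly one $KG$-module structure on $\mathrm{St}$ that extends the $KU$-module structure and satisfies, for all $i$, 1. $t\,u\xi=tut^{-1}\xi$ for $t\in T$, $u\in U$; 2. $n_iu\xi=-n_iun_i^{-1}\xi$ for $u\in U_i'$; 3. $n_iu_i'u_i\xi=n_iu_i'n_i^{-1}(x-1)\xi$ for $u_i'\in U_i'$ and $1\ne u_i\in U_i$, where $x\in U_i$ is the element determined by $u_i$ as above. Moreover, every homomorphism $\theta:T\to K^\times$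 extends uniquely to a homomorphism $B\to K^\times$ trivial on $U$; if $K_\theta$ denotes the corresponding one-dimensional $B$-module (and its restriction to $T$) and $M(\theta)=KG\otimes_{KB}K_\theta$, then $M(\theta)\otimes_K\mathrm{St}\cong\operatorname{Ind}_T^GK_\theta=KG\otimes_{KT}K_\theta$ as $KG$-modules. -/

import Mathlib

open scoped TensorProduct

noncomputable section

universe u v

namespace FinitaryClassical

/-! ### The finite rank classical groups

`GL_n`, `SL_n` and `Sp_{2n}` are the groups of Mathlib (`Matrix.symplecticGroup` belongs to the
alternating form with matrix `[[0, -1], [1, 0]]`). The special orthogonal groups are those of the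
split quadratic forms. -/

/-- The split quadratic form `∑ x_i y_i` in `2 n` variables. -/
def evenForm (k : Type u) [Field k] (n : ℕ) (x : Fin n ⊕ Fin n → k) : k :=
  ∑ i, x (Sum.inl i) * x (Sum.inr i)

/-- The split quadratic form `∑ x_i y_i + z ^ 2` in `2 n + 1` variables. -/
def oddForm (k : Type u) [Field k] (n : ℕ) (x : (Fin n ⊕ Fin n) ⊕ Unit → k) : k :=
  ∑ i, x (Sum.inl (Sum.inl i)) * x (Sum.inl (Sum.inr i)) + x (Sum.inr ()) ^ 2

/-- Dickson's expression `∑ b_{ij} c_{ij}` of a matrix with blocks `[[A, B], [C, D]]`. On the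
orthogonal group of `evenForm` in characteristic two it is the Dickson invariant. -/
def dickson {k : Type u} [Field k] {n : ℕ} (M : Matrix (Fin n ⊕ Fin n) (Fin n ⊕ Fin n) k) : k :=
  ∑ i, ∑ j, M (Sum.inl i) (Sum.inr j) * M (Sum.inr i) (Sum.inl j)

/-- `SO_{2n+1}`: matrices of determinant one that preserve the split quadratic form. -/
def SOodd (k : Type u) [Field k] (n : ℕ) :
    Subgroup (Matrix.SpecialLinearGroup ((Fin n ⊕ Fin n) ⊕ Unit) k) where
  carrier := {g | ∀ x, oddForm k n (g.1.mulVec x) = oddForm k n x}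
  mul_mem' := by
    intro a b ha hb x
    rw [Matrix.SpecialLinearGroup.coe_mul, ← Matrix.mulVec_mulVec, ha, hb]
  one_mem' := by intro x; simp
  inv_mem' := by
    intro a ha x
    rw [← ha, Matrix.mulVec_mulVec]
    have h : a.1 * (a⁻¹).1 = 1 := by
      rw [← Matrix.SpecialLinearGroup.coe_mul, mul_inv_cancel, Matrix.SpecialLinearGroup.coe_one]
    rw [h, Matrix.one_mulVec]

section Dickson

variable {k : Type u} [Field k] {n : ℕ}

open Matrix

lemma evenForm_polar (x y : Fin n ⊕ Fin n → k) :
    evenForm k n (x + y) - evenForm k n x - evenForm k n y =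
      ∑ i, (x (Sum.inl i) * y (Sum.inr i) + y (Sum.inl i) * x (Sum.inr i)) := by
  simp only [evenForm, Pi.add_apply, ← Finset.sum_sub_distrib]
  exact Finset.sum_congr rfl fun i _ => by ring

/-- The block relations of a matrix that preserves `evenForm`. -/
lemma evenForm_blocks {M : Matrix (Fin n ⊕ Fin n) (Fin n ⊕ Fin n) k}
    (h : ∀ x, evenForm k n (M.mulVec x) = evenForm k n x) :
    (∀ j, (M.toBlocks₁₁ᵀ * M.toBlocks₂₁) j j = 0) ∧
    (∀ j, (M.toBlocks₁₂ᵀ * M.toBlocks₂₂) j j = 0) ∧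
    Mᵀ * fromBlocks 0 1 1 0 * M = fromBlocks 0 1 1 0 := by
  have key : ∀ x y : Fin n ⊕ Fin n → k,
      ∑ i, ((M *ᵥ x) (Sum.inl i) * (M *ᵥ y) (Sum.inr i) +
        (M *ᵥ y) (Sum.inl i) * (M *ᵥ x) (Sum.inr i)) =
      ∑ i, (x (Sum.inl i) * y (Sum.inr i) + y (Sum.inl i) * x (Sum.inr i)) := by
    intro x y
    rw [← evenForm_polar, ← evenForm_polar, ← Matrix.mulVec_add, h, h, h]
  refine ⟨fun j => ?_, fun j => ?_, ?_⟩
  · have := h (Pi.single (Sum.inl j) 1)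
    simpa [evenForm, Matrix.mul_apply, toBlocks₁₁, toBlocks₂₁] using this
  · have := h (Pi.single (Sum.inr j) 1)
    simpa [evenForm, Matrix.mul_apply, toBlocks₁₂, toBlocks₂₂] using this
  · refine Matrix.ext fun a b => ?_
    have hab := key (Pi.single a 1) (Pi.single b 1)
    simp only [Matrix.mulVec_single_one, Matrix.col_apply] at hab
    have e1 : (Mᵀ * (fromBlocks 0 1 1 0 : Matrix (Fin n ⊕ Fin n) (Fin n ⊕ Fin n) k) * M) a b =
        ∑ i, (M (Sum.inl i) a * M (Sum.inr i) b + M (Sum.inl i) b * M (Sum.inr i) a) := by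
      rw [Matrix.mul_apply, Fintype.sum_sum_type, ← Finset.sum_add_distrib]
      refine Finset.sum_congr rfl fun i _ => ?_
      simp [Matrix.mul_apply, Matrix.one_apply]
      ring
    rw [e1, hab]
    rcases a with a | a <;> rcases b with b | b <;>
      simp [Pi.single_apply, Matrix.one_apply, eq_comm]

lemma trace_alt_symm (h2 : (2 : k) = 0) {X S : Matrix (Fin n) (Fin n) k}
    (hX : Xᵀ = X) (hX0 : ∀ j, X j j = 0) (hS : Sᵀ = S) : (X * S).trace = 0 := by
  simp only [Matrix.trace, Matrix.diag, Matrix.mul_apply]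
  rw [← Finset.sum_product']
  refine Finset.sum_involution (fun p _ => (p.2, p.1)) ?_ ?_ (by simp) (by simp)
  · intro p _
    have h1 : X p.2 p.1 = X p.1 p.2 := congrFun (congrFun hX p.1) p.2
    have h3 : S p.2 p.1 = S p.1 p.2 := congrFun (congrFun hS p.1) p.2
    simp only [h1, h3]
    linear_combination (X p.1 p.2 * S p.1 p.2) * h2
  · rintro ⟨i, j⟩ _ hne heq
    simp only [Prod.mk.injEq] at heq
    apply hne
    simp only [heq.1, hX0, zero_mul]

lemma dickson_eq_trace (M : Matrix (Fin n ⊕ Fin n) (Fin n ⊕ Fin n) k) :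
    dickson M = (M.toBlocks₁₂ᵀ * M.toBlocks₂₁).trace := by
  simp only [dickson, Matrix.trace, Matrix.diag, Matrix.mul_apply, Matrix.transpose_apply,
    toBlocks₁₂, toBlocks₂₁, Matrix.of_apply]
  exact Finset.sum_comm

/-- In characteristic two the Dickson invariant is additive on the orthogonal group. -/
lemma dickson_mul (h2 : (2 : k) = 0) {M N : Matrix (Fin n ⊕ Fin n) (Fin n ⊕ Fin n) k}
    (hM : ∀ x, evenForm k n (M.mulVec x) = evenForm k n x)
    (hN : ∀ x, evenForm k n (N.mulVec x) = evenForm k n x) :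
    dickson (M * N) = dickson M + dickson N := by
  obtain ⟨hX0, hY0, hJ⟩ := evenForm_blocks hM
  obtain ⟨-, -, hJ'⟩ := evenForm_blocks hN
  have hneg : ∀ P : Matrix (Fin n) (Fin n) k, -P = P := fun P => by
    ext i j
    simp only [Matrix.neg_apply]
    linear_combination (-(P i j)) * h2
  have hJJ : (fromBlocks 0 1 1 0 : Matrix (Fin n ⊕ Fin n) (Fin n ⊕ Fin n) k) *
      fromBlocks 0 1 1 0 = 1 := by
    simp [fromBlocks_multiply]
  have hJ'' : N * fromBlocks 0 1 1 0 * Nᵀ = fromBlocks 0 1 1 0 := by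
    have h1 : (fromBlocks 0 1 1 0 * Nᵀ * fromBlocks 0 1 1 0) * N = 1 := by
      rw [Matrix.mul_assoc, Matrix.mul_assoc, ← Matrix.mul_assoc Nᵀ, hJ', hJJ]
    have h3 := mul_eq_one_comm.mp h1
    calc N * fromBlocks 0 1 1 0 * Nᵀ
        = (N * (fromBlocks 0 1 1 0 * Nᵀ * fromBlocks 0 1 1 0)) * fromBlocks 0 1 1 0 := by
          simp only [Matrix.mul_assoc, hJJ, Matrix.mul_one]
      _ = fromBlocks 0 1 1 0 := by rw [h3, Matrix.one_mul]
  rw [dickson_eq_trace, dickson_eq_trace, dickson_eq_trace]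
  rw [← fromBlocks_toBlocks M] at hJ
  rw [← fromBlocks_toBlocks N] at hJ''
  rw [← fromBlocks_toBlocks M, ← fromBlocks_toBlocks N, fromBlocks_multiply]
  simp only [toBlocks_fromBlocks₁₂, toBlocks_fromBlocks₂₁]
  generalize M.toBlocks₁₁ = A at *
  generalize M.toBlocks₁₂ = B at *
  generalize M.toBlocks₂₁ = C at *
  generalize M.toBlocks₂₂ = D at *
  generalize N.toBlocks₁₁ = A' at *
  generalize N.toBlocks₁₂ = B' at *
  generalize N.toBlocks₂₁ = C' at *
  generalize N.toBlocks₂₂ = D' at *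
  simp only [fromBlocks_transpose, fromBlocks_multiply, fromBlocks_inj, Matrix.mul_zero,
    Matrix.mul_one, zero_add, add_zero] at hJ hJ''
  obtain ⟨r1, r2, r3, r4⟩ := hJ
  obtain ⟨q1, q2, q3, q4⟩ := hJ''
  have eq_of_add : ∀ {P Q : Matrix (Fin n) (Fin n) k}, P + Q = 0 → P = Q := by
    intro P Q h
    rw [eq_neg_of_add_eq_zero_left h, hneg]
  have hX : (Aᵀ * C)ᵀ = Aᵀ * C := by
    rw [Matrix.transpose_mul, Matrix.transpose_transpose]; exact eq_of_add r1
  have hY : (Bᵀ * D)ᵀ = Bᵀ * D := by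
    rw [Matrix.transpose_mul, Matrix.transpose_transpose]; exact eq_of_add r4
  have hS : (A' * B'ᵀ)ᵀ = A' * B'ᵀ := by
    rw [Matrix.transpose_mul, Matrix.transpose_transpose]; exact eq_of_add q1
  have hS' : (C' * D'ᵀ)ᵀ = C' * D'ᵀ := by
    rw [Matrix.transpose_mul, Matrix.transpose_transpose]; exact eq_of_add q4
  have t1 : (B'ᵀ * (Aᵀ * C) * A').trace = 0 := by
    rw [Matrix.mul_assoc, Matrix.trace_mul_comm, Matrix.mul_assoc]
    exact trace_alt_symm h2 hX hX0 hS
  have t2 : (D'ᵀ * (Bᵀ * D) * C').trace = 0 := by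
    rw [Matrix.mul_assoc, Matrix.trace_mul_comm, Matrix.mul_assoc]
    exact trace_alt_symm h2 hY hY0 hS'
  have hAD : Aᵀ * D = 1 + Cᵀ * B := by
    rw [← r2, add_right_comm]
    have : Cᵀ * B + Cᵀ * B = 0 := by
      nth_rewrite 1 [← hneg (Cᵀ * B)]; exact neg_add_cancel _
    rw [this, zero_add]
  have e : (A * B' + B * D')ᵀ * (C * A' + D * C') =
      B'ᵀ * (Aᵀ * C) * A' + D'ᵀ * (Bᵀ * D) * C' + B'ᵀ * (Aᵀ * D) * C' +
        D'ᵀ * (Bᵀ * C) * A' := by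
    simp only [Matrix.transpose_add, Matrix.transpose_mul, Matrix.add_mul, Matrix.mul_add,
      Matrix.mul_assoc]
    abel
  rw [e, Matrix.trace_add, Matrix.trace_add, Matrix.trace_add, t1, t2, hAD, Matrix.mul_add,
    Matrix.add_mul, Matrix.mul_one, Matrix.trace_add]
  have t3 : (D'ᵀ * (Bᵀ * C) * A').trace = (Cᵀ * B * (D' * A'ᵀ)).trace := by
    rw [← Matrix.trace_transpose]
    simp only [Matrix.transpose_mul, Matrix.transpose_transpose]
    rw [Matrix.trace_mul_comm, Matrix.mul_assoc]
  have t4 : (B'ᵀ * (Cᵀ * B) * C').trace = (Cᵀ * B * (C' * B'ᵀ)).trace := by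
    rw [Matrix.mul_assoc, Matrix.trace_mul_comm, Matrix.mul_assoc]
  have t5 : (Cᵀ * B * (D' * A'ᵀ)).trace + (Cᵀ * B * (C' * B'ᵀ)).trace = (Bᵀ * C).trace := by
    rw [← Matrix.trace_add, ← Matrix.mul_add, add_comm (D' * A'ᵀ)]
    have : C' * B'ᵀ + D' * A'ᵀ = 1 := by rw [← q3, add_comm]
    rw [this, Matrix.mul_one, ← Matrix.trace_transpose]
    simp
  rw [t3, t4]
  linear_combination t5

end Dickson

/-- `SO_{2n}`: matrices of determinant one that preserve the split quadratic form and, in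
characteristic two, have trivial Dickson invariant. -/
def SOeven (k : Type u) [Field k] (n : ℕ) :
    Subgroup (Matrix.SpecialLinearGroup (Fin n ⊕ Fin n) k) where
  carrier := {g | (∀ x, evenForm k n (g.1.mulVec x) = evenForm k n x) ∧
    ((2 : k) = 0 → dickson g.1 = 0)}
  mul_mem' := by
    intro a b ha hb
    refine ⟨fun x => ?_, fun h2 => ?_⟩
    · rw [Matrix.SpecialLinearGroup.coe_mul, ← Matrix.mulVec_mulVec, ha.1, hb.1]
    · rw [Matrix.SpecialLinearGroup.coe_mul, dickson_mul h2 ha.1 hb.1, ha.2 h2, hb.2 h2, add_zero]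
  one_mem' := by
    refine ⟨fun x => by simp, fun _ => by simp [dickson]⟩
  inv_mem' := by
    intro a ha
    have h : a.1 * (a⁻¹).1 = 1 := by
      rw [← Matrix.SpecialLinearGroup.coe_mul, mul_inv_cancel, Matrix.SpecialLinearGroup.coe_one]
    have hq : ∀ x, evenForm k n ((a⁻¹).1.mulVec x) = evenForm k n x := by
      intro x
      rw [← ha.1, Matrix.mulVec_mulVec, h, Matrix.one_mulVec]
    refine ⟨hq, fun h2 => ?_⟩
    have h3 := dickson_mul h2 ha.1 hq
    rw [h, ha.2 h2, zero_add] at h3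
    rw [← h3]
    simp [dickson]

/-! ### The infinite rank groups -/

/-- The space with basis `e_z`, `z ∈ ℤ`, on which all the groups act. -/
abbrev V (k : Type u) [Field k] : Type u := ℤ →₀ k

/-- The basis vector `e_z`. -/
def e (k : Type u) [Field k] (z : ℤ) : V k := Finsupp.single z 1

section Embed

variable {k : Type u} [Field k] {J : Type} [Fintype J] [DecidableEq J]

/-- The inclusion `k^J → V` along an embedding of index sets. -/
def inc (c : J ↪ ℤ) : (J → k) →ₗ[k] V k := Fintype.linearCombination k fun j => e k (c j)

/-- The projection `V → k^J` along an embedding of index sets. -/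
def res (c : J ↪ ℤ) : V k →ₗ[k] (J → k) :=
  LinearMap.pi fun j => Finsupp.lapply (c j)

lemma res_inc (c : J ↪ ℤ) (x : J → k) : res c (inc c x) = x := by
  ext j
  simp [res, inc, Fintype.linearCombination_apply, e, Finsupp.single_apply]

/-- The `J × J` matrix `M`, acting on the span of the `e_{c j}`, extended by the identity on the
other basis vectors. -/
def embed (c : J ↪ ℤ) : Matrix J J k →* Module.End k (V k) where
  toFun M := 1 + inc c ∘ₗ Matrix.toLin' (M - 1) ∘ₗ res c
  map_one' := by simp
  map_mul' M N := by
    have h : ∀ (P : Matrix J J k) (x : V k),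
        (1 + inc c ∘ₗ Matrix.toLin' (P - 1) ∘ₗ res c : Module.End k (V k)) x =
          x + (inc c (P.mulVec (res c x)) - inc c (res c x)) := by
      intro P x
      rw [← map_sub]
      simp
    refine LinearMap.ext fun x => ?_
    rw [Module.End.mul_apply, h, h, h]
    simp only [map_add, map_sub, res_inc, Matrix.mulVec_add, Matrix.mulVec_sub,
      Matrix.mulVec_mulVec]
    abel

lemma embed_apply_mem (c : J ↪ ℤ) (M : Matrix J J k) (j : J) :
    embed c M (e k (c j)) = ∑ i, M i j • e k (c i) := by
  have h : res c (e k (c j)) = Pi.single j 1 := by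
    ext i
    simp [res, e, Finsupp.single_apply, Pi.single_apply, eq_comm]
  have h1 : inc c (Pi.single j (1 : k)) = e k (c j) := by
    simp [inc]
  have h2 : inc c ((M - 1).mulVec (Pi.single j 1)) = ∑ i, M i j • e k (c i) - e k (c j) := by
    rw [Matrix.sub_mulVec, Matrix.one_mulVec, map_sub, h1, Matrix.mulVec_single_one]
    simp [inc, Fintype.linearCombination_apply]
  have h3 : embed c M (e k (c j)) =
      e k (c j) + inc c ((M - 1).mulVec (res c (e k (c j)))) := rfl
  rw [h3]
  rw [h, h2]
  abel

lemma embed_apply_notMem (c : J ↪ ℤ) (M : Matrix J J k) {z : ℤ} (hz : ∀ j, c j ≠ z) :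
    embed c M (e k z) = e k z := by
  have h : res c (e k z) = 0 := by
    ext i
    simp [res, e, (hz i).symm]
  change e k z + inc c ((M - 1).mulVec (res c (e k z))) = _
  rw [h]
  simp

end Embed

/-- Coordinates `1, …, n`. -/
def coordA (n : ℕ) : Fin n ↪ ℤ where
  toFun i := (i : ℤ) + 1
  inj' := by
    intro i j h
    simp only at h
    ext
    omega

/-- Coordinates `-1, …, -n` (first half) and `1, …, n` (second half); the `i`-th coordinates of
the two halves are opposite. -/
def coordD (n : ℕ) : Fin n ⊕ Fin n ↪ ℤ where
  toFun := Sum.elim (fun i => -((i : ℤ) + 1)) fun i => (i : ℤ) + 1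
  inj' := by
    rintro (i | i) (j | j) h <;> simp only [Sum.elim_inl, Sum.elim_inr] at h
    · congr 1; ext; omega
    · omega
    · omega
    · congr 1; ext; omega

/-- Coordinates as in `coordD`, and in addition the coordinate `0`. -/
def coordB (n : ℕ) : (Fin n ⊕ Fin n) ⊕ Unit ↪ ℤ where
  toFun := Sum.elim (coordD n) fun _ => 0
  inj' := by
    rintro (i | i) (j | j) h
    · exact congrArg _ ((coordD n).injective h)
    · rcases i with i | i <;> simp [coordD] at h <;> omega
    · rcases j with j | j <;> simp [coordD] at h <;> omega
    · rfl

/-- The five families `GL_n`, `SL_n`, `SO_{2n}`, `SO_{2n+1}`, `Sp_{2n}`. -/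
inductive Family
  | GL
  | SL
  | SOeven
  | SOodd
  | Sp

/-- The group of invertible endomorphisms of `V`. -/
abbrev GLV (k : Type u) [Field k] : Type u := (Module.End k (V k))ˣ

/-- The image in `GL(V)` of the `n`-th group of a family; it increases with `n`. -/
def level (X : Family) (k : Type u) [Field k] (n : ℕ) : Subgroup (GLV k) :=
  match X with
  | .GL => (Units.map (embed (k := k) (coordA n))).range
  | .SL => ((embed (k := k) (coordA n)).comp
      Matrix.SpecialLinearGroup.coeMonoidHom).toHomUnits.range
  | .SOeven => (((embed (k := k) (coordD n)).comp
      Matrix.SpecialLinearGroup.coeMonoidHom).comp (SOeven k n).subtype).toHomUnits.range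
  | .SOodd => (((embed (k := k) (coordB n)).comp
      Matrix.SpecialLinearGroup.coeMonoidHom).comp (SOodd k n).subtype).toHomUnits.range
  | .Sp => ((embed (k := k) (coordD n)).comp
      (Matrix.symplecticGroup (Fin n) k).subtype).toHomUnits.range

/-- `G_∞`, the union of the increasing sequence of groups `G_n`. -/
def Ginf (X : Family) (k : Type u) [Field k] : Subgroup (GLV k) := ⨆ n, level X k n

/-! ### Torus, Borel subgroup, unipotent subgroups, Weyl group -/

section Subgroups

variable (X : Family) (k : Type u) [Field k]

/-- The action of an element of `G_∞` on `V`. -/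
abbrev act {X : Family} {k : Type u} [Field k] (g : Ginf X k) : V k →ₗ[k] V k := g.1.1

/-- The span of the basis vectors indexed by `s`. -/
def spanOf (s : Set ℤ) : Submodule k (V k) := Finsupp.supported k k s

variable {X k} in
lemma act_inv_act (g : Ginf X k) (x : V k) : act g⁻¹ (act g x) = x := by
  have h : g.1⁻¹.1 * g.1.1 = 1 := by rw [← Units.val_mul, inv_mul_cancel, Units.val_one]
  exact LinearMap.congr_fun h x

variable {X k} in
lemma act_act_inv (g : Ginf X k) (x : V k) : act g (act g⁻¹ x) = x := by
  have h : g.1.1 * g.1⁻¹.1 = 1 := by rw [← Units.val_mul, mul_inv_cancel, Units.val_one]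
  exact LinearMap.congr_fun h x

variable {X k} in
lemma act_mul (g h : Ginf X k) (x : V k) : act (g * h) x = act g (act h x) := rfl

variable {X k} in
/-- `g` maps a subspace onto itself, expressed through `g` and its inverse. -/
lemma map_eq_iff (g : Ginf X k) (F : Submodule k (V k)) :
    F.map (act g) = F ↔ ∀ x, act g x ∈ F ↔ x ∈ F := by
  constructor
  · intro h x
    constructor
    · intro hx
      rw [← h] at hx
      obtain ⟨y, hy, hyx⟩ := hx
      have : y = x := by rw [← act_inv_act g y, hyx, act_inv_act]
      exact this ▸ hy
    · intro hx
      rw [← h]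
      exact ⟨x, hx, rfl⟩
  · intro h
    ext x
    constructor
    · rintro ⟨y, hy, rfl⟩
      exact (h y).2 hy
    · intro hx
      exact ⟨act g⁻¹ x, (h _).1 (by rwa [act_act_inv]), act_act_inv g x⟩

/-- The torus `T` of diagonal elements of `G_∞`. -/
def T : Subgroup (Ginf X k) where
  carrier := {g | ∀ z, ∃ a : kˣ, act g (e k z) = a • e k z}
  one_mem' z := ⟨1, by simp [act]⟩
  mul_mem' := by
    intro g h hg hh z
    obtain ⟨a, ha⟩ := hg z
    obtain ⟨b, hb⟩ := hh z
    exact ⟨a * b, by rw [act_mul, hb, Units.smul_def, map_smul, ha, Units.smul_def, smul_smul,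
      Units.smul_def, Units.val_mul, mul_comm]⟩
  inv_mem' := by
    intro g hg z
    obtain ⟨a, ha⟩ := hg z
    refine ⟨a⁻¹, ?_⟩
    have h := act_inv_act g (e k z)
    rw [ha, Units.smul_def, map_smul] at h
    nth_rewrite 2 [← h]
    rw [Units.smul_def, smul_smul, Units.inv_mul, one_smul]

/-- The normalizer `N` of `T` in `G_∞`. -/
def N : Subgroup (Ginf X k) := Subgroup.normalizer (T X k : Set (Ginf X k))

/-- The elements of `G_∞` that stabilize every span of a set of basis vectors `e_i`, `i ∈ s z`. -/
def stab (s : ℤ → Set ℤ) : Subgroup (Ginf X k) where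
  carrier := {g | ∀ z, (spanOf k (s z)).map (act g) = spanOf k (s z)}
  one_mem' z := (map_eq_iff _ _).2 fun _ => Iff.rfl
  mul_mem' := by
    intro g h hg hh z
    exact (map_eq_iff _ _).2 fun x => by
      rw [act_mul, (map_eq_iff _ _).1 (hg z), (map_eq_iff _ _).1 (hh z)]
  inv_mem' := by
    intro g hg z
    exact (map_eq_iff _ _).2 fun x => by
      rw [← (map_eq_iff _ _).1 (hg z), act_act_inv]

/-- The elements of `stab s` that moreover satisfy `g e_z ∈ e_z + span (e_i, i ∈ s z)`. -/
def unip (s : ℤ → Set ℤ) : Subgroup (Ginf X k) where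
  carrier := {g | g ∈ stab X k s ∧ ∀ z, act g (e k z) - e k z ∈ spanOf k (s z)}
  one_mem' := ⟨one_mem _, fun z => by simp [act]⟩
  mul_mem' := by
    intro g h hg hh
    refine ⟨mul_mem hg.1 hh.1, fun z => ?_⟩
    have h1 : act (g * h) (e k z) - e k z =
        act g (act h (e k z) - e k z) + (act g (e k z) - e k z) := by
      rw [act_mul, map_sub]; abel
    rw [h1]
    exact add_mem (((map_eq_iff _ _).1 (hg.1 z) _).2 (hh.2 z)) (hg.2 z)
  inv_mem' := by
    intro g hg
    refine ⟨inv_mem hg.1, fun z => ?_⟩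
    rw [← (map_eq_iff _ _).1 (hg.1 z), map_sub, act_act_inv, ← neg_sub]
    exact neg_mem (hg.2 z)

/-- The Borel subgroup `B`: the stabilizer of the flag of the subspaces `⟨e_i, i < z⟩`, that is,
the group of upper triangular elements of `G_∞`. -/
def B : Subgroup (Ginf X k) := stab X k Set.Iio

/-- The group `U` of upper unitriangular elements of `G_∞`, the kernel of `B → T`. -/
def U : Subgroup (Ginf X k) := unip X k Set.Iio

/-- The group of lower unitriangular elements of `G_∞`. -/
def Uminus : Subgroup (Ginf X k) := unip X k Set.Ioi

end Subgroups

/-- The permutation of the coordinates `ℤ` that is induced by the `i`-th simple reflection of the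
Weyl group with respect to `B`. -/
def simpleRefl : Family → ℕ → Equiv.Perm ℤ
  | .GL, i => Equiv.swap ((i : ℤ) + 1) (i + 2)
  | .SL, i => Equiv.swap ((i : ℤ) + 1) (i + 2)
  | .SOodd, 0 => Equiv.swap 1 (-1)
  | .Sp, 0 => Equiv.swap 1 (-1)
  | .SOeven, 0 => Equiv.swap 1 (-2) * Equiv.swap 2 (-1)
  | _, (i + 1) => Equiv.swap ((i : ℤ) + 1) (i + 2) * Equiv.swap (-((i : ℤ) + 1)) (-((i : ℤ) + 2))

/-- `n ∈ N` represents the `i`-th simple reflection `s_i ∈ W = N / T`: it permutes the lines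
`k e_z` as `s_i` does. Two such elements differ by an element of `T`. -/
def Represents {X : Family} {k : Type u} [Field k] (n : Ginf X k) (i : ℕ) : Prop :=
  n ∈ N X k ∧ ∀ z, ∃ a : kˣ, act n (e k z) = a • e k (simpleRefl X i z)

section Steinberg

variable {X : Family} {k : Type u} [Field k]

/-- `U_i`, the elements `u ∈ U` with `n_i u n_i⁻¹` lower triangular. -/
def Usub (n : Ginf X k) : Subgroup (Ginf X k) :=
  U X k ⊓ (Uminus X k).comap (MulAut.conj n).toMonoidHom

/-- `U_i'`, the elements `u ∈ U` with `n_i u n_i⁻¹ ∈ U`. -/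
def Usub' (n : Ginf X k) : Subgroup (Ginf X k) :=
  U X k ⊓ (U X k).comap (MulAut.conj n).toMonoidHom

lemma conj_mem_of_mem_Usub' {n u : Ginf X k} (hu : u ∈ Usub' n) : n * u * n⁻¹ ∈ U X k := hu.2

/-- Diagonal elements stabilize the span of any set of basis vectors. -/
lemma T_le_stab (s : ℤ → Set ℤ) : T X k ≤ stab X k s := by
  have h1 : ∀ (t : Ginf X k), t ∈ T X k → ∀ (r : Set ℤ) (x : V k),
      x ∈ spanOf k r → act t x ∈ spanOf k r := by
    intro t ht r x hx
    have hle : spanOf k r ≤ (spanOf k r).comap (act t) := by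
      rw [spanOf, Finsupp.supported_eq_span_single, Submodule.span_le]
      rintro _ ⟨z, hz, rfl⟩
      obtain ⟨a, ha⟩ := ht z
      have hez : (fun i => Finsupp.single i (1 : k)) z = e k z := rfl
      rw [hez, SetLike.mem_coe, Submodule.mem_comap, ha, Units.smul_def]
      exact Submodule.smul_mem _ _ (Submodule.subset_span ⟨z, hz, rfl⟩)
    exact hle hx
  intro t ht z
  refine (map_eq_iff _ _).2 fun x => ⟨fun hx => ?_, h1 t ht _ x⟩
  rw [← act_inv_act t x]
  exact h1 _ (inv_mem ht) _ _ hx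

/-- `T` normalizes `U`. -/
lemma conj_mem_of_mem_T {t u : Ginf X k} (ht : t ∈ T X k) (hu : u ∈ U X k) :
    t * u * t⁻¹ ∈ U X k := by
  have hts := T_le_stab (X := X) (k := k) Set.Iio ht
  refine ⟨mul_mem (mul_mem hts hu.1) (inv_mem hts), fun z => ?_⟩
  obtain ⟨a, ha⟩ := inv_mem ht z
  rw [← (map_eq_iff _ _).1 (inv_mem hts z), map_sub, act_mul, act_mul, act_inv_act, ha,
    Units.smul_def, map_smul, ← smul_sub]
  exact Submodule.smul_mem _ _ (hu.2 z)

/-- The space `K U ξ` underlying the free `K U`-module of rank one: `u ξ` is the basis vector of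
the group algebra that belongs to `u`. -/
abbrev St (X : Family) (k : Type u) [Field k] (K : Type v) [Field K] : Type (max u v) :=
  MonoidAlgebra K (U X k)

/-- The vector `u ξ`. -/
def xi (K : Type v) [Field K] (u : Ginf X k) (hu : u ∈ U X k) : St X k K :=
  MonoidAlgebra.single ⟨u, hu⟩ 1

/-- A `K G`-module structure on `K U ξ` that extends the `K U`-module structure and satisfies the
formulas for the action of `T` and of the chosen representatives `n_i`. -/
structure IsSteinberg (K : Type v) [Field K] (n : ℕ → Ginf X k)
    (ρ : Representation K (Ginf X k) (St X k K)) : Prop where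
  extends_U : ∀ (u : Ginf X k) (hu : u ∈ U X k) (f : St X k K), ρ u f = xi K u hu * f
  torus : ∀ (t : Ginf X k) (ht : t ∈ T X k) (u : Ginf X k) (hu : u ∈ U X k),
    ρ t (xi K u hu) = xi K (t * u * t⁻¹) (conj_mem_of_mem_T ht hu)
  reflection : ∀ (i : ℕ) (u : Ginf X k) (hu : u ∈ Usub' (n i)),
    ρ (n i) (xi K u hu.1) = - xi K (n i * u * (n i)⁻¹) (conj_mem_of_mem_Usub' hu)
  reflection' : ∀ (i : ℕ) (u' : Ginf X k) (hu' : u' ∈ Usub' (n i))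
    (w : Ginf X k) (hw : w ∈ Usub (n i)), w ≠ 1 →
    ∀ (x : Ginf X k) (hx : x ∈ Usub (n i)),
    (∃ t ∈ T X k, ∃ y ∈ Usub (n i), n i * w * (n i)⁻¹ = x * n i * t * y) →
    ρ (n i) (xi K (u' * w) (mul_mem hu'.1 hw.1)) =
      xi K (n i * u' * (n i)⁻¹) (conj_mem_of_mem_Usub' hu') * (xi K x hx.1 - 1)

end Steinberg

/-- The one-dimensional representation given by a character. -/
def ofCharacter {H : Type u} [Group H] {K : Type v} [Field K] (χ : H →* Kˣ) :
    Representation K H K where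
  toFun h := LinearMap.mulLeft K (χ h : K)
  map_one' := by ext; simp
  map_mul' _ _ := by ext; simp

/-- The character `χ` of `B` is `θ` regarded as a character of `B` through `B → T`: it restricts
to `θ` on `T` and is trivial on `U`. -/
def IsInflation {X : Family} {k : Type u} [Field k] {K : Type v} [Field K]
    (θ : T X k →* Kˣ) (χ : B X k →* Kˣ) : Prop :=
  (∀ (t : T X k) (b : B X k), (b : Ginf X k) = t → χ b = θ t) ∧
    ∀ b : B X k, (b : Ginf X k) ∈ U X k → χ b = 1

/-- The induced module `M(θ) = K G ⊗_{K B} K_χ`. -/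
abbrev M {X : Family} {k : Type u} [Field k] {K : Type v} [Field K] (χ : B X k →* Kˣ) :=
  Representation.ind (B X k).subtype (ofCharacter χ)

end FinitaryClassical

end

noncomputable section

universe u v

namespace FinitaryClassical

variable {k : Type u} [Field k]

set_option linter.unusedSectionVars false
set_option linter.unusedSimpArgs false

/-! ### Forms on the space `V` -/

/-! The Steinberg module is found inside the functions on `G`, on which `G` acts by left
translation. In finite rank its generator is the alternating sum of the cosets `w B`, `w ∈ W = N /
T`. For infinite `W` this sum is no element of `K[G/B]`, but it is still a function on `G`: the
value is the sign of `w` on `w B` and zero outside `N B`. Call it `η` (`eta`). The map `psi` sends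
`u ξ` to the translate `u η`. It is injective with `G`-stable image, and the required formulas are
identities between translates of `η`, so the module structure is obtained by transport.

The formulas. `T` fixes `η`, and a representative `n_i` changes its sign. Moreover `η = f - n_i f`,
where `f` (`etaPos`) is the part of `η` on the cosets `w B` for which `w⁻¹` keeps the `i`-th simple
root positive; `f` is fixed by `T` and by `U_i`. If `n_i w n_i⁻¹ = x n_i t y`, then `n_i w n_i f = x
n_i t y n_i² f = x n_i f`, hence `n_i w η = x η - η` (`leftReg_eta_Usub`).

Injectivity (`psi_injective`). `W` has no longest element, but finitely many elements of `U` lie in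
some `G_n`, and a monomial `v` reverses the order of all coordinates of a possibly larger `G_n`. For
`u, u₀` among these elements, `u⁻¹ u₀ v⁻¹ ∈ N B` puts the lower unitriangular element `v u⁻¹ u₀ v⁻¹`
into `N B`, which forces `u = u₀`. Evaluation at `u₀ v⁻¹` therefore isolates the coefficient of
`u₀`.

Stability of the image and uniqueness of the structure both follow from generation of `G` by `T`,
`U` and the `n_i` (`gen_eq_top`). This is elimination: rank one elements move the images of basis
vectors back into the standard flag until the product lies in `B`. With a form it suffices to treat
negative coordinates, since orthogonal spaces follow; for `SO_{2n}` the last step needs the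
determinant and the Dickson invariant.

In rank one, `U_i` has a single parameter, a matrix coefficient (`marker`), and the isometry
equations determine the remaining coefficients at the inversions of `s_i`. This gives `U = U_i'
U_i`; the element `x` comes from explicit identities of `SL_2` type, or `SO_3` type for the short
root.

For the tensor product, `B = T U` shows that `St` restricted to `B` is induced from the trivial
module of `T`. Hence `M(θ) ⊗ St ≅ Ind_B^G (K_θ ⊗ St) ≅ Ind_T^G K_θ`; `nonempty_equiv_of_isInduced`
writes both directions down. -/

/-- The bilinear form `∑_{z > 0} x_z y_{-z}`. -/
def half (k : Type u) [Field k] : V k →ₗ[k] V k →ₗ[k] k :=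
  Finsupp.lsum k fun z => if 0 < z then LinearMap.toSpanSingleton k _ (Finsupp.lapply (-z)) else 0

lemma e_apply (z w : ℤ) : e k z w = if z = w then 1 else 0 := Finsupp.single_apply

lemma half_e_left (z : ℤ) (y : V k) : half k (e k z) y = if 0 < z then y (-z) else 0 := by
  rw [half, e, Finsupp.lsum_single]
  split_ifs <;> simp

lemma half_e_right (x : V k) (z : ℤ) : half k x (e k z) = if z < 0 then x (-z) else 0 := by
  have h : (half k).flip (e k z) =
      if z < 0 then (Finsupp.lapply (-z) : V k →ₗ[k] k) else 0 := by
    refine Finsupp.lhom_ext' fun w => LinearMap.ext_ring ?_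
    have := half_e_left (k := k) w (e k z)
    rw [e_apply] at this
    simp only [LinearMap.comp_apply, Finsupp.lsingle_apply, LinearMap.flip_apply]
    refine this.trans ?_
    by_cases hw : z = -w
    · subst hw
      by_cases h0 : 0 < w <;> simp [h0]
    · have : ¬ w = -z := fun h => hw (by omega)
      by_cases h0 : z < 0 <;> simp [h0, hw, this]
  rw [← LinearMap.flip_apply, h]
  split_ifs <;> simp

/-- The isometry condition of a family of classical groups. -/
def Iso : Family → Module.End k (V k) → Prop
  | .GL, _ => True
  | .SL, _ => True
  | .SOeven, f => ∀ x, half k (f x) (f x) = half k x x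
  | .SOodd, f => ∀ x, half k (f x) (f x) + f x 0 ^ 2 = half k x x + x 0 ^ 2
  | .Sp, f => ∀ x y, half k (f x) (f y) - half k (f y) (f x) = half k x y - half k y x

/-- The coordinates that belong to a family. -/
def coords : Family → Set ℤ
  | .GL => {z | 0 < z}
  | .SL => {z | 0 < z}
  | .SOeven => {z | z ≠ 0}
  | .SOodd => Set.univ
  | .Sp => {z | z ≠ 0}

/-- The coordinates on which the `n`-th group of a family acts. -/
def box (X : Family) (n : ℕ) : Set ℤ := {z | z ∈ coords X ∧ -(n : ℤ) ≤ z ∧ z ≤ n}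

lemma coordA_apply (n : ℕ) (i : Fin n) : coordA n i = (i : ℤ) + 1 := rfl

lemma coordD_inl (n : ℕ) (i : Fin n) : coordD n (Sum.inl i) = -((i : ℤ) + 1) := rfl

lemma coordD_inr (n : ℕ) (i : Fin n) : coordD n (Sum.inr i) = (i : ℤ) + 1 := rfl

lemma coordB_inl (n : ℕ) (i : Fin n ⊕ Fin n) : coordB n (Sum.inl i) = coordD n i := rfl

lemma coordB_inr (n : ℕ) (i : Unit) : coordB n (Sum.inr i) = 0 := rfl

lemma range_coordA (n : ℕ) : Set.range (coordA n) = box .GL n := by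
  ext z
  constructor
  · rintro ⟨i, rfl⟩
    have := i.2
    rw [coordA_apply]
    refine ⟨?_, ?_, ?_⟩
    · change (0 : ℤ) < _
      omega
    · omega
    · omega
  · rintro ⟨h1 : 0 < z, -, h2⟩
    refine ⟨⟨(z - 1).toNat, by omega⟩, ?_⟩
    rw [coordA_apply, Fin.val_mk]
    omega

lemma range_coordD (n : ℕ) : Set.range (coordD n) = box .Sp n := by
  ext z
  constructor
  · rintro ⟨i | i, rfl⟩ <;> have := i.2 <;> simp only [coordD_inl, coordD_inr] <;>
    refine ⟨?_, ?_, ?_⟩ <;> first | omega | (change _ ≠ (0 : ℤ); omega)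
  · rintro ⟨h1 : z ≠ 0, h2, h3⟩
    rcases lt_or_gt_of_ne h1 with h | h
    · refine ⟨Sum.inl ⟨(-z - 1).toNat, by omega⟩, ?_⟩
      rw [coordD_inl, Fin.val_mk]
      omega
    · refine ⟨Sum.inr ⟨(z - 1).toNat, by omega⟩, ?_⟩
      rw [coordD_inr, Fin.val_mk]
      omega

lemma range_coordB (n : ℕ) : Set.range (coordB n) = box .SOodd n := by
  have h : Set.range (coordB n) = Set.range (coordD n) ∪ {0} := by
    ext z
    constructor
    · rintro ⟨i | i, rfl⟩
      · exact Or.inl ⟨i, rfl⟩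
      · exact Or.inr rfl
    · rintro (⟨i, rfl⟩ | h)
      · exact ⟨Sum.inl i, rfl⟩
      · exact ⟨Sum.inr (), (Set.mem_singleton_iff.1 h).symm⟩
  rw [h, range_coordD]
  ext z
  constructor
  · rintro (⟨-, h⟩ | h)
    · exact ⟨trivial, h⟩
    · rw [Set.mem_singleton_iff.1 h]
      exact ⟨trivial, by omega, by omega⟩
  · rintro ⟨-, h⟩
    by_cases h0 : z = 0
    · exact Or.inr h0
    · exact Or.inl ⟨h0, h⟩

/-! ### Matrices as finitary endomorphisms of `V` -/

section Embed

variable {J : Type} [Fintype J] [DecidableEq J]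

/-- The matrix of an endomorphism with respect to the basis vectors `e_{c j}`. -/
def matOf (c : J ↪ ℤ) (f : Module.End k (V k)) : Matrix J J k :=
  Matrix.of fun i j => f (e k (c j)) (c i)

lemma matOf_apply (c : J ↪ ℤ) (f : Module.End k (V k)) (i j : J) :
    matOf c f i j = f (e k (c j)) (c i) := rfl

lemma inc_apply (c : J ↪ ℤ) (y : J → k) (j : J) : inc c y (c j) = y j :=
  congrFun (res_inc c y) j

lemma inc_apply_notMem (c : J ↪ ℤ) (y : J → k) {z : ℤ} (hz : z ∉ Set.range c) :
    inc c y z = 0 := by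
  simp only [inc, Fintype.linearCombination_apply, Finsupp.finsetSum_apply, Finsupp.smul_apply,
    e_apply]
  exact Finset.sum_eq_zero fun j _ => by rw [if_neg fun h => hz ⟨j, h⟩, smul_zero]

lemma embed_apply (c : J ↪ ℤ) (M : Matrix J J k) (x : V k) :
    embed c M x = inc c (M.mulVec (res c x)) + (x - inc c (res c x)) := by
  change x + inc c ((M - 1).mulVec (res c x)) = _
  rw [Matrix.sub_mulVec, Matrix.one_mulVec, map_sub]
  abel

lemma embed_inc (c : J ↪ ℤ) (M : Matrix J J k) (y : J → k) :
    embed c M (inc c y) = inc c (M.mulVec y) := by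
  rw [embed_apply, res_inc, sub_self, add_zero]

lemma sum_smul_e_apply (c : J ↪ ℤ) (y : J → k) :
    ∑ i, y i • e k (c i) = inc c y := by
  simp [inc, Fintype.linearCombination_apply]

lemma embed_e (c : J ↪ ℤ) (M : Matrix J J k) (j : J) :
    embed c M (e k (c j)) = inc c fun i => M i j := by
  rw [embed_apply_mem, ← sum_smul_e_apply]

lemma matOf_embed (c : J ↪ ℤ) (M : Matrix J J k) : matOf c (embed c M) = M := by
  ext i j
  rw [matOf_apply, embed_e, inc_apply]

lemma mem_spanOf {s : Set ℤ} {x : V k} : x ∈ spanOf k s ↔ ∀ z, z ∉ s → x z = 0 := by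
  rw [spanOf, Finsupp.mem_supported']

lemma e_mem_spanOf {s : Set ℤ} {z : ℤ} (h : z ∈ s) : e k z ∈ spanOf k s := by
  rw [mem_spanOf]
  intro w hw
  rw [e_apply, if_neg]
  rintro rfl
  exact hw h

lemma inc_res_of_mem (c : J ↪ ℤ) {x : V k} (hx : x ∈ spanOf k (Set.range c)) :
    inc c (res c x) = x := by
  ext z
  by_cases hz : z ∈ Set.range c
  · obtain ⟨j, rfl⟩ := hz
    rw [inc_apply]
    rfl
  · rw [inc_apply_notMem c _ hz, mem_spanOf.1 hx z hz]

lemma hom_ext_e {W : Type*} [AddCommGroup W] [Module k W] {f g : V k →ₗ[k] W}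
    (h : ∀ z, f (e k z) = g (e k z)) : f = g :=
  Finsupp.lhom_ext' fun z => LinearMap.ext_ring (h z)

lemma embed_matOf (c : J ↪ ℤ) (f : Module.End k (V k))
    (h1 : ∀ z, z ∉ Set.range c → f (e k z) = e k z)
    (h2 : ∀ z, z ∈ Set.range c → f (e k z) ∈ spanOf k (Set.range c)) :
    embed c (matOf c f) = f := by
  refine hom_ext_e fun z => ?_
  by_cases hz : z ∈ Set.range c
  · have := h2 z hz
    obtain ⟨j, rfl⟩ := hz
    rw [embed_e, ← inc_res_of_mem c this]
    rfl
  · rw [h1 z hz, embed_apply_notMem]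
    exact fun j hj => hz ⟨j, hj⟩

lemma embed_fix (c : J ↪ ℤ) (M : Matrix J J k) {z : ℤ} (hz : z ∉ Set.range c) :
    embed c M (e k z) = e k z :=
  embed_apply_notMem _ _ fun j hj => hz ⟨j, hj⟩

lemma embed_mem_spanOf (c : J ↪ ℤ) (M : Matrix J J k) {z : ℤ} (hz : z ∈ Set.range c) :
    embed c M (e k z) ∈ spanOf k (Set.range c) := by
  obtain ⟨j, rfl⟩ := hz
  rw [embed_e, mem_spanOf]
  exact fun w hw => inc_apply_notMem c _ hw

/-- Endomorphisms with the same finite support restriction are given by the same matrix. -/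
lemma exists_embed_eq_iff (c : J ↪ ℤ) (f : Module.End k (V k)) (P : Matrix J J k → Prop) :
    (∃ M, P M ∧ embed c M = f) ↔ (∀ z, z ∉ Set.range c → f (e k z) = e k z) ∧
      (∀ z, z ∈ Set.range c → f (e k z) ∈ spanOf k (Set.range c)) ∧ P (matOf c f) := by
  constructor
  · rintro ⟨M, hM, rfl⟩
    exact ⟨fun z => embed_fix c M, fun z => embed_mem_spanOf c M, by rwa [matOf_embed]⟩
  · rintro ⟨h1, h2, h3⟩
    exact ⟨_, h3, embed_matOf c f h1 h2⟩

/-- An invertible endomorphism is injective on the span of the `e_{c j}`, where it acts through `M`,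
and an injective square matrix over a field is invertible. -/
lemma isUnit_det_of_embed (c : J ↪ ℤ) (M : Matrix J J k) {g : GLV k} (h : embed c M = g.1) :
    IsUnit M.det := by
  rw [← Matrix.isUnit_iff_isUnit_det, ← Matrix.mulVec_injective_iff_isUnit]
  intro x y hxy
  have h1 : g.1 (inc c x) = g.1 (inc c y) := by
    rw [← h, embed_inc, embed_inc]
    exact congrArg _ hxy
  have h2 : inc c x = inc c y := by
    have h3 : g⁻¹.1 * g.1 = 1 := by rw [← Units.val_mul, inv_mul_cancel, Units.val_one]
    have := congrArg g⁻¹.1 h1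
    rwa [← Module.End.mul_apply, ← Module.End.mul_apply, h3] at this
  rw [← res_inc c x, h2, res_inc]

lemma half_inc_left (c : J ↪ ℤ) (y : J → k) (r : V k) :
    half k (inc c y) r = ∑ j, y j * if 0 < c j then r (-(c j)) else 0 := by
  rw [← sum_smul_e_apply, map_sum, LinearMap.sum_apply]
  simp only [map_smul, LinearMap.smul_apply, half_e_left, smul_eq_mul]

lemma half_inc_right (c : J ↪ ℤ) (y : J → k) (r : V k) :
    half k r (inc c y) = ∑ j, y j * if c j < 0 then r (-(c j)) else 0 := by
  rw [← sum_smul_e_apply, map_sum]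
  simp only [map_smul, half_e_right, smul_eq_mul]

/-- `half` is additive along the decomposition of `V` into the span of `e_{c j}` and the span of
the remaining basis vectors. -/
lemma half_split (c : J ↪ ℤ) (hc : ∀ z, z ∈ Set.range c → -z ∈ Set.range c) (y y' : J → k)
    {r r' : V k} (hr : res c r = 0) (hr' : res c r' = 0) :
    half k (inc c y + r) (inc c y' + r') = half k (inc c y) (inc c y') + half k r r' := by
  have h0 : ∀ {s : V k}, res c s = 0 → ∀ j, s (-(c j)) = 0 := by
    intro s hs j
    obtain ⟨i, hi⟩ := hc (c j) ⟨j, rfl⟩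
    rw [← hi]
    exact congrFun hs i
  have h1 : half k (inc c y) r' = 0 := by
    rw [half_inc_left]
    exact Finset.sum_eq_zero fun j _ => by rw [h0 hr']; simp
  have h2 : half k r (inc c y') = 0 := by
    rw [half_inc_right]
    exact Finset.sum_eq_zero fun j _ => by rw [h0 hr]; simp
  simp only [map_add, LinearMap.add_apply, h1, h2]
  abel

lemma res_sub_inc_res (c : J ↪ ℤ) (x : V k) : res c (x - inc c (res c x)) = 0 := by
  rw [map_sub, res_inc, sub_self]

/-- The part of a vector outside the span is fixed and pairs to zero with the span, because the
index set is symmetric. So the failure of isometry is visible on the finite block alone. -/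
lemma half_embed (c : J ↪ ℤ) (hc : ∀ z, z ∈ Set.range c → -z ∈ Set.range c) (M : Matrix J J k)
    (x y : V k) : half k (embed c M x) (embed c M y) - half k x y =
      half k (inc c (M.mulVec (res c x))) (inc c (M.mulVec (res c y))) -
        half k (inc c (res c x)) (inc c (res c y)) := by
  rw [embed_apply, embed_apply,
    half_split c hc _ _ (res_sub_inc_res c x) (res_sub_inc_res c y)]
  have h := half_split c hc (res c x) (res c y) (res_sub_inc_res c x) (res_sub_inc_res c y)
  rw [add_sub_cancel, add_sub_cancel] at h
  rw [h]
  abel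

end Embed

lemma neg_mem_range_coordD (n : ℕ) (z : ℤ) (hz : z ∈ Set.range (coordD n)) :
    -z ∈ Set.range (coordD n) := by
  rw [range_coordD] at *
  obtain ⟨h1 : z ≠ 0, h2, h3⟩ := hz
  exact ⟨neg_ne_zero.2 h1, by omega, by omega⟩

lemma neg_mem_range_coordB (n : ℕ) (z : ℤ) (hz : z ∈ Set.range (coordB n)) :
    -z ∈ Set.range (coordB n) := by
  rw [range_coordB] at *
  obtain ⟨-, h2, h3⟩ := hz
  exact ⟨trivial, by omega, by omega⟩

lemma neg_coordD_inr (n : ℕ) (i : Fin n) : -coordD n (Sum.inr i) = coordD n (Sum.inl i) := rfl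

lemma coordD_inr_pos (n : ℕ) (i : Fin n) : 0 < coordD n (Sum.inr i) := by
  rw [coordD_inr]; omega

lemma coordD_inl_not_pos (n : ℕ) (i : Fin n) : ¬ 0 < coordD n (Sum.inl i) := by
  rw [coordD_inl]; omega

lemma half_inc_coordD (n : ℕ) (y y' : Fin n ⊕ Fin n → k) :
    half k (inc (coordD n) y) (inc (coordD n) y') =
      ∑ i, y (Sum.inr i) * y' (Sum.inl i) := by
  rw [half_inc_left, Fintype.sum_sum_type]
  simp [coordD_inr_pos, coordD_inl_not_pos, neg_coordD_inr, inc_apply, coordD_inr_pos]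

lemma half_inc_coordD_self (n : ℕ) (y : Fin n ⊕ Fin n → k) :
    half k (inc (coordD n) y) (inc (coordD n) y) = evenForm k n y := by
  rw [half_inc_coordD]
  exact Finset.sum_congr rfl fun i _ => mul_comm _ _

lemma half_inc_coordB_self (n : ℕ) (y : (Fin n ⊕ Fin n) ⊕ Unit → k) :
    half k (inc (coordB n) y) (inc (coordB n) y) + inc (coordB n) y 0 ^ 2 = oddForm k n y := by
  have h2 : ∀ i, inc (coordB n) y (coordD n i) = y (Sum.inl i) := fun i =>
    inc_apply (coordB n) y (Sum.inl i)
  have h3 : inc (coordB n) y 0 = y (Sum.inr ()) := inc_apply (coordB n) y (Sum.inr ())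
  rw [h3, oddForm, half_inc_left, Fintype.sum_sum_type, Fintype.sum_sum_type]
  simp [coordB_inl, coordB_inr, coordD_inr_pos, coordD_inl_not_pos, neg_coordD_inr, h2, mul_comm]

/-! ### Membership in the groups of finite rank -/

/-- The condition on determinant and Dickson invariant in the definition of a family. -/
def DetCond : Family → ℕ → Module.End k (V k) → Prop
  | .GL, _, _ => True
  | .SL, n, f => (matOf (coordA n) f).det = 1
  | .SOeven, n, f => (matOf (coordD n) f).det = 1 ∧
      ((2 : k) = 0 → dickson (matOf (coordD n) f) = 0)
  | .SOodd, n, f => (matOf (coordB n) f).det = 1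
  | .Sp, _, _ => True

lemma iso_SOeven_embed (n : ℕ) (M : Matrix (Fin n ⊕ Fin n) (Fin n ⊕ Fin n) k) :
    Iso .SOeven (embed (coordD n) M) ↔ ∀ y, evenForm k n (M.mulVec y) = evenForm k n y := by
  have h := fun x => half_embed (coordD n) (neg_mem_range_coordD n) M x x
  simp only [half_inc_coordD_self] at h
  constructor
  · intro hM y
    have := h (inc (coordD n) y)
    rw [hM, sub_self, res_inc] at this
    exact (sub_eq_zero.1 this.symm)
  · intro hM x
    have := h x
    rw [hM, sub_self] at this
    exact sub_eq_zero.1 this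

lemma embed_coordB_zero (n : ℕ) (M : Matrix ((Fin n ⊕ Fin n) ⊕ Unit) ((Fin n ⊕ Fin n) ⊕ Unit) k)
    (x : V k) : embed (coordB n) M x 0 = inc (coordB n) (M.mulVec (res (coordB n) x)) 0 := by
  have h : inc (coordB n) (res (coordB n) x) 0 = x 0 := inc_apply (coordB n) _ (Sum.inr ())
  rw [embed_apply, Finsupp.add_apply, Finsupp.sub_apply, h, sub_self, add_zero]

lemma iso_SOodd_embed (n : ℕ) (M : Matrix ((Fin n ⊕ Fin n) ⊕ Unit) ((Fin n ⊕ Fin n) ⊕ Unit) k) :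
    Iso .SOodd (embed (coordB n) M) ↔ ∀ y, oddForm k n (M.mulVec y) = oddForm k n y := by
  have h : ∀ x, (half k (embed (coordB n) M x) (embed (coordB n) M x) +
      embed (coordB n) M x 0 ^ 2) - (half k x x + x 0 ^ 2) =
      oddForm k n (M.mulVec (res (coordB n) x)) - oddForm k n (res (coordB n) x) := by
    intro x
    have h1 := half_embed (coordB n) (neg_mem_range_coordB n) M x x
    have h2 : inc (coordB n) (res (coordB n) x) 0 = x 0 := inc_apply (coordB n) _ (Sum.inr ())
    rw [← half_inc_coordB_self, ← half_inc_coordB_self, embed_coordB_zero, h2]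
    linear_combination h1
  constructor
  · intro hM y
    have := h (inc (coordB n) y)
    rw [hM, sub_self, res_inc] at this
    exact (sub_eq_zero.1 this.symm)
  · intro hM x
    have := h x
    rw [hM, sub_self] at this
    exact sub_eq_zero.1 this

/-- The positive coordinates are the second half of `coordD`, so `half` pairs the second half of `y`
with the first half of `y'`; this matches the sign convention of `Matrix.J`. -/
lemma half_sub_half_eq_J (n : ℕ) (y y' : Fin n ⊕ Fin n → k) :
    half k (inc (coordD n) y) (inc (coordD n) y') - half k (inc (coordD n) y') (inc (coordD n) y) =
      dotProduct y ((Matrix.J (Fin n) k).mulVec y') := by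
  rw [half_inc_coordD, half_inc_coordD, dotProduct, Fintype.sum_sum_type]
  simp [Matrix.J, Matrix.fromBlocks_mulVec, Matrix.neg_mulVec]
  rw [sub_eq_add_neg, add_comm]
  congr 1
  exact congrArg Neg.neg (Finset.sum_congr rfl fun i _ => mul_comm _ _)

lemma iso_Sp_embed (n : ℕ) (M : Matrix (Fin n ⊕ Fin n) (Fin n ⊕ Fin n) k) :
    Iso .Sp (embed (coordD n) M) ↔ M ∈ Matrix.symplecticGroup (Fin n) k := by
  have h : ∀ x y, (half k (embed (coordD n) M x) (embed (coordD n) M y) -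
      half k (embed (coordD n) M y) (embed (coordD n) M x)) - (half k x y - half k y x) =
      dotProduct (res (coordD n) x)
        ((M.transpose * Matrix.J (Fin n) k * M).mulVec (res (coordD n) y)) -
      dotProduct (res (coordD n) x) ((Matrix.J (Fin n) k).mulVec (res (coordD n) y)) := by
    intro x y
    have h1 := half_embed (coordD n) (neg_mem_range_coordD n) M x y
    have h2 := half_embed (coordD n) (neg_mem_range_coordD n) M y x
    have h3 := half_sub_half_eq_J n (res (coordD n) x) (res (coordD n) y)
    have h4 := half_sub_half_eq_J n (M.mulVec (res (coordD n) x)) (M.mulVec (res (coordD n) y))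
    have h5 : dotProduct (res (coordD n) x)
        ((M.transpose * Matrix.J (Fin n) k * M).mulVec (res (coordD n) y)) =
        dotProduct (M.mulVec (res (coordD n) x))
          ((Matrix.J (Fin n) k).mulVec (M.mulVec (res (coordD n) y))) := by
      rw [Matrix.mul_assoc, ← Matrix.mulVec_mulVec, Matrix.dotProduct_mulVec,
        Matrix.vecMul_transpose, Matrix.mulVec_mulVec]
    rw [h5, ← h3, ← h4]
    linear_combination h1 - h2
  rw [SymplecticGroup.mem_iff']
  constructor
  · intro hM
    refine Matrix.ext_of_mulVec_single fun j => ?_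
    refine dotProduct_eq _ _ fun w => ?_
    have := h (inc (coordD n) w) (inc (coordD n) (Pi.single j 1))
    rw [hM, sub_self, res_inc, res_inc] at this
    rw [dotProduct_comm, dotProduct_comm _ w]
    exact (sub_eq_zero.1 this.symm)
  · intro hM x y
    have := h x y
    rw [hM, sub_self] at this
    exact sub_eq_zero.1 this

lemma mem_range_toHomUnits {H : Type*} [Group H] (φ : H →* Module.End k (V k)) (g : GLV k) :
    g ∈ φ.toHomUnits.range ↔ ∃ a, φ a = g.1 := by
  rw [MonoidHom.mem_range]
  exact exists_congr fun a => Units.ext_iff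

/-- Replaces the five matrix groups by conditions on the endomorphism itself. Only `DetCond` still
refers to a matrix; later arguments work with the action on the vectors `e_z`. -/
lemma mem_level_iff (X : Family) (n : ℕ) (g : GLV k) :
    g ∈ level X k n ↔ (∀ z, z ∉ box X n → g.1 (e k z) = e k z) ∧
      (∀ z, z ∈ box X n → g.1 (e k z) ∈ spanOf k (box X n)) ∧ Iso X g.1 ∧ DetCond X n g.1 := by
  match X with
  | .GL =>
    have h := exists_embed_eq_iff (coordA n) g.1 fun _ => True
    rw [range_coordA] at h
    refine Iff.trans ?_ (h.trans (by simp [Iso, DetCond]))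
    constructor
    · rintro ⟨a, ha⟩
      exact ⟨a.1, trivial, by rw [← ha]; rfl⟩
    · rintro ⟨M, -, hM⟩
      have hu := (Matrix.isUnit_iff_isUnit_det _).2 (isUnit_det_of_embed _ M hM)
      exact ⟨hu.unit, Units.ext hM⟩
  | .SL =>
    have h := exists_embed_eq_iff (coordA n) g.1 fun M => M.det = 1
    rw [range_coordA] at h
    refine Iff.trans ?_ (h.trans (by simp [Iso, DetCond, box, coords]))
    refine (mem_range_toHomUnits _ g).trans ?_
    constructor
    · rintro ⟨a, ha⟩
      exact ⟨a.1, a.2, ha⟩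
    · rintro ⟨M, h1, hM⟩
      exact ⟨⟨M, h1⟩, hM⟩
  | .SOeven =>
    have h := exists_embed_eq_iff (coordD n) g.1 fun M => Iso .SOeven (embed (coordD n) M) ∧
      M.det = 1 ∧ ((2 : k) = 0 → dickson M = 0)
    rw [range_coordD] at h
    have h' : (∀ z, z ∉ box .SOeven n → g.1 (e k z) = e k z) →
        (∀ z, z ∈ box .SOeven n → g.1 (e k z) ∈ spanOf k (box .SOeven n)) →
        embed (coordD n) (matOf (coordD n) g.1) = g.1 := by
      intro h1 h2
      refine embed_matOf _ _ ?_ ?_ <;> rw [range_coordD] <;> assumption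
    refine Iff.trans ?_ (h.trans (and_congr_right fun h1 => and_congr_right fun h2 => ?_))
    · refine (mem_range_toHomUnits _ g).trans ?_
      constructor
      · rintro ⟨a, ha⟩
        exact ⟨a.1.1, ⟨(iso_SOeven_embed _ _).2 a.2.1, a.1.2, a.2.2⟩, ha⟩
      · rintro ⟨M, ⟨h0, h1, h2⟩, hM⟩
        exact ⟨⟨⟨M, h1⟩, (iso_SOeven_embed _ _).1 h0, h2⟩, hM⟩
    · rw [h' h1 h2]
      rfl
  | .SOodd =>
    have h := exists_embed_eq_iff (coordB n) g.1 fun M => Iso .SOodd (embed (coordB n) M) ∧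
      M.det = 1
    rw [range_coordB] at h
    have h' : (∀ z, z ∉ box .SOodd n → g.1 (e k z) = e k z) →
        (∀ z, z ∈ box .SOodd n → g.1 (e k z) ∈ spanOf k (box .SOodd n)) →
        embed (coordB n) (matOf (coordB n) g.1) = g.1 := by
      intro h1 h2
      refine embed_matOf _ _ ?_ ?_ <;> rw [range_coordB] <;> assumption
    refine Iff.trans ?_ (h.trans (and_congr_right fun h1 => and_congr_right fun h2 => ?_))
    · refine (mem_range_toHomUnits _ g).trans ?_
      constructor
      · rintro ⟨a, ha⟩
        exact ⟨a.1.1, ⟨(iso_SOodd_embed _ _).2 a.2, a.1.2⟩, ha⟩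
      · rintro ⟨M, ⟨h0, h1⟩, hM⟩
        exact ⟨⟨⟨M, h1⟩, (iso_SOodd_embed _ _).1 h0⟩, hM⟩
    · rw [h' h1 h2]
      rfl
  | .Sp =>
    have h := exists_embed_eq_iff (coordD n) g.1 fun M => Iso .Sp (embed (coordD n) M)
    rw [range_coordD] at h
    have h' : (∀ z, z ∉ box .Sp n → g.1 (e k z) = e k z) →
        (∀ z, z ∈ box .Sp n → g.1 (e k z) ∈ spanOf k (box .Sp n)) →
        embed (coordD n) (matOf (coordD n) g.1) = g.1 := by
      intro h1 h2
      refine embed_matOf _ _ ?_ ?_ <;> rw [range_coordD] <;> assumption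
    refine Iff.trans ?_ (h.trans (and_congr_right fun h1 => and_congr_right fun h2 => ?_))
    · refine (mem_range_toHomUnits _ g).trans ?_
      constructor
      · rintro ⟨a, ha⟩
        exact ⟨a.1, (iso_Sp_embed _ _).2 a.2, ha⟩
      · rintro ⟨M, h0, hM⟩
        exact ⟨⟨M, (iso_Sp_embed _ _).1 h0⟩, hM⟩
    · rw [h' h1 h2]
      simp [DetCond]

/-! ### Independence of determinant and Dickson invariant of the rank -/

lemma inc_apply_eq_sum {J : Type} [Fintype J] [DecidableEq J] (c : J ↪ ℤ) (y : J → k) (z : ℤ) :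
    inc c y z = ∑ a, (if z = c a then 1 else 0) * y a := by
  rw [← sum_smul_e_apply, Finsupp.finsetSum_apply]
  refine Finset.sum_congr rfl fun a _ => ?_
  rw [Finsupp.smul_apply, e_apply, smul_eq_mul, mul_comm]
  simp only [eq_comm]

/-- On the larger index set the matrix is `1 + P (M - 1) Q` with `Q P = 1`, and Sylvester's identity
`det (1 + A B) = det (1 + B A)` returns `det M`. -/
lemma det_matOf_embed {J J' : Type} [Fintype J] [DecidableEq J] [Fintype J'] [DecidableEq J']
    (c : J ↪ ℤ) (c' : J' ↪ ℤ) (h : Set.range c ⊆ Set.range c') (M : Matrix J J k) :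
    (matOf c' (embed c M)).det = M.det := by
  let P : Matrix J' J k := Matrix.of fun i j => if c' i = c j then 1 else 0
  let Q : Matrix J J' k := Matrix.of fun i j => if c' j = c i then 1 else 0
  have hQP : Q * P = 1 := by
    ext i j
    obtain ⟨i', hi'⟩ := h ⟨i, rfl⟩
    rw [Matrix.mul_apply, Finset.sum_eq_single i']
    · simp [P, Q, hi', Matrix.one_apply]
    · intro b _ hb
      have : ¬ c' b = c i := fun hbi => hb (c'.injective (hbi.trans hi'.symm))
      simp [Q, this]
    · simp
  have hM : matOf c' (embed c M) = 1 + P * ((M - 1) * Q) := by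
    ext i j
    have h1 : embed c M (e k (c' j)) = e k (c' j) +
        inc c ((M - 1).mulVec (res c (e k (c' j)))) := rfl
    rw [matOf_apply, h1, Finsupp.add_apply, Matrix.add_apply, e_apply, inc_apply_eq_sum,
      Matrix.mul_apply]
    congr 1
    · simp [Matrix.one_apply, eq_comm]
    · refine Finset.sum_congr rfl fun a _ => congrArg _ ?_
      rw [Matrix.mulVec, dotProduct, Matrix.mul_apply]
      refine Finset.sum_congr rfl fun b _ => congrArg _ ?_
      change e k (c' j) (c b) = _
      rw [e_apply]
      rfl
  rw [hM, Matrix.det_one_add_mul_comm, Matrix.mul_assoc, hQP, Matrix.mul_one, add_sub_cancel]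

lemma det_matOf_eq {J J' : Type} [Fintype J] [DecidableEq J] [Fintype J'] [DecidableEq J']
    (c : J ↪ ℤ) (c' : J' ↪ ℤ) (h : Set.range c ⊆ Set.range c') (f : Module.End k (V k))
    (h1 : ∀ z, z ∉ Set.range c → f (e k z) = e k z)
    (h2 : ∀ z, z ∈ Set.range c → f (e k z) ∈ spanOf k (Set.range c)) :
    (matOf c' f).det = (matOf c f).det := by
  nth_rewrite 1 [← embed_matOf c f h1 h2]
  exact det_matOf_embed c c' h _

/-- Sums over ranges of natural numbers make the expressions for different ranks comparable. -/
lemma dickson_matOf_eq_sum (n : ℕ) (f : Module.End k (V k)) :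
    dickson (matOf (coordD n) f) = ∑ i ∈ Finset.range n, ∑ j ∈ Finset.range n,
      f (e k ((j : ℤ) + 1)) (-((i : ℤ) + 1)) * f (e k (-((j : ℤ) + 1))) ((i : ℤ) + 1) := by
  rw [Finset.sum_range]
  simp only [Finset.sum_range]
  rfl

lemma box_mono (X : Family) {n m : ℕ} (h : n ≤ m) : box X n ⊆ box X m := by
  rintro z ⟨h1, h2, h3⟩
  exact ⟨h1, by omega, by omega⟩

lemma spanOf_mono {s t : Set ℤ} (h : s ⊆ t) {x : V k} (hx : x ∈ spanOf k s) : x ∈ spanOf k t :=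
  mem_spanOf.2 fun z hz => mem_spanOf.1 hx z fun h' => hz (h h')

/-- Every additional term has first factor zero: `f` fixes the basis vectors outside the smaller box
and preserves the span of those inside. -/
lemma dickson_matOf_eq {n m : ℕ} (h : n ≤ m) (f : Module.End k (V k))
    (h1 : ∀ z, z ∉ box .SOeven n → f (e k z) = e k z)
    (h2 : ∀ z, z ∈ box .SOeven n → f (e k z) ∈ spanOf k (box .SOeven n)) :
    dickson (matOf (coordD m) f) = dickson (matOf (coordD n) f) := by
  have hout : ∀ i j : ℕ, n ≤ i ∨ n ≤ j →
      f (e k ((j : ℤ) + 1)) (-((i : ℤ) + 1)) = 0 := by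
    intro i j hij
    by_cases hj : n ≤ j
    · rw [h1 _ fun hb => by have := hb.2.2; omega, e_apply, if_neg (by omega)]
    · have hi : n ≤ i := hij.resolve_right hj
      have hj' : ((j : ℤ) + 1) ∈ box .SOeven n :=
        ⟨show _ ≠ (0 : ℤ) by omega, by omega, by omega⟩
      exact mem_spanOf.1 (h2 _ hj') _ fun hb => by have := hb.2.1; omega
  have hsub : Finset.range n ⊆ Finset.range m := Finset.range_subset_range.2 h
  rw [dickson_matOf_eq_sum, dickson_matOf_eq_sum]
  symm
  rw [← Finset.sum_subset hsub]
  · refine Finset.sum_congr rfl fun i _ => Finset.sum_subset hsub fun j _ hj => ?_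
    rw [hout i j (Or.inr (by simpa using hj)), zero_mul]
  · intro i _ hi
    exact Finset.sum_eq_zero fun j _ => by rw [hout i j (Or.inl (by simpa using hi)), zero_mul]

lemma level_mono (X : Family) {n m : ℕ} (h : n ≤ m) : level X k n ≤ level X k m := by
  intro g hg
  rw [mem_level_iff] at hg ⊢
  obtain ⟨h1, h2, h3, h4⟩ := hg
  refine ⟨fun z hz => h1 z fun h' => hz (box_mono X h h'), fun z hz => ?_, h3, ?_⟩
  · by_cases hz' : z ∈ box X n
    · exact spanOf_mono (box_mono X h) (h2 z hz')
    · rw [h1 z hz']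
      exact e_mem_spanOf hz
  · match X with
    | .GL => trivial
    | .SL =>
      refine (det_matOf_eq (coordA n) (coordA m) ?_ g.1 ?_ ?_).trans h4
      · rw [range_coordA, range_coordA]; exact box_mono _ h
      · rw [range_coordA]; exact h1
      · rw [range_coordA]; exact h2
    | .SOeven =>
      refine ⟨(det_matOf_eq (coordD n) (coordD m) ?_ g.1 ?_ ?_).trans h4.1, fun h0 => ?_⟩
      · rw [range_coordD, range_coordD]; exact box_mono _ h
      · rw [range_coordD]; exact h1
      · rw [range_coordD]; exact h2
      · rw [dickson_matOf_eq h g.1 h1 h2, h4.2 h0]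
    | .SOodd =>
      refine (det_matOf_eq (coordB n) (coordB m) ?_ g.1 ?_ ?_).trans h4
      · rw [range_coordB, range_coordB]; exact box_mono _ h
      · rw [range_coordB]; exact h1
      · rw [range_coordB]; exact h2
    | .Sp => trivial

lemma mem_Ginf_iff {X : Family} {g : GLV k} : g ∈ Ginf X k ↔ ∃ n, g ∈ level X k n := by
  rw [Ginf, Subgroup.mem_iSup_of_directed]
  exact (monotone_nat_of_le_succ fun n => level_mono X n.le_succ).directed_le

lemma exists_mem_level {X : Family} (g : Ginf X k) (N : ℕ) : ∃ n, N ≤ n ∧ g.1 ∈ level X k n := by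
  obtain ⟨n, hn⟩ := mem_Ginf_iff.1 g.2
  exact ⟨max N n, le_max_left _ _, level_mono X (le_max_right _ _) hn⟩

lemma isoOf {X : Family} (g : Ginf X k) : Iso X g.1.1 := by
  obtain ⟨n, -, hn⟩ := exists_mem_level g 0
  exact ((mem_level_iff _ _ _).1 hn).2.2.1

/-- The matrix coefficients of an element of `G_∞`. -/
def coef {X : Family} (g : Ginf X k) (i j : ℤ) : k := act g (e k j) i

/-! ### The subgroups `B`, `U`, `Uminus` and `T` in terms of matrix coefficients -/

section Coef

variable {X : Family}

lemma apply_eq_sum (f : Module.End k (V k)) (x : V k) (i : ℤ) :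
    f x i = ∑ j ∈ x.support, x j * f (e k j) i := by
  conv_lhs => rw [← Finsupp.sum_single x, Finsupp.sum, map_sum, Finsupp.finsetSum_apply]
  refine Finset.sum_congr rfl fun j _ => ?_
  have : Finsupp.single j (x j) = x j • e k j := by simp [e]
  rw [this, map_smul, Finsupp.smul_apply, smul_eq_mul]

lemma act_apply_eq_sum (g : Ginf X k) (x : V k) (i : ℤ) :
    act g x i = ∑ j ∈ x.support, x j * coef g i j := apply_eq_sum _ _ _

lemma coef_one (i j : ℤ) : coef (1 : Ginf X k) i j = e k j i := rfl

lemma coef_ext {g h : Ginf X k} (H : ∀ i j, coef g i j = coef h i j) : g = h :=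
  Subtype.ext (Units.ext (hom_ext_e fun z => Finsupp.ext fun i => H i z))

lemma coef_of_notMem_left (g : Ginf X k) {i : ℤ} (hi : i ∉ coords X) (j : ℤ) :
    coef g i j = e k j i := by
  obtain ⟨n, -, hn⟩ := exists_mem_level g 0
  obtain ⟨h1, h2, -, -⟩ := (mem_level_iff _ _ _).1 hn
  by_cases hj : j ∈ box X n
  · have h3 := mem_spanOf.1 (h2 j hj) i fun h => hi h.1
    rw [coef, h3, e_apply, if_neg]
    rintro rfl
    exact hi hj.1
  · rw [coef, h1 j hj]

lemma coef_of_notMem_right (g : Ginf X k) (i : ℤ) {j : ℤ} (hj : j ∉ coords X) :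
    coef g i j = e k j i := by
  obtain ⟨n, -, hn⟩ := exists_mem_level g 0
  obtain ⟨h1, -, -, -⟩ := (mem_level_iff _ _ _).1 hn
  rw [coef, h1 j fun h => hj h.1]

lemma exists_coord (X : Family) (n : ℕ) : ∃ (J : Type) (_ : Fintype J) (_ : DecidableEq J)
    (c : J ↪ ℤ), Set.range c = box X n := by
  match X with
  | .GL => exact ⟨_, inferInstance, inferInstance, coordA n, range_coordA n⟩
  | .SL => exact ⟨_, inferInstance, inferInstance, coordA n, range_coordA n⟩
  | .SOeven => exact ⟨_, inferInstance, inferInstance, coordD n, range_coordD n⟩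
  | .SOodd => exact ⟨_, inferInstance, inferInstance, coordB n, range_coordB n⟩
  | .Sp => exact ⟨_, inferInstance, inferInstance, coordD n, range_coordD n⟩

/-- The order of `ℤ` pulled back along `c` makes the matrix upper triangular in the usual sense. -/
lemma det_eq_prod_of_triangular {J : Type} [Fintype J] [DecidableEq J] (c : J ↪ ℤ)
    (M : Matrix J J k) (h : ∀ i j, c j < c i → M i j = 0) : M.det = ∏ j, M j j := by
  let _ : LinearOrder J := LinearOrder.lift' c c.injective
  have h' : M.BlockTriangular id := fun i j hij => h i j hij
  convert Matrix.det_of_isUpperTriangular h'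

/-- The element lives in finite rank, where its determinant is a unit and, by triangularity, the
product of the diagonal coefficients. -/
lemma coef_diag_ne_zero_of_triangular (g : Ginf X k) (h : ∀ i j, j < i → coef g i j = 0) (z : ℤ) :
    coef g z z ≠ 0 := by
  obtain ⟨n, -, hn⟩ := exists_mem_level g 0
  obtain ⟨h1, h2, -, -⟩ := (mem_level_iff _ _ _).1 hn
  obtain ⟨J, _, _, c, hc⟩ := exists_coord X n
  rw [← hc] at h1 h2
  by_cases hz : z ∈ Set.range c
  · obtain ⟨j, rfl⟩ := hz
    have h3 := isUnit_det_of_embed c _ (embed_matOf c g.1.1 h1 h2)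
    rw [det_eq_prod_of_triangular c (matOf c g.1.1) fun i j hij => h _ _ hij] at h3
    exact Finset.prod_ne_zero_iff.1 h3.ne_zero j (Finset.mem_univ j)
  · rw [coef, h1 z hz, e_apply, if_pos rfl]
    exact one_ne_zero

/-- Triangularity with respect to the order transported along `f` implies that the spans of lower
sets are stabilized. -/
lemma act_mem_spanOf_iff (g : Ginf X k) (f : ℤ → ℤ) (hf : Function.Injective f)
    (h : ∀ i j, f j < f i → coef g i j = 0) (hd : ∀ j, coef g j j ≠ 0) (S : Set ℤ)
    (hS : ∀ i j, f i ≤ f j → j ∈ S → i ∈ S) (x : V k) :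
    act g x ∈ spanOf k S ↔ x ∈ spanOf k S := by
  constructor
  · intro hx
    rw [mem_spanOf]
    intro j hj
    by_contra hxj
    -- At the index `m` of the support that is largest for the transported order, the only
    -- contribution to `act g x` is `x m` times a nonzero diagonal coefficient. So `m ∉ S` is
    -- impossible.
    obtain ⟨m, hm, hmax⟩ := Finset.exists_max_image x.support f ⟨j, Finsupp.mem_support_iff.2 hxj⟩
    have hmS : m ∉ S := fun hm' => hj (hS j m (hmax j (Finsupp.mem_support_iff.2 hxj)) hm')
    have h1 := mem_spanOf.1 hx m hmS
    rw [act_apply_eq_sum, Finset.sum_eq_single m] at h1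
    · exact (mul_ne_zero (Finsupp.mem_support_iff.1 hm) (hd m)) h1
    · intro b hb hbm
      rw [h m b (lt_of_le_of_ne (hmax b hb) fun h' => hbm (hf h')), mul_zero]
    · exact fun h' => absurd hm h'
  · intro hx
    rw [mem_spanOf]
    intro i hi
    rw [act_apply_eq_sum]
    refine Finset.sum_eq_zero fun j _ => ?_
    by_cases hj : j ∈ S
    · rw [h i j (lt_of_not_ge fun h' => hi (hS i j h' hj)), mul_zero]
    · rw [mem_spanOf.1 hx j hj, zero_mul]

lemma mem_B_iff (g : Ginf X k) : g ∈ B X k ↔ ∀ i j, j < i → coef g i j = 0 := by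
  constructor
  · intro hg i j hij
    have h1 : e k j ∈ spanOf k (Set.Iio i) := e_mem_spanOf hij
    exact mem_spanOf.1 (((map_eq_iff _ _).1 (hg i) _).2 h1) i (lt_irrefl i)
  · intro h z
    exact (map_eq_iff _ _).2 fun x => act_mem_spanOf_iff g id Function.injective_id h
      (coef_diag_ne_zero_of_triangular g h) _ (fun i j hij hj => lt_of_le_of_lt hij hj) x

/-- The order is transported along `f` so that `f = id` yields `U` and negation yields `Uminus`. -/
lemma mem_unip_aux (g : Ginf X k) (f : ℤ → ℤ) (hf : Function.Injective f) :
    g ∈ unip X k (fun z => {i | f i < f z}) ↔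
      ∀ i j, ¬ f i < f j → coef g i j = e k j i := by
  constructor
  · rintro ⟨-, h⟩ i j hij
    have := mem_spanOf.1 (h j) i hij
    rw [Finsupp.sub_apply] at this
    exact sub_eq_zero.1 this
  · intro h
    refine ⟨fun z => (map_eq_iff _ _).2 fun x => act_mem_spanOf_iff g f hf ?_ ?_ _
      (fun i j hij hj => lt_of_le_of_lt hij hj) x, fun z => mem_spanOf.2 fun i hi => ?_⟩
    · intro i j hij
      rw [h i j hij.not_gt, e_apply, if_neg]
      rintro rfl
      exact lt_irrefl _ hij
    · intro j
      rw [h j j (lt_irrefl _), e_apply, if_pos rfl]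
      exact one_ne_zero
    · rw [Finsupp.sub_apply]
      exact sub_eq_zero.2 (h i z hi)

lemma mem_U_iff (g : Ginf X k) : g ∈ U X k ↔ ∀ i j, j ≤ i → coef g i j = e k j i := by
  refine (mem_unip_aux g id Function.injective_id).trans ?_
  simp only [id, not_lt]

lemma mem_Uminus_iff (g : Ginf X k) : g ∈ Uminus X k ↔ ∀ i j, i ≤ j → coef g i j = e k j i := by
  have h := mem_unip_aux g (fun z => -z) neg_injective
  simp only [neg_lt_neg_iff, not_lt] at h
  exact h

lemma mem_T_iff (g : Ginf X k) : g ∈ T X k ↔ ∀ i j, i ≠ j → coef g i j = 0 := by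
  constructor
  · intro h i j hij
    obtain ⟨a, ha⟩ := h j
    rw [coef, ha, Finsupp.smul_apply, e_apply, if_neg hij.symm, smul_zero]
  · intro h z
    have h1 := coef_diag_ne_zero_of_triangular g (fun i j hij => h i j hij.ne') z
    refine ⟨Units.mk0 _ h1, Finsupp.ext fun i => ?_⟩
    rw [Finsupp.smul_apply, Units.smul_mk0, e_apply]
    by_cases hi : z = i
    · subst hi
      rw [if_pos rfl, smul_eq_mul, mul_one]
      rfl
    · rw [if_neg hi, smul_zero]
      exact h i z (Ne.symm hi)

lemma T_le_B : T X k ≤ B X k := T_le_stab _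

lemma U_le_B : U X k ≤ B X k := fun _ h => h.1

lemma eq_one_of_mem_B_of_mem_Uminus {g : Ginf X k} (hB : g ∈ B X k) (hU : g ∈ Uminus X k) :
    g = 1 := by
  refine coef_ext fun i j => ?_
  rw [coef_one]
  rcases le_or_gt i j with h | h
  · exact (mem_Uminus_iff g).1 hU i j h
  · rw [(mem_B_iff g).1 hB i j h, e_apply, if_neg h.ne]

lemma eq_one_of_mem_T_of_mem_U {g : Ginf X k} (hT : g ∈ T X k) (hU : g ∈ U X k) :
    g = 1 := by
  refine coef_ext fun i j => ?_
  rw [coef_one]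
  rcases le_or_gt j i with h | h
  · exact (mem_U_iff g).1 hU i j h
  · rw [(mem_T_iff g).1 hT i j h.ne, e_apply, if_neg h.ne']

end Coef

/-! ### The invariant bilinear form -/

/-- The families that preserve a form. -/
def Family.HasForm : Family → Prop
  | .GL => False
  | .SL => False
  | _ => True

/-- The invariant bilinear form of a family. -/
def bil : Family → V k → V k → k
  | .GL, _, _ => 0
  | .SL, _, _ => 0
  | .SOeven, x, y => half k x y + half k y x
  | .SOodd, x, y => half k x y + half k y x + 2 * x 0 * y 0
  | .Sp, x, y => half k x y - half k y x

/-- The value of the invariant bilinear form at `(e_z, e_{-z})`, for `z ≠ 0`. -/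
def bilSign (k : Type u) [Field k] : Family → ℤ → kˣ
  | .Sp, z => if 0 < z then 1 else -1
  | _, _ => 1

lemma bil_smul_left (X : Family) (a : k) (x y : V k) : bil X (a • x) y = a * bil X x y := by
  match X with
  | .GL | .SL => simp [bil]
  | .SOeven | .SOodd | .Sp => simp [bil]; try ring

lemma bil_smul_right (X : Family) (a : k) (x y : V k) : bil X x (a • y) = a * bil X x y := by
  match X with
  | .GL | .SL => simp [bil]
  | .SOeven | .SOodd | .Sp => simp [bil]; try ring

/-- Polarization of the quadratic form at `x + y`. In characteristic two the quadratic condition is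
stronger, so both `Iso` and `bil` are used below. -/
lemma Iso.bil_eq {X : Family} {f : Module.End k (V k)} (hf : Iso X f) (x y : V k) :
    bil X (f x) (f y) = bil X x y := by
  match X, hf with
  | .GL, _ | .SL, _ => rfl
  | .SOeven, hf =>
    have h1 : ∀ x, half k (f x) (f x) = half k x x := hf
    have h2 := h1 (x + y)
    simp only [map_add, LinearMap.add_apply, h1] at h2
    simp only [bil]
    linear_combination h2
  | .SOodd, hf =>
    have h1 : ∀ x, half k (f x) (f x) + f x 0 ^ 2 = half k x x + x 0 ^ 2 := hf
    have h2 := h1 (x + y)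
    have h3 := h1 x
    have h4 := h1 y
    simp only [map_add, LinearMap.add_apply, Finsupp.add_apply] at h2
    simp only [bil]
    linear_combination h2 - h3 - h4
  | .Sp, hf => exact hf x y

lemma half_apply (x y : V k) :
    half k x y = ∑ z ∈ x.support, if 0 < z then x z * y (-z) else 0 := by
  conv_lhs => rw [← Finsupp.sum_single x, Finsupp.sum, map_sum, LinearMap.sum_apply]
  refine Finset.sum_congr rfl fun z _ => ?_
  have : Finsupp.single z (x z) = x z • e k z := by simp [e]
  rw [this, map_smul, LinearMap.smul_apply, half_e_left, smul_eq_mul, mul_ite, mul_zero]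

lemma half_eq_single {x y : V k} {a : ℤ} (ha : 0 < a)
    (h : ∀ z, 0 < z → z ≠ a → x z * y (-z) = 0) : half k x y = x a * y (-a) := by
  rw [half_apply, Finset.sum_eq_single a]
  · rw [if_pos ha]
  · intro z _ hz
    split_ifs with h0
    · exact h z h0 hz
    · rfl
  · intro h'
    rw [Finsupp.notMem_support_iff.1 h']
    simp

lemma half_eq_zero {x y : V k} (h : ∀ z, 0 < z → x z * y (-z) = 0) : half k x y = 0 := by
  rw [half_apply]
  exact Finset.sum_eq_zero fun z _ => by split_ifs with h0 <;> [exact h z h0; rfl]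

/-- This is how invariance of the form is exploited: triangularity kills all products of
coefficients but one, and an equation for a single product remains. -/
lemma bil_eq_single {X : Family} (hX : X.HasForm) {x y : V k} {a : ℤ} (ha : a ≠ 0)
    (h : ∀ z, z ≠ a → x z * y (-z) = 0) : bil X x y = ((bilSign k X a : kˣ) : k) * (x a * y (-a)) := by
  have h0 := h 0 ha.symm
  rw [neg_zero] at h0
  have h' : ∀ z, z ≠ -a → y z * x (-z) = 0 := fun z hz => by
    have := h (-z) (by omega)
    rwa [neg_neg, mul_comm] at this
  rcases lt_or_gt_of_ne ha with ha' | ha'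
  · have h1 : half k x y = 0 := half_eq_zero fun z hz => h z (by omega)
    have h2 : half k y x = x a * y (-a) := by
      rw [half_eq_single (a := -a) (by omega) fun z _ hz => h' z hz, neg_neg, mul_comm]
    match X, hX with
    | .SOeven, _ => simp [bil, bilSign, h1, h2]
    | .SOodd, _ => simp [bil, bilSign, h1, h2, mul_assoc, h0]
    | .Sp, _ => simp [bil, bilSign, h1, h2, ha'.not_gt]
  · have h1 : half k x y = x a * y (-a) := half_eq_single ha' fun z _ hz => h z hz
    have h2 : half k y x = 0 := half_eq_zero fun z hz => h' z (by omega)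
    match X, hX with
    | .SOeven, _ => simp [bil, bilSign, h1, h2]
    | .SOodd, _ => simp [bil, bilSign, h1, h2, mul_assoc, h0]
    | .Sp, _ => simp [bil, bilSign, h1, h2, ha']

lemma bil_e_e {X : Family} (hX : X.HasForm) {a : ℤ} (ha : a ≠ 0) :
    bil X (e k a) (e k (-a)) = ((bilSign k X a : kˣ) : k) := by
  rw [bil_eq_single hX ha]
  · simp [e_apply]
  · intro z hz
    rw [e_apply, if_neg hz.symm, zero_mul]

lemma bil_e_right {X : Family} (hX : X.HasForm) {a : ℤ} (ha : a ≠ 0) (x : V k) :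
    bil X x (e k (-a)) = ((bilSign k X a : kˣ) : k) * x a := by
  rw [bil_eq_single hX ha]
  · simp [e_apply]
  · intro z hz
    rw [e_apply, if_neg (by omega), mul_zero]

lemma bil_eq_zero {X : Family} {x y : V k} (h : ∀ z, x z * y (-z) = 0) : bil X x y = 0 := by
  have h0 := h 0
  rw [neg_zero] at h0
  have h1 : half k x y = 0 := half_eq_zero fun z _ => h z
  have h2 : half k y x = 0 := half_eq_zero fun z _ => by
    have := h (-z)
    rwa [neg_neg, mul_comm] at this
  match X with
  | .GL | .SL => rfl
  | .SOeven | .Sp => simp [bil, h1, h2]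
  | .SOodd => simp [bil, h1, h2, mul_assoc, h0]

lemma half_e_self (z : ℤ) : half k (e k z) (e k z) = 0 := by
  rw [half_e_left, e_apply]
  split_ifs <;> first | rfl | omega

section

variable {X : Family}

lemma bil_act (g : Ginf X k) (x y : V k) : bil X (act g x) (act g y) = bil X x y :=
  (isoOf g).bil_eq x y

/-- The diagonal coefficients of a triangular element at opposite coordinates are inverse. -/
lemma coef_mul_coef_neg (hX : X.HasForm) {b : Ginf X k} (hb : b ∈ B X k) {z : ℤ} (hz : z ≠ 0) :
    coef b z z * coef b (-z) (-z) = 1 := by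
  have h := bil_act b (e k z) (e k (-z))
  rw [bil_e_e hX hz, bil_eq_single hX hz] at h
  · exact mul_left_cancel₀ (bilSign k X z : kˣ).ne_zero (h.trans (mul_one _).symm)
  · intro w hw
    rcases lt_or_gt_of_ne hw with h' | h'
    · exact mul_eq_zero_of_right _ ((mem_B_iff b).1 hb (-w) (-z) (by omega))
    · exact mul_eq_zero_of_left ((mem_B_iff b).1 hb w z h') _

/-- By triangularity `b e_0` has no positive coordinate, so `half` contributes nothing to the
quadratic form and only the square survives. This works in characteristic two as well. -/
lemma coef_zero_sq {b : Ginf .SOodd k} (hb : b ∈ B .SOodd k) : coef b 0 0 ^ 2 = 1 := by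
  have h : half k (act b (e k 0)) (act b (e k 0)) + coef b 0 0 ^ 2 =
    half k (e k 0) (e k 0) + e k 0 0 ^ 2 := isoOf b (e k 0)
  rw [half_e_self, half_eq_zero fun z hz =>
    mul_eq_zero_of_left ((mem_B_iff b).1 hb z 0 hz) _, e_apply, if_pos rfl] at h
  simpa using h

end

/-! ### Diagonal elements -/

/-- The diagonal endomorphism with given entries. -/
def diagEnd (d : ℤ → k) : Module.End k (V k) :=
  Finsupp.lsum k fun z => d z • Finsupp.lsingle z

lemma diagEnd_e (d : ℤ → k) (z : ℤ) : diagEnd d (e k z) = d z • e k z := by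
  simp [diagEnd, e]

lemma diagEnd_apply (d : ℤ → k) (x : V k) (z : ℤ) : diagEnd d x z = d z * x z := by
  have h : (Finsupp.lapply z : V k →ₗ[k] k) ∘ₗ diagEnd d = d z • Finsupp.lapply z := by
    refine hom_ext_e fun w => ?_
    rw [LinearMap.comp_apply, diagEnd_e]
    by_cases hw : w = z
    · subst hw; simp
    · simp [e_apply, hw]
  exact LinearMap.congr_fun h x

/-- The diagonal automorphism with given entries. -/
def diagUnit (d : ℤ → kˣ) : GLV k where
  val := diagEnd fun z => d z
  inv := diagEnd fun z => ↑(d z)⁻¹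
  val_inv := hom_ext_e fun z => by
    rw [Module.End.mul_apply, diagEnd_e, map_smul, diagEnd_e, smul_smul, Units.inv_mul, one_smul]
    rfl
  inv_val := hom_ext_e fun z => by
    rw [Module.End.mul_apply, diagEnd_e, map_smul, diagEnd_e, smul_smul, Units.mul_inv, one_smul]
    rfl

lemma half_diagEnd {d : ℤ → k} (hd : ∀ z, z ≠ 0 → d z * d (-z) = 1) (x y : V k) :
    half k (diagEnd d x) (diagEnd d y) = half k x y := by
  have h : (half k).compl₁₂ (diagEnd d) (diagEnd d) = half k := by
    refine hom_ext_e fun z => hom_ext_e fun w => ?_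
    simp only [LinearMap.compl₁₂_apply, diagEnd_e, map_smul, LinearMap.smul_apply, half_e_left,
      e_apply, smul_eq_mul]
    split_ifs with h1 h2
    · subst h2
      rw [mul_one, mul_comm]
      exact hd z h1.ne'
    · simp
    · simp
  exact LinearMap.congr_fun₂ h x y

lemma iso_diagEnd (X : Family) {d : ℤ → k} (hd : X.HasForm → ∀ z, z ≠ 0 → d z * d (-z) = 1)
    (h0 : X = .SOodd → d 0 ^ 2 = 1) : Iso X (diagEnd d) := by
  match X, hd, h0 with
  | .GL, _, _ | .SL, _, _ => trivial
  | .SOeven, hd, _ => exact fun x => half_diagEnd (hd trivial) x x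
  | .SOodd, hd, h0 =>
    intro x
    rw [half_diagEnd (hd trivial), diagEnd_apply]
    linear_combination (x 0 ^ 2) * h0 rfl
  | .Sp, hd, _ =>
    intro x y
    rw [half_diagEnd (hd trivial), half_diagEnd (hd trivial)]

/-- For triangular endomorphisms the determinant depends on the diagonal only, and each term of the
Dickson expression contains a coefficient below the diagonal. -/
lemma detCond_iff_of_triangular (X : Family) (n : ℕ) {f f' : Module.End k (V k)}
    (h : ∀ i j, j < i → f (e k j) i = 0) (h' : ∀ i j, j < i → f' (e k j) i = 0)
    (hd : ∀ z, f (e k z) z = f' (e k z) z) : DetCond X n f ↔ DetCond X n f' := by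
  have hdet : ∀ {J : Type} [Fintype J] [DecidableEq J] (c : J ↪ ℤ),
      (matOf c f).det = (matOf c f').det := by
    intro J _ _ c
    rw [det_eq_prod_of_triangular c (matOf c f) fun i j hij => h _ _ hij,
      det_eq_prod_of_triangular c (matOf c f') fun i j hij => h' _ _ hij]
    exact Finset.prod_congr rfl fun j _ => hd _
  have hdick : ∀ {f : Module.End k (V k)}, (∀ i j, j < i → f (e k j) i = 0) →
      dickson (matOf (coordD n) f) = 0 := by
    intro f hf
    rw [dickson_matOf_eq_sum]
    refine Finset.sum_eq_zero fun i _ => Finset.sum_eq_zero fun j _ => ?_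
    exact mul_eq_zero_of_right _ (hf _ _ (by omega))
  match X with
  | .GL => exact Iff.rfl
  | .SL => simp only [DetCond, hdet]
  | .SOeven => simp only [DetCond, hdet, hdick h, hdick h']
  | .SOodd => simp only [DetCond, hdet]
  | .Sp => exact Iff.rfl

/-- The diagonal of `b` alone is an isometry, because entries at opposite coordinates are inverse
and the entry at `0` squares to one where it matters. It also satisfies the same determinant
condition, so it lies in the level of `b`. -/
lemma exists_eq_coef_diag {X : Family} {b : Ginf X k} (hb : b ∈ B X k) :
    ∃ t ∈ T X k, ∀ z, coef t z z = coef b z z := by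
  have hb' := (mem_B_iff b).1 hb
  have hne := coef_diag_ne_zero_of_triangular b hb'
  obtain ⟨n, -, hn⟩ := exists_mem_level b 0
  obtain ⟨h1, h2, h3, h4⟩ := (mem_level_iff _ _ _).1 hn
  let d : ℤ → kˣ := fun z => Units.mk0 _ (hne z)
  have hdz : ∀ z, (d z : k) = coef b z z := fun z => rfl
  have hde : ∀ z, (diagUnit d).1 (e k z) = coef b z z • e k z := fun z => diagEnd_e _ z
  have hmem : diagUnit d ∈ level X k n := by
    rw [mem_level_iff]
    refine ⟨fun z hz => ?_, fun z hz => ?_, iso_diagEnd X (fun hX z hz =>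
      coef_mul_coef_neg hX hb hz) ?_, ?_⟩
    · rw [hde, coef, h1 z hz, e_apply, if_pos rfl, one_smul]
    · rw [hde]
      exact Submodule.smul_mem _ _ (e_mem_spanOf hz)
    · rintro rfl
      exact coef_zero_sq hb
    · refine (detCond_iff_of_triangular X n hb' (fun i j hij => ?_) fun z => ?_).1 h4
      · rw [hde, Finsupp.smul_apply, e_apply, if_neg hij.ne, smul_zero]
      · rw [hde, Finsupp.smul_apply, e_apply, if_pos rfl, smul_eq_mul, mul_one]
        rfl
  refine ⟨⟨diagUnit d, mem_Ginf_iff.2 ⟨n, hmem⟩⟩, fun z => ⟨d z, hde z⟩, fun z => ?_⟩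
  change (diagUnit d).1 (e k z) z = _
  rw [hde, Finsupp.smul_apply, e_apply, if_pos rfl, smul_eq_mul, mul_one]

/-! ### Monomial elements -/

section Mono

variable {X : Family}

/-- `g` permutes the coordinate lines according to `σ`. -/
def IsMono (g : Ginf X k) (σ : Equiv.Perm ℤ) : Prop :=
  ∀ z, ∃ a : kˣ, act g (e k z) = a • e k (σ z)

lemma Represents.isMono {n : Ginf X k} {i : ℕ} (h : Represents n i) :
    IsMono n (simpleRefl X i) := h.2

lemma isMono_one_iff {g : Ginf X k} : IsMono g 1 ↔ g ∈ T X k := Iff.rfl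

lemma IsMono.mul {g h : Ginf X k} {σ τ : Equiv.Perm ℤ} (hg : IsMono g σ) (hh : IsMono h τ) :
    IsMono (g * h) (σ * τ) := by
  intro z
  obtain ⟨a, ha⟩ := hh z
  obtain ⟨b, hb⟩ := hg (τ z)
  refine ⟨a * b, ?_⟩
  rw [act_mul, ha, Units.smul_def, map_smul, hb, ← Units.smul_def, smul_smul]
  rfl

lemma IsMono.inv {g : Ginf X k} {σ : Equiv.Perm ℤ} (hg : IsMono g σ) : IsMono g⁻¹ σ⁻¹ := by
  intro z
  obtain ⟨a, ha⟩ := hg (σ⁻¹ z)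
  refine ⟨a⁻¹, ?_⟩
  rw [show σ (σ⁻¹ z) = z from σ.apply_symm_apply z] at ha
  have h := act_inv_act g (e k (σ⁻¹ z))
  rw [ha, Units.smul_def, map_smul, ← Units.smul_def] at h
  rw [← h, smul_smul, inv_mul_cancel, one_smul]

/-- Conjugation by a monomial element permutes the matrix coefficients up to units. -/
lemma IsMono.exists_conj {n : Ginf X k} {σ : Equiv.Perm ℤ} (hn : IsMono n σ) :
    ∃ a : ℤ → kˣ, (∀ z, act n (e k z) = a z • e k (σ z)) ∧
      ∀ (g : Ginf X k) (i j : ℤ), coef (n * g * n⁻¹) (σ i) (σ j) =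
      (a i : k) * coef g i j * ↑(a j)⁻¹ := by
  choose a ha using hn
  refine ⟨a, ha, fun g i j => ?_⟩
  have h1 : act n⁻¹ (e k (σ j)) = (a j)⁻¹ • e k j := by
    have h := act_inv_act n (e k j)
    rw [ha, Units.smul_def, map_smul, ← Units.smul_def] at h
    rw [← h, smul_smul, inv_mul_cancel, one_smul]
  have h2 : ∀ x : V k, act n x (σ i) = a i * x i := by
    intro x
    rw [act_apply_eq_sum, Finset.sum_eq_single i]
    · rw [coef, ha, Finsupp.smul_apply, e_apply, if_pos rfl, Units.smul_def, smul_eq_mul,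
        mul_one, mul_comm]
    · intro b _ hb
      rw [coef, ha, Finsupp.smul_apply, e_apply, if_neg fun h => hb (σ.injective h), smul_zero,
        mul_zero]
    · intro h
      rw [Finsupp.notMem_support_iff.1 h, zero_mul]
  rw [coef, act_mul, act_mul, h1, h2, Units.smul_def, map_smul, Finsupp.smul_apply, smul_eq_mul, coef]
  ring

lemma IsMono.conj_coef_eq_zero_iff {n : Ginf X k} {σ : Equiv.Perm ℤ} (hn : IsMono n σ)
    (g : Ginf X k) (i j : ℤ) : coef (n * g * n⁻¹) (σ i) (σ j) = 0 ↔ coef g i j = 0 := by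
  obtain ⟨a, -, ha⟩ := hn.exists_conj
  rw [ha]
  simp

/-- `n g n⁻¹` and the identity have the same coefficient at `(σ i, σ j)` if and only if `g` and
the identity have the same coefficient at `(i, j)`. -/
lemma IsMono.conj_coef_eq_iff {n : Ginf X k} {σ : Equiv.Perm ℤ} (hn : IsMono n σ)
    (g : Ginf X k) (i j : ℤ) :
    coef (n * g * n⁻¹) (σ i) (σ j) = e k (σ j) (σ i) ↔ coef g i j = e k j i := by
  obtain ⟨a, -, ha⟩ := hn.exists_conj
  rw [ha, e_apply, e_apply]
  by_cases hij : j = i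
  · subst hij
    rw [if_pos rfl, if_pos rfl, mul_right_comm, Units.mul_inv, one_mul]
  · rw [if_neg hij, if_neg fun h => hij (σ.injective h)]
    simp

lemma IsMono.apply_of_notMem {g : Ginf X k} {σ : Equiv.Perm ℤ} (hg : IsMono g σ) {z : ℤ}
    (h : act g (e k z) = e k z) : σ z = z := by
  obtain ⟨a, ha⟩ := hg z
  rw [h] at ha
  have := DFunLike.congr_fun ha (σ z)
  rw [Finsupp.smul_apply, e_apply, e_apply, if_pos rfl, Units.smul_def, smul_eq_mul, mul_one]
    at this
  by_contra hne
  rw [if_neg (Ne.symm hne)] at this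
  exact a.ne_zero this.symm

lemma IsMono.exists_forall_eq {g : Ginf X k} {σ : Equiv.Perm ℤ} (hg : IsMono g σ) :
    ∃ n : ℕ, ∀ z, z ∉ box X n → σ z = z := by
  obtain ⟨n, -, hn⟩ := exists_mem_level g 0
  obtain ⟨h1, -, -, -⟩ := (mem_level_iff _ _ _).1 hn
  exact ⟨n, fun z hz => hg.apply_of_notMem (h1 z hz)⟩

/-- For `SO_{2n+1}` the vector `e_0` is the only basis vector with nonzero quadratic form. For the
other families with a form, `0` is not a coordinate and `e_0` is fixed. -/
lemma IsMono.map_zero (hX : X.HasForm) {g : Ginf X k} {σ : Equiv.Perm ℤ} (hg : IsMono g σ) :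
    σ 0 = 0 := by
  by_cases h : X = .SOodd
  · subst h
    obtain ⟨a, ha⟩ := hg 0
    have h : half k (act g (e k 0)) (act g (e k 0)) + (act g (e k 0) 0) ^ 2 =
      half k (e k 0) (e k 0) + e k 0 0 ^ 2 := isoOf g (e k 0)
    rw [ha, Units.smul_def, map_smul, map_smul, LinearMap.smul_apply, half_e_self, half_e_self,
      Finsupp.smul_apply, e_apply, e_apply] at h
    by_contra hne
    simp [hne] at h
  · have h0 : (0 : ℤ) ∉ coords X := by
      match X, hX, h with
      | .SOeven, _, _ | .Sp, _, _ => exact fun h => h rfl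
      | .SOodd, _, h => exact absurd rfl h
    refine hg.apply_of_notMem (Finsupp.ext fun i => ?_)
    exact coef_of_notMem_right g i h0

/-- For `z ≠ 0` the vectors `e_z` and `e_{-z}` pair to a unit, while `e_{σ z}` pairs nontrivially
with no basis vector except `e_{-σ z}`. -/
lemma IsMono.map_neg (hX : X.HasForm) {g : Ginf X k} {σ : Equiv.Perm ℤ} (hg : IsMono g σ)
    (z : ℤ) : σ (-z) = -σ z := by
  by_cases hz : z = 0
  · subst hz
    rw [neg_zero, hg.map_zero hX, neg_zero]
  · have h := bil_act g (e k z) (e k (-z))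
    obtain ⟨a, ha⟩ := hg z
    obtain ⟨b, hb⟩ := hg (-z)
    rw [ha, hb, bil_e_e hX hz, Units.smul_def, Units.smul_def, bil_smul_left, bil_smul_right] at h
    have h0 : σ z ≠ 0 := by
      rw [← hg.map_zero hX]
      exact fun h => hz (σ.injective h)
    have hne : bil X (e k (σ z)) (e k (σ (-z))) ≠ 0 := by
      intro h'
      rw [h', mul_zero, mul_zero] at h
      exact (bilSign k X z : kˣ).ne_zero h.symm
    by_contra hneq
    apply hne
    refine bil_eq_zero fun w => ?_
    rw [e_apply, e_apply]
    by_cases hw : σ z = w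
    · rw [if_neg (c := σ (-z) = -w) (by omega), mul_zero]
    · rw [if_neg hw, zero_mul]

/-- An upper triangular monomial element is diagonal. -/
lemma IsMono.eq_one_of_mem_B {g : Ginf X k} {σ : Equiv.Perm ℤ} (hg : IsMono g σ)
    (hB : g ∈ B X k) : σ = 1 := by
  have hle : ∀ z, σ z ≤ z := by
    intro z
    by_contra hlt
    obtain ⟨a, ha⟩ := hg z
    have := (mem_B_iff g).1 hB (σ z) z (not_le.1 hlt)
    rw [coef, ha, Finsupp.smul_apply, e_apply, if_pos rfl, Units.smul_def, smul_eq_mul,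
      mul_one] at this
    exact a.ne_zero this
  obtain ⟨n, hn⟩ := hg.exists_forall_eq
  by_contra hne
  have hex : ∃ z : ℤ, z ≤ n ∧ σ z ≠ z := by
    by_contra hall
    push Not at hall
    refine hne (Equiv.ext fun z => ?_)
    by_cases hz : z ≤ (n : ℤ)
    · exact hall z hz
    · exact hn z fun h => hz h.2.2
  have hbdd : ∀ z : ℤ, z ≤ n ∧ σ z ≠ z → -(n : ℤ) ≤ z := by
    intro z hz
    by_contra hlt
    exact hz.2 (hn z fun h => hlt h.2.1)
  -- Only finitely many coordinates are moved, so there is a least one. Its image is strictly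
  -- smaller, hence fixed, which contradicts injectivity.
  obtain ⟨m, hm, hmin⟩ := Int.exists_least_of_bdd ⟨_, hbdd⟩ hex
  have h1 : σ m < m := lt_of_le_of_ne (hle m) hm.2
  have h2 : σ (σ m) = σ m := by
    by_contra h
    have := hmin (σ m) ⟨h1.le.trans hm.1, h⟩
    omega
  exact hm.2 (σ.injective h2)

end Mono

/-! ### The decomposition `B = T U` -/

section Triangular

variable {X : Family}

lemma act_T_apply {t : Ginf X k} (ht : t ∈ T X k) (x : V k) (i : ℤ) :
    act t x i = coef t i i * x i := by
  rw [act_apply_eq_sum, Finset.sum_eq_single i]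
  · exact mul_comm _ _
  · intro b _ hb
    rw [(mem_T_iff t).1 ht i b (Ne.symm hb), mul_zero]
  · intro h
    rw [Finsupp.notMem_support_iff.1 h, zero_mul]

lemma coef_T_mul {t : Ginf X k} (ht : t ∈ T X k) (g : Ginf X k) (i j : ℤ) :
    coef (t * g) i j = coef t i i * coef g i j := act_T_apply ht _ _

/-- `B = T U`. -/
lemma exists_eq_mul_of_mem_B {b : Ginf X k} (hb : b ∈ B X k) :
    ∃ t ∈ T X k, ∃ u ∈ U X k, b = t * u := by
  obtain ⟨t, ht, h⟩ := exists_eq_coef_diag hb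
  refine ⟨t, ht, t⁻¹ * b, ?_, by group⟩
  have hd : ∀ z, coef t⁻¹ z z * coef t z z = 1 := by
    intro z
    rw [← coef_T_mul (inv_mem ht), inv_mul_cancel, coef_one, e_apply, if_pos rfl]
  rw [mem_U_iff]
  intro i j hij
  rw [coef_T_mul (inv_mem ht), e_apply]
  rcases hij.lt_or_eq with h' | rfl
  · rw [(mem_B_iff b).1 hb i j h', mul_zero, if_neg h'.ne]
  · rw [if_pos rfl, ← h, hd]

/-- An upper unitriangular automorphism with the properties of an element of a group of finite
rank, apart from the determinant condition, belongs to that group. -/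
lemma mem_level_of_unitriangular {n : ℕ} {f : GLV k}
    (h1 : ∀ z, z ∉ box X n → f.1 (e k z) = e k z)
    (h2 : ∀ z, z ∈ box X n → f.1 (e k z) ∈ spanOf k (box X n)) (h3 : Iso X f.1)
    (h4 : ∀ i j, j ≤ i → f.1 (e k j) i = e k j i) : f ∈ level X k n := by
  refine (mem_level_iff X n f).2 ⟨h1, h2, h3, ?_⟩
  refine (detCond_iff_of_triangular X n (f := 1) (fun i j hij => ?_) (fun i j hij => ?_)
    fun z => ?_).1 ((mem_level_iff X n 1).1 (one_mem _)).2.2.2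
  · rw [Module.End.one_apply, e_apply, if_neg hij.ne]
  · rw [h4 i j hij.le, e_apply, if_neg hij.ne]
  · rw [h4 z z le_rfl, Module.End.one_apply]

end Triangular

/-! ### The simple root subgroups -/

/-- The matrix unit `e_q ↦ e_p`. -/
def matUnit (k : Type u) [Field k] (p q : ℤ) : Module.End k (V k) :=
  Finsupp.lsingle p ∘ₗ Finsupp.lapply q

lemma matUnit_apply (p q : ℤ) (x : V k) : matUnit k p q x = x q • e k p := by
  simp [matUnit, e]

lemma matUnit_mul_ne (p : ℤ) {q r : ℤ} (h : r ≠ q) (s : ℤ) :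
    matUnit k p q * matUnit k r s = 0 := by
  refine LinearMap.ext fun x => ?_
  simp [matUnit_apply, e_apply, h]

lemma matUnit_e_apply (p q i j : ℤ) :
    matUnit k p q (e k j) i = if j = q ∧ p = i then 1 else 0 := by
  rw [matUnit_apply, Finsupp.smul_apply, e_apply, e_apply]
  by_cases h1 : j = q <;> by_cases h2 : p = i <;> simp [h1, h2]

/-- The element of the simple root subgroup with parameter `a`, as an endomorphism. -/
def rootEnd : Family → ℕ → k → Module.End k (V k)
  | .GL, i, a => 1 + a • matUnit k (i + 1) (i + 2)
  | .SL, i, a => 1 + a • matUnit k (i + 1) (i + 2)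
  | .Sp, 0, a => 1 + a • matUnit k (-1) 1
  -- The image `e_1 + a e_0 + c e_{-1}` of `e_1` is singular only for `c = -a²`, and its
  -- orthogonality to the image `e_0 + d e_{-1}` of `e_0` forces `d = -2a`.
  | .SOodd, 0, a => 1 + a • matUnit k 0 1 + (-(2 * a)) • matUnit k (-1) 0 +
      (-a ^ 2) • matUnit k (-1) 1
  | .SOeven, 0, a => 1 + a • matUnit k (-2) 1 + (-a) • matUnit k (-1) 2
  | _, i + 1, a => 1 + a • matUnit k (i + 1) (i + 2) + (-a) • matUnit k (-(i + 2)) (-(i + 1))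

lemma rootEnd_mul_single {p q : ℤ} (h : p ≠ q) (a b : k) :
    (1 + a • matUnit k p q) * (1 + b • matUnit k p q) = 1 + (a + b) • matUnit k p q := by
  simp only [mul_add, add_mul, one_mul, mul_one, smul_mul_assoc, mul_smul_comm,
    matUnit_mul_ne _ h, smul_zero, add_zero, add_smul]
  abel

lemma rootEnd_mul_double {p q r s : ℤ} (h1 : p ≠ q) (h2 : p ≠ s) (h3 : r ≠ q) (h4 : r ≠ s)
    (a b c d : k) :
    (1 + a • matUnit k p q + c • matUnit k r s) * (1 + b • matUnit k p q + d • matUnit k r s) =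
      1 + (a + b) • matUnit k p q + (c + d) • matUnit k r s := by
  simp only [mul_add, add_mul, one_mul, mul_one, smul_mul_assoc, mul_smul_comm,
    matUnit_mul_ne _ h1, matUnit_mul_ne _ h2, matUnit_mul_ne _ h3, matUnit_mul_ne _ h4,
    smul_zero, add_zero, add_smul]
  abel

lemma rootEnd_mul (X : Family) (i : ℕ) (a b : k) :
    rootEnd X i a * rootEnd X i b = rootEnd X i (a + b) := by
  match X, i with
  | .GL, i | .SL, i => exact rootEnd_mul_single (by omega) a b
  | .Sp, 0 => exact rootEnd_mul_single (by omega) a b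
  | .SOodd, 0 =>
    refine LinearMap.ext fun x => Finsupp.ext fun z => ?_
    simp only [rootEnd, Module.End.mul_apply, LinearMap.add_apply,
      LinearMap.smul_apply, Module.End.one_apply, matUnit_apply, Finsupp.add_apply, Finsupp.smul_apply, e_apply, smul_eq_mul]
    norm_num
    split_ifs <;> first | omega | ring
  | .SOeven, 0 =>
    rw [rootEnd, rootEnd, rootEnd, neg_add]
    exact rootEnd_mul_double (by omega) (by omega) (by omega) (by omega) a b _ _
  | .SOeven, i + 1 | .SOodd, i + 1 | .Sp, i + 1 =>
    simp only [rootEnd, neg_add (a := a)]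
    exact rootEnd_mul_double (by omega) (by omega) (by omega) (by omega) a b _ _

lemma rootEnd_zero (X : Family) (i : ℕ) : rootEnd X i (0 : k) = 1 := by
  match X, i with
  | .GL, i | .SL, i | .Sp, 0 | .SOodd, 0 | .SOeven, 0 => simp [rootEnd]
  | .SOeven, i + 1 | .SOodd, i + 1 | .Sp, i + 1 => simp [rootEnd]

lemma half_double {p q : ℤ} (hp : 0 < p) (hq : 0 < q) (hpq : p ≠ q) (a : k) (x y : V k) :
    half k ((1 + a • matUnit k p q + (-a) • matUnit k (-q) (-p)) x)
      ((1 + a • matUnit k p q + (-a) • matUnit k (-q) (-p)) y) = half k x y := by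
  have h1 : ¬ 0 < -q := by omega
  have h2 : ¬ p < 0 := by omega
  have h3 : -q < 0 := by omega
  have h4 : -q ≠ q := by omega
  simp only [LinearMap.add_apply, LinearMap.smul_apply,
    Module.End.one_apply, matUnit_apply, map_add, map_smul, half_e_left, half_e_right,
    if_pos hp, if_neg h1, if_neg h2, if_pos h3, neg_neg, smul_eq_mul, e_apply, neg_inj,
    if_neg hpq, if_neg h4]
  ring

lemma iso_rootEnd (X : Family) (i : ℕ) (a : k) : Iso X (rootEnd X i a) := by
  match X, i with
  | .GL, i | .SL, i => trivial
  | .Sp, 0 =>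
    intro x y
    simp [rootEnd, matUnit_apply, half_e_left, half_e_right]
    ring
  | .SOodd, 0 =>
    intro x
    simp [rootEnd, matUnit_apply, half_e_left, half_e_right, e_apply]
    ring
  | .SOeven, 0 =>
    intro x
    simp [rootEnd, matUnit_apply, half_e_left, half_e_right]
    ring
  | .SOeven, i + 1 =>
    exact fun x => half_double (p := i + 1) (q := i + 2) (by omega) (by omega) (by omega) a x x
  | .Sp, i + 1 =>
    intro x y
    have h := half_double (p := i + 1) (q := i + 2) (by omega) (by omega) (by omega) a
    rw [rootEnd, h x y, h y x]
    all_goals simp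
  | .SOodd, i + 1 =>
    intro x
    have h := half_double (p := i + 1) (q := i + 2) (by omega) (by omega) (by omega) a x x
    have h0 : rootEnd .SOodd (i + 1) a x 0 = x 0 := by
      simp only [rootEnd, LinearMap.add_apply, LinearMap.smul_apply,
        Module.End.one_apply, matUnit_apply, Finsupp.add_apply,
        Finsupp.smul_apply, e_apply]
      rw [if_neg (by omega), if_neg (by omega)]
      simp
    rw [h0]
    exact congrArg (· + _) h

/-- The pairs of coordinates at which elements of a simple root subgroup may have nonzero
coefficients off the diagonal. -/
def rootSupp : Family → ℕ → ℤ → ℤ → Prop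
  | .GL, i, p, q => p = i + 1 ∧ q = i + 2
  | .SL, i, p, q => p = i + 1 ∧ q = i + 2
  | .Sp, 0, p, q => p = -1 ∧ q = 1
  | .SOodd, 0, p, q => (p = -1 ∧ q = 1) ∨ (p = 0 ∧ q = 1) ∨ (p = -1 ∧ q = 0)
  | .SOeven, 0, p, q => (p = -2 ∧ q = 1) ∨ (p = -1 ∧ q = 2)
  | _, i + 1, p, q => (p = i + 1 ∧ q = i + 2) ∨ (p = -(i + 2) ∧ q = -(i + 1))

lemma rootEnd_coef_eq (X : Family) (i : ℕ) (a : k) {p q : ℤ} (h : ¬ rootSupp X i p q) :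
    rootEnd X i a (e k q) p = e k q p := by
  match X, i, h with
  | .GL, i, h | .SL, i, h =>
    simp only [rootSupp] at h
    simp only [rootEnd, LinearMap.add_apply, LinearMap.smul_apply, Module.End.one_apply,
      Finsupp.add_apply, Finsupp.smul_apply, matUnit_e_apply]
    rw [if_neg (by omega)]
    simp
  | .Sp, 0, h =>
    simp only [rootSupp] at h
    simp only [rootEnd, LinearMap.add_apply, LinearMap.smul_apply, Module.End.one_apply,
      Finsupp.add_apply, Finsupp.smul_apply, matUnit_e_apply]
    rw [if_neg (by omega)]
    simp
  | .SOodd, 0, h =>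
    simp only [rootSupp] at h
    simp only [rootEnd, LinearMap.add_apply, LinearMap.smul_apply, Module.End.one_apply,
      Finsupp.add_apply, Finsupp.smul_apply, matUnit_e_apply]
    rw [if_neg (by omega), if_neg (by omega), if_neg (by omega)]
    simp
  | .SOeven, 0, h =>
    simp only [rootSupp] at h
    simp only [rootEnd, LinearMap.add_apply, LinearMap.smul_apply, Module.End.one_apply,
      Finsupp.add_apply, Finsupp.smul_apply, matUnit_e_apply]
    rw [if_neg (by omega), if_neg (by omega)]
    simp
  | .SOeven, i + 1, h | .SOodd, i + 1, h | .Sp, i + 1, h =>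
    simp only [rootSupp] at h
    simp only [rootEnd, LinearMap.add_apply, LinearMap.smul_apply, Module.End.one_apply,
      Finsupp.add_apply, Finsupp.smul_apply, matUnit_e_apply]
    rw [if_neg (by omega), if_neg (by omega)]
    simp

lemma rootSupp_lt {X : Family} {i : ℕ} {p q : ℤ} (h : rootSupp X i p q) : p < q := by
  match X, i, h with
  | .GL, i, h | .SL, i, h | .Sp, 0, h | .SOodd, 0, h | .SOeven, 0, h => 
    simp only [rootSupp] at h; omega
  | .SOeven, i + 1, h | .SOodd, i + 1, h | .Sp, i + 1, h => simp only [rootSupp] at h; omega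

/-- The bound `i + 2` is not sharp for every family, but it serves all of them at once. -/
lemma mem_box_of_rootSupp {X : Family} {i : ℕ} {p q : ℤ} (h : rootSupp X i p q) :
    p ∈ box X (i + 2) ∧ q ∈ box X (i + 2) := by
  have h0 : ∀ z : ℤ, z ≠ 0 → z ∈ coords .SOeven ∧ z ∈ coords .Sp := fun z hz => ⟨hz, hz⟩
  have h1 : ∀ z : ℤ, 0 < z → z ∈ coords .GL ∧ z ∈ coords .SL := fun z hz => ⟨hz, hz⟩
  have h2 : ∀ z : ℤ, z ∈ coords .SOodd := fun z => trivial
  match X, i, h with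
  | .GL, i, h =>
    simp only [rootSupp] at h
    exact ⟨⟨(h1 p (by omega)).1, by omega, by omega⟩, ⟨(h1 q (by omega)).1, by omega, by omega⟩⟩
  | .SL, i, h =>
    simp only [rootSupp] at h
    exact ⟨⟨(h1 p (by omega)).1, by omega, by omega⟩, ⟨(h1 q (by omega)).1, by omega, by omega⟩⟩
  | .Sp, 0, h =>
    simp only [rootSupp] at h
    exact ⟨⟨(h0 p (by omega)).1, by omega, by omega⟩, ⟨(h0 q (by omega)).1, by omega, by omega⟩⟩
  | .SOodd, 0, h =>
    simp only [rootSupp] at h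
    exact ⟨⟨h2 p, by omega, by omega⟩, ⟨h2 q, by omega, by omega⟩⟩
  | .SOeven, 0, h =>
    simp only [rootSupp] at h
    exact ⟨⟨(h0 p (by omega)).1, by omega, by omega⟩, ⟨(h0 q (by omega)).1, by omega, by omega⟩⟩
  | .SOodd, i + 1, h =>
    simp only [rootSupp] at h
    exact ⟨⟨h2 p, by omega, by omega⟩, ⟨h2 q, by omega, by omega⟩⟩
  | .SOeven, i + 1, h | .Sp, i + 1, h =>
    simp only [rootSupp] at h
    exact ⟨⟨(h0 p (by omega)).1, by omega, by omega⟩, ⟨(h0 q (by omega)).1, by omega, by omega⟩⟩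

/-- The element of the simple root subgroup with parameter `a`, as an automorphism. -/
def rootUnit (X : Family) (i : ℕ) (a : k) : GLV k where
  val := rootEnd X i a
  inv := rootEnd X i (-a)
  val_inv := by rw [rootEnd_mul, add_neg_cancel, rootEnd_zero]
  inv_val := by rw [rootEnd_mul, neg_add_cancel, rootEnd_zero]

lemma rootUnit_mem_level (X : Family) (i : ℕ) (a : k) : rootUnit X i a ∈ level X k (i + 2) := by
  refine mem_level_of_unitriangular (fun z hz => Finsupp.ext fun w => ?_) (fun z hz => ?_)
    (iso_rootEnd X i a) fun p q hqp => ?_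
  · exact rootEnd_coef_eq X i a fun h => hz (mem_box_of_rootSupp h).2
  · refine mem_spanOf.2 fun w hw => ?_
    change rootEnd X i a (e k z) w = 0
    rw [rootEnd_coef_eq X i a fun h => hw (mem_box_of_rootSupp h).1, e_apply, if_neg]
    rintro rfl
    exact hw hz
  · exact rootEnd_coef_eq X i a fun h => absurd (rootSupp_lt h) hqp.not_gt

/-- The element of the simple root subgroup with parameter `a`. -/
def rootElt (X : Family) (i : ℕ) (a : k) : Ginf X k :=
  ⟨rootUnit X i a, mem_Ginf_iff.2 ⟨_, rootUnit_mem_level X i a⟩⟩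

lemma act_rootElt (X : Family) (i : ℕ) (a : k) (x : V k) :
    act (rootElt X i a) x = rootEnd X i a x := rfl

lemma rootElt_mul (X : Family) (i : ℕ) (a b : k) :
    rootElt X i a * rootElt X i b = rootElt X i (a + b) :=
  Subtype.ext (Units.ext (rootEnd_mul X i a b))

lemma rootElt_zero (X : Family) (i : ℕ) : rootElt X i (0 : k) = 1 :=
  Subtype.ext (Units.ext (rootEnd_zero X i))

lemma rootElt_inv (X : Family) (i : ℕ) (a : k) : (rootElt X i a)⁻¹ = rootElt X i (-a) := by
  rw [inv_eq_iff_mul_eq_one, rootElt_mul, add_neg_cancel, rootElt_zero]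

lemma rootElt_mem_U (X : Family) (i : ℕ) (a : k) : rootElt X i a ∈ U X k :=
  (mem_U_iff _).2 fun _ _ hqp => rootEnd_coef_eq X i a fun h =>
    absurd (rootSupp_lt h) hqp.not_gt

lemma simpleRefl_inv (X : Family) (i : ℕ) : (simpleRefl X i)⁻¹ = simpleRefl X i := by
  rw [inv_eq_iff_mul_eq_one]
  ext z
  match X, i with
  | .GL, i | .SL, i | .Sp, 0 | .SOodd, 0 => simp [simpleRefl]
  | .SOeven, 0 =>
    simp only [simpleRefl, Equiv.Perm.mul_apply, Equiv.swap_apply_def, Equiv.Perm.one_apply]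
    grind
  | .SOeven, i + 1 | .SOodd, i + 1 | .Sp, i + 1 =>
    simp only [simpleRefl, Equiv.Perm.mul_apply, Equiv.swap_apply_def, Equiv.Perm.one_apply]
    grind

lemma simpleRefl_simpleRefl (X : Family) (i : ℕ) (z : ℤ) :
    simpleRefl X i (simpleRefl X i z) = z := by
  nth_rewrite 1 [← simpleRefl_inv]
  exact (simpleRefl X i).symm_apply_apply z

lemma simpleRefl_lt_of_rootSupp {X : Family} {i : ℕ} {p q : ℤ} (h : rootSupp X i p q) :
    simpleRefl X i q < simpleRefl X i p := by
  match X, i, h with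
  | .GL, i, h | .SL, i, h | .Sp, 0, h | .SOodd, 0, h | .SOeven, 0, h =>
    simp only [rootSupp] at h
    simp only [simpleRefl, Equiv.Perm.mul_apply, Equiv.swap_apply_def]
    grind
  | .SOeven, i + 1, h | .SOodd, i + 1, h | .Sp, i + 1, h =>
    simp only [rootSupp] at h
    simp only [simpleRefl, Equiv.Perm.mul_apply, Equiv.swap_apply_def]
    grind

/-- The coordinates of the coefficient that is the parameter of a simple root element. -/
def marker : Family → ℕ → ℤ × ℤ
  | .GL, i => (i + 1, i + 2)
  | .SL, i => (i + 1, i + 2)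
  | .Sp, 0 => (-1, 1)
  | .SOodd, 0 => (0, 1)
  | .SOeven, 0 => (-2, 1)
  | _, i + 1 => (i + 1, i + 2)

/-- An element of `U` whose coefficient at the marker vanishes has vanishing coefficients at all
inversions of the simple reflection. -/
lemma coef_eq_zero_of_marker {X : Family} {i : ℕ} {u : Ginf X k} (hu : u ∈ U X k)
    (h : coef u (marker X i).1 (marker X i).2 = 0) {p q : ℤ} (hpq : p < q)
    (hs : simpleRefl X i q < simpleRefl X i p) : coef u p q = 0 := by
  have hU := (mem_U_iff u).1 hu
  have hd : ∀ z, coef u z z = 1 := fun z => by rw [hU z z le_rfl, e_apply, if_pos rfl]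
  have hl : ∀ p q, q < p → coef u p q = 0 := fun p q h => by
    rw [hU p q h.le, e_apply, if_neg h.ne]
  have hzero : (0 : ℤ) ∉ coords X → p = 0 ∨ q = 0 → coef u p q = 0 := by
    rintro h0 (rfl | rfl)
    · rw [coef_of_notMem_left u h0, e_apply, if_neg (by omega)]
    · rw [coef_of_notMem_right u _ h0, e_apply, if_neg (by omega)]
  match X, i, u, h, hs with
  | .GL, i, u, h, hs | .SL, i, u, h, hs =>
    have : p = i + 1 ∧ q = i + 2 := by
      simp only [simpleRefl, Equiv.swap_apply_def] at hs
      grind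
    rw [this.1, this.2]
    exact h
  | .Sp, 0, u, h, hs =>
    have : (p = -1 ∧ q = 1) ∨ p = 0 ∨ q = 0 := by
      simp only [simpleRefl, Equiv.swap_apply_def] at hs
      grind
    rcases this with ⟨rfl, rfl⟩ | h0
    · exact h
    · exact hzero (fun h => h rfl) h0
  | .SOodd, 0, u, h, hs =>
    have : (p = -1 ∧ q = 1) ∨ (p = 0 ∧ q = 1) ∨ (p = -1 ∧ q = 0) := by
      simp only [simpleRefl, Equiv.swap_apply_def] at hs
      grind
    have h01 : coef u 0 1 = 0 := h
    rcases this with ⟨rfl, rfl⟩ | ⟨rfl, rfl⟩ | ⟨rfl, rfl⟩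
    -- The quadratic form at `u e_1` says that the coefficient at `(-1, 1)` plus the square of the
    -- one at `(0, 1)` is zero.
    · have h1 : half k (act u (e k 1)) (act u (e k 1)) + coef u 0 1 ^ 2 =
        half k (e k 1) (e k 1) + e k 1 0 ^ 2 := isoOf u (e k 1)
      rw [half_e_self, half_eq_single one_pos fun z hz hz1 =>
        mul_eq_zero_of_left (hl z 1 (by omega)) _, h01, e_apply, if_neg (by omega)] at h1
      change coef u 1 1 * coef u (-1) 1 + _ = _ at h1
      rw [hd] at h1
      simpa using h1
    · exact h
    -- Since the coefficient at `(0, 1)` vanishes, orthogonality of `u e_1` and `u e_0` leaves only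
    -- the coefficient at `(-1, 0)`.
    · have h1 := bil_act u (e k 1) (e k 0)
      have h2 : bil .SOodd (e k 1) (e k 0) = 0 := bil_eq_zero fun z => by
        rw [e_apply, e_apply]
        by_cases hz : (1 : ℤ) = z
        · rw [if_neg (c := (0 : ℤ) = -z) (by omega), mul_zero]
        · rw [if_neg hz, zero_mul]
      rw [h2, bil_eq_single (X := .SOodd) (a := 1) trivial one_ne_zero] at h1
      · change _ * (coef u 1 1 * coef u (-1) 0) = 0 at h1
        rw [hd, one_mul] at h1
        exact (mul_eq_zero.1 h1).resolve_left (bilSign k _ 1 : kˣ).ne_zero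
      · intro z hz
        by_cases h0 : z = 0
        · subst h0
          exact mul_eq_zero_of_left h01 _
        · rcases lt_or_gt_of_ne hz with h' | h'
          · exact mul_eq_zero_of_right _ (hl (-z) 0 (by omega))
          · exact mul_eq_zero_of_left (hl z 1 h') _
  | .SOeven, 0, u, h, hs =>
    have : (p = 0 ∨ q = 0) ∨ (p = -2 ∧ q = 1) ∨ (p = -1 ∧ q = 1) ∨ (p = -1 ∧ q = 2) ∨
        (p = -2 ∧ q = 2) := by
      simp only [simpleRefl, Equiv.Perm.mul_apply, Equiv.swap_apply_def] at hs
      grind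
    -- The marker is `(-2, 1)`. The quadratic form at `u e_1` gives `(-1, 1)`, the pairing of `u
    -- e_1` with `u e_2` gives `(-1, 2)`, and the quadratic form at `u e_2` gives `(-2, 2)`.
    have h21 : coef u (-2) 1 = 0 := h
    have h11 : coef u (-1) 1 = 0 := by
      have h1 : half k (act u (e k 1)) (act u (e k 1)) = half k (e k 1) (e k 1) :=
        isoOf u (e k 1)
      rw [half_e_self, half_eq_single one_pos fun z hz hz1 =>
        mul_eq_zero_of_left (hl z 1 (by omega)) _] at h1
      change coef u 1 1 * coef u (-1) 1 = _ at h1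
      rwa [hd, one_mul] at h1
    have h12 : coef u (-1) 2 = 0 := by
      have h1 := bil_act u (e k 1) (e k 2)
      have h2 : bil .SOeven (e k 1) (e k 2) = 0 := bil_eq_zero fun z => by
        rw [e_apply, e_apply]
        by_cases hz : (1 : ℤ) = z
        · rw [if_neg (c := (2 : ℤ) = -z) (by omega), mul_zero]
        · rw [if_neg hz, zero_mul]
      rw [h2, bil_eq_single (X := .SOeven) (a := 1) trivial one_ne_zero] at h1
      · change _ * (coef u 1 1 * coef u (-1) 2) = 0 at h1
        rw [hd, one_mul] at h1
        exact (mul_eq_zero.1 h1).resolve_left (bilSign k _ 1 : kˣ).ne_zero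
      · intro z hz
        by_cases h0 : z = 0
        · subst h0
          refine mul_eq_zero_of_left ?_ _
          change coef u 0 1 = 0
          rw [coef_of_notMem_left u (fun h => h rfl), e_apply, if_neg (by omega)]
        by_cases h1' : z = -1
        · rw [h1']
          exact mul_eq_zero_of_left h11 _
        by_cases h2' : z = -2
        · rw [h2']
          exact mul_eq_zero_of_left h21 _
        rcases lt_or_gt_of_ne hz with h' | h'
        · exact mul_eq_zero_of_right _ (hl (-z) 2 (by omega))
        · exact mul_eq_zero_of_left (hl z 1 h') _
    rcases this with h0 | ⟨rfl, rfl⟩ | ⟨rfl, rfl⟩ | ⟨rfl, rfl⟩ | ⟨rfl, rfl⟩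
    · exact hzero (fun h => h rfl) h0
    · exact h21
    · exact h11
    · exact h12
    · have h1 : half k (act u (e k 2)) (act u (e k 2)) = half k (e k 2) (e k 2) :=
        isoOf u (e k 2)
      rw [half_e_self, half_eq_single (a := 2) (by omega)] at h1
      · change coef u 2 2 * coef u (-2) 2 = _ at h1
        rwa [hd, one_mul] at h1
      · intro z hz hz2
        by_cases hz1 : z = 1
        · rw [hz1]
          exact mul_eq_zero_of_right _ h12
        · exact mul_eq_zero_of_left (hl z 2 (by omega)) _
  | .SOeven, i + 1, u, h, hs | .SOodd, i + 1, u, h, hs | .Sp, i + 1, u, h, hs =>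
    have : (p = i + 1 ∧ q = i + 2) ∨ (p = -(i + 2) ∧ q = -(i + 1)) := by
      simp only [simpleRefl, Equiv.Perm.mul_apply, Equiv.swap_apply_def] at hs
      grind
    have h12 : coef u (i + 1) (i + 2) = 0 := h
    rcases this with ⟨rfl, rfl⟩ | ⟨rfl, rfl⟩
    · exact h
    -- Orthogonality of `u e_{i+2}` and `u e_{-(i+1)}` ties the second inversion to the marker `(i +
    -- 1, i + 2)`.
    · have h1 := bil_act u (e k (i + 2)) (e k (-(i + 1)))
      have h2 : ∀ X, bil X (e k (i + 2)) (e k (-(i + 1))) = 0 := fun X => bil_eq_zero fun z => by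
        rw [e_apply, e_apply]
        by_cases hz : (i + 2 : ℤ) = z
        · rw [if_neg (c := (-(i + 1) : ℤ) = -z) (by omega), mul_zero]
        · rw [if_neg hz, zero_mul]
      rw [h2, bil_eq_single (a := i + 2) (by trivial) (by omega)] at h1
      · change _ * (coef u (i + 2) (i + 2) * coef u (-(i + 2)) (-(i + 1))) = 0 at h1
        rw [hd, one_mul] at h1
        exact (mul_eq_zero.1 h1).resolve_left (bilSign k _ _ : kˣ).ne_zero
      · intro z hz
        by_cases h1' : z = i + 1
        · rw [h1']
          exact mul_eq_zero_of_left h12 _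
        rcases lt_or_gt_of_ne hz with h' | h'
        · exact mul_eq_zero_of_right _ (hl (-z) (-(i + 1)) (by omega))
        · exact mul_eq_zero_of_left (hl z (i + 2) h') _

/-! ### The factorization `U = U_i' U_i` and the uniqueness of `x` -/

section Factorization

variable {X : Family}

/-- The third summand occurs only for the short root of `SO_{2n+1}`. The inequality ensures that an
upper triangular element applied afterwards cannot bring it back to the row of the marker. -/
lemma rootEnd_marker (X : Family) (i : ℕ) (a : k) :
    ∃ b : k, rootEnd X i a (e k (marker X i).2) =
      e k (marker X i).2 + a • e k (marker X i).1 + b • e k (-(marker X i).2) ∧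
      (b ≠ 0 → -(marker X i).2 < (marker X i).1) := by
  have key : ∀ p q : ℤ, p ≠ q → (1 + a • matUnit k p q) (e k q) = e k q + a • e k p +
      (0 : k) • e k (-q) := by
    intro p q _
    rw [LinearMap.add_apply, LinearMap.smul_apply, matUnit_apply, e_apply, if_pos rfl, one_smul,
      zero_smul, add_zero]
    rfl
  have key' : ∀ p q r s : ℤ, p ≠ q → s ≠ q →
      (1 + a • matUnit k p q + (-a) • matUnit k r s) (e k q) = e k q + a • e k p +
      (0 : k) • e k (-q) := by
    intro p q r s h hs
    rw [LinearMap.add_apply, key p q h, LinearMap.smul_apply, matUnit_apply, e_apply,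
      if_neg hs.symm, zero_smul, zero_smul, smul_zero, add_zero]
  match X, i with
  | .GL, i | .SL, i => exact ⟨0, key _ _ (by omega), fun h => absurd rfl h⟩
  | .Sp, 0 => exact ⟨0, key _ _ (by omega), fun h => absurd rfl h⟩
  | .SOodd, 0 =>
    refine ⟨-a ^ 2, ?_, fun _ => by simp [marker]⟩
    simp [rootEnd, marker, matUnit_apply, e_apply]
  | .SOeven, 0 => exact ⟨0, key' _ _ _ _ (by omega) (by omega), fun h => absurd rfl h⟩
  | .SOeven, i + 1 | .SOodd, i + 1 | .Sp, i + 1 =>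
    exact ⟨0, key' _ _ _ _ (by omega) (by omega),
      fun h => absurd rfl h⟩

/-- So the marker coefficient of `u` is the parameter of its `U_i`-component, and a root element on
the right can cancel it. -/
lemma coef_mul_rootElt_marker {u : Ginf X k} (hu : u ∈ U X k) (i : ℕ) (a : k) :
    coef (u * rootElt X i a) (marker X i).1 (marker X i).2 =
      coef u (marker X i).1 (marker X i).2 + a := by
  obtain ⟨b, hb, hlt⟩ := rootEnd_marker X i a
  have hU := (mem_U_iff u).1 hu
  rw [coef, act_mul, act_rootElt, hb, map_add, map_add, map_smul, map_smul, Finsupp.add_apply,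
    Finsupp.add_apply, Finsupp.smul_apply, Finsupp.smul_apply]
  change _ + a • coef u _ _ + b • coef u _ _ = _
  have h1 : b • coef u (marker X i).1 (-(marker X i).2) = 0 := by
    by_cases h0 : b = 0
    · rw [h0, zero_smul]
    · rw [hU _ _ (hlt h0).le, e_apply, if_neg (hlt h0).ne, smul_zero]
  rw [h1, hU _ _ le_rfl, e_apply, if_pos rfl, add_zero, smul_eq_mul, mul_one]
  rfl

lemma conj_mem_U_of_coef {n : Ginf X k} {i : ℕ} (hn : Represents n i) {u : Ginf X k}
    (hu : u ∈ U X k)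
    (h : ∀ p q, p < q → simpleRefl X i q < simpleRefl X i p → coef u p q = 0) :
    n * u * n⁻¹ ∈ U X k := by
  rw [mem_U_iff]
  intro p q hqp
  rw [← simpleRefl_simpleRefl X i p, ← simpleRefl_simpleRefl X i q, hn.isMono.conj_coef_eq_iff]
  rcases le_or_gt (simpleRefl X i q) (simpleRefl X i p) with h1 | h1
  · exact (mem_U_iff u).1 hu _ _ h1
  · rw [h _ _ h1, e_apply, if_neg h1.ne']
    rw [simpleRefl_simpleRefl, simpleRefl_simpleRefl]
    refine lt_of_le_of_ne hqp ?_
    rintro rfl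
    exact lt_irrefl _ h1

lemma rootElt_mem_Usub {n : Ginf X k} {i : ℕ} (hn : Represents n i) (a : k) :
    rootElt X i a ∈ Usub n := by
  refine ⟨rootElt_mem_U X i a, ?_⟩
  change n * rootElt X i a * n⁻¹ ∈ Uminus X k
  rw [mem_Uminus_iff]
  intro p q hpq
  rw [← simpleRefl_simpleRefl X i p, ← simpleRefl_simpleRefl X i q, hn.isMono.conj_coef_eq_iff]
  refine rootEnd_coef_eq X i a fun h => ?_
  have := simpleRefl_lt_of_rootSupp h
  rw [simpleRefl_simpleRefl, simpleRefl_simpleRefl] at this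
  omega

lemma eq_one_of_mem_Usub_of_mem_Usub' {n u : Ginf X k} (h : u ∈ Usub n) (h' : u ∈ Usub' n) :
    u = 1 := by
  have h1 : n * u * n⁻¹ = 1 := eq_one_of_mem_B_of_mem_Uminus (U_le_B h'.2) h.2
  rwa [conj_eq_one_iff] at h1

/-- Once the marker coefficient is cancelled, the coefficients at all inversions of the reflection
vanish, and conjugation by `n` produces nothing below the diagonal. -/
lemma mul_rootElt_neg_mem_Usub' {n : Ginf X k} {i : ℕ} (hn : Represents n i) {u : Ginf X k}
    (hu : u ∈ U X k) :
    u * rootElt X i (-coef u (marker X i).1 (marker X i).2) ∈ Usub' n := by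
  have h1 := mul_mem hu (rootElt_mem_U X i (-coef u (marker X i).1 (marker X i).2))
  refine ⟨h1, conj_mem_U_of_coef hn h1 fun p q hpq hs => coef_eq_zero_of_marker h1 ?_ hpq hs⟩
  rw [coef_mul_rootElt_marker hu, add_neg_cancel]

/-- Dividing `w` by the root element with the same marker coefficient leaves an element of both
`U_i` and `U_i'`, which is trivial. -/
lemma mem_Usub_iff {n : Ginf X k} {i : ℕ} (hn : Represents n i) {w : Ginf X k} :
    w ∈ Usub n ↔ ∃ a, w = rootElt X i a := by
  constructor
  · intro hw
    have h1 := mul_rootElt_neg_mem_Usub' hn hw.1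
    have h2 := eq_one_of_mem_Usub_of_mem_Usub' (mul_mem hw (rootElt_mem_Usub hn _)) h1
    refine ⟨coef w (marker X i).1 (marker X i).2, ?_⟩
    rw [← rootElt_inv, mul_inv_eq_one] at h2
    exact h2
  · rintro ⟨a, rfl⟩
    exact rootElt_mem_Usub hn a

/-- `U = U_i' U_i` with uniqueness. -/
lemma existsUnique_factorization {n : Ginf X k} {i : ℕ} (hn : Represents n i) {u : Ginf X k}
    (hu : u ∈ U X k) : ∃! p : Usub' n × Usub n, u = (p.1 : Ginf X k) * p.2 := by
  refine ⟨⟨⟨_, mul_rootElt_neg_mem_Usub' hn hu⟩, ⟨_, rootElt_mem_Usub hn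
    (coef u (marker X i).1 (marker X i).2)⟩⟩, ?_, ?_⟩
  · change u = u * _ * _
    rw [mul_assoc, rootElt_mul, neg_add_cancel, rootElt_zero, mul_one]
  · have huniq : ∀ p q : Usub' n × Usub n, u = (p.1 : Ginf X k) * p.2 →
        u = (q.1 : Ginf X k) * q.2 → p = q := by
      rintro ⟨⟨a, ha⟩, ⟨b, hb⟩⟩ ⟨⟨c, hc⟩, ⟨d, hd⟩⟩ h1 h2
      change u = a * b at h1
      change u = c * d at h2
      -- One side lies in `U_i'`, the other in `U_i`, and these groups meet trivially.
      have h3 : c⁻¹ * a = d * b⁻¹ := by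
        rw [inv_mul_eq_iff_eq_mul, ← mul_assoc, ← h2, h1, mul_assoc, mul_inv_cancel, mul_one]
      have h4 : c⁻¹ * a = 1 := eq_one_of_mem_Usub_of_mem_Usub'
        (h3 ▸ mul_mem hd (inv_mem hb)) (mul_mem (inv_mem hc) ha)
      have h5 : c = a := inv_mul_eq_one.1 h4
      have h6 : d = b := by rw [← mul_inv_eq_one, ← h3, h4]
      subst h5 h6
      rfl
    intro q hq
    refine huniq _ _ hq ?_
    change u = u * _ * _
    rw [mul_assoc, rootElt_mul, neg_add_cancel, rootElt_zero, mul_one]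

lemma conj_mem_T {n : Ginf X k} {σ : Equiv.Perm ℤ} (hn : IsMono n σ) {t : Ginf X k}
    (ht : t ∈ T X k) : n * t * n⁻¹ ∈ T X k := by
  have h := (hn.mul (isMono_one_iff.2 ht)).mul hn.inv
  rw [mul_one, mul_inv_cancel] at h
  exact h

/-- Rearranged, the equation identifies the lower unitriangular element `n (y' y⁻¹) n⁻¹` with an
element of `B`, so it is trivial. What remains places `x'⁻¹ x` in `T ∩ U`. -/
lemma eq_of_mul_eq_mul {n : Ginf X k} {i : ℕ} (hn : Represents n i) {x x' t t' y y' : Ginf X k}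
    (hx : x ∈ Usub n) (hx' : x' ∈ Usub n) (ht : t ∈ T X k) (ht' : t' ∈ T X k)
    (hy : y ∈ Usub n) (hy' : y' ∈ Usub n) (h : x * n * t * y = x' * n * t' * y') : x = x' := by
  have hv : n * (y' * y⁻¹) * n⁻¹ ∈ Uminus X k := (mul_mem hy' (inv_mem hy) : _ ∈ Usub n).2
  have h1 : (n * t' * n⁻¹)⁻¹ * (x'⁻¹ * x) * (n * t * n⁻¹) = n * (y' * y⁻¹) * n⁻¹ := by
    have h2 : x'⁻¹ * x = n * t' * y' * (n * t * y)⁻¹ := by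
      rw [eq_mul_inv_iff_mul_eq, mul_assoc, inv_mul_eq_iff_eq_mul]
      simpa only [mul_assoc] using h
    rw [h2]
    group
  have hT := conj_mem_T hn.isMono ht
  have hT' := conj_mem_T hn.isMono ht'
  have hU : x'⁻¹ * x ∈ U X k := mul_mem (inv_mem hx'.1) hx.1
  have h3 : n * (y' * y⁻¹) * n⁻¹ = 1 := by
    refine eq_one_of_mem_B_of_mem_Uminus ?_ hv
    rw [← h1]
    exact mul_mem (mul_mem (inv_mem (T_le_B hT')) (U_le_B hU)) (T_le_B hT)
  rw [h3] at h1
  have h4 : x'⁻¹ * x = (n * t' * n⁻¹) * (n * t * n⁻¹)⁻¹ := by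
    rwa [mul_assoc, inv_mul_eq_one, eq_comm, ← eq_mul_inv_iff_mul_eq] at h1
  have h5 : x'⁻¹ * x = 1 := eq_one_of_mem_T_of_mem_U (h4 ▸ mul_mem hT' (inv_mem hT)) hU
  exact (inv_mul_eq_one.1 h5).symm

/-! ### The rank one groups -/

/-- The element of the opposite of a simple root subgroup with parameter `c`. -/
def oppEnd : Family → ℕ → k → Module.End k (V k)
  | .GL, i, c => 1 + c • matUnit k (i + 2) (i + 1)
  | .SL, i, c => 1 + c • matUnit k (i + 2) (i + 1)
  | .Sp, 0, c => 1 + c • matUnit k 1 (-1)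
  | .SOodd, 0, c => 1 + c • matUnit k 0 (-1) + (-(2 * c)) • matUnit k 1 0 +
      (-c ^ 2) • matUnit k 1 (-1)
  | .SOeven, 0, c => 1 + c • matUnit k 1 (-2) + (-c) • matUnit k 2 (-1)
  | _, i + 1, c => 1 + c • matUnit k (i + 2) (i + 1) + (-c) • matUnit k (-(i + 1)) (-(i + 2))

/-- The product of three elementary `2 × 2` matrices with parameters `b, c, b` has diagonal entries
`1 + b c`, which vanish here. -/
lemma single_sl2 {p q : ℤ} (h : p ≠ q) {b c : k} (hbc : b * c = -1) (z : ℤ) :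
    ∃ a : kˣ, (1 + b • matUnit k p q) ((1 + c • matUnit k q p) ((1 + b • matUnit k p q) (e k z))) =
      a • e k (Equiv.swap p q z) := by
  have hc : c ≠ 0 := by rintro rfl; simp at hbc
  have hb : b ≠ 0 := by rintro rfl; simp at hbc
  have hcb : c * b = -1 := by rw [mul_comm]; exact hbc
  simp only [LinearMap.add_apply, Module.End.one_apply, LinearMap.smul_apply, matUnit_apply]
  by_cases hp : z = p
  · subst hp
    refine ⟨Units.mk0 c hc, ?_⟩
    rw [Equiv.swap_apply_left, Units.smul_mk0]
    refine Finsupp.ext fun w => ?_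
    simp [e_apply, h, h.symm]
    split_ifs <;> simp_all
  · by_cases hq : z = q
    · subst hq
      refine ⟨Units.mk0 b hb, ?_⟩
      rw [Equiv.swap_apply_right, Units.smul_mk0]
      refine Finsupp.ext fun w => ?_
      simp [e_apply, h, h.symm]
      split_ifs <;> simp_all
    · refine ⟨1, ?_⟩
      rw [Equiv.swap_apply_of_ne_of_ne hp hq, one_smul]
      simp [e_apply, hp, hq]

/-- Two commuting copies of the `SL_2` identity on disjoint pairs of coordinates, with parameters
`b, c` and `-b, -c`. -/
lemma double_sl2 {p q r s : ℤ} (h1 : p ≠ q) (h2 : r ≠ s) (h3 : p ≠ r) (h4 : p ≠ s) (h5 : q ≠ r)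
    (h6 : q ≠ s) {b c : k} (hbc : b * c = -1) (z : ℤ) :
    ∃ a : kˣ, (1 + b • matUnit k p q + (-b) • matUnit k r s)
      ((1 + c • matUnit k q p + (-c) • matUnit k s r)
        ((1 + b • matUnit k p q + (-b) • matUnit k r s) (e k z))) =
      a • e k ((Equiv.swap p q * Equiv.swap r s) z) := by
  have hc : c ≠ 0 := by rintro rfl; simp at hbc
  have hb : b ≠ 0 := by rintro rfl; simp at hbc
  have hcb : c * b = -1 := by rw [mul_comm]; exact hbc
  simp only [LinearMap.add_apply, Module.End.one_apply, LinearMap.smul_apply, matUnit_apply,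
    Equiv.Perm.mul_apply]
  by_cases hp : z = p
  · subst hp
    refine ⟨Units.mk0 c hc, ?_⟩
    rw [Equiv.swap_apply_of_ne_of_ne h3 h4, Equiv.swap_apply_left, Units.smul_mk0]
    refine Finsupp.ext fun w => ?_
    simp [e_apply, h1, h1.symm, h3, h4, h5, h6, h3.symm, h4.symm, h5.symm, h6.symm]
    split_ifs <;> simp_all
  by_cases hq : z = q
  · subst hq
    refine ⟨Units.mk0 b hb, ?_⟩
    rw [Equiv.swap_apply_of_ne_of_ne h5 h6, Equiv.swap_apply_right, Units.smul_mk0]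
    refine Finsupp.ext fun w => ?_
    simp [e_apply, h1, h1.symm, h3, h4, h5, h6, h3.symm, h4.symm, h5.symm, h6.symm]
    split_ifs <;> simp_all
  by_cases hr : z = r
  · subst hr
    refine ⟨-Units.mk0 c hc, ?_⟩
    rw [Equiv.swap_apply_left, Equiv.swap_apply_of_ne_of_ne h4.symm h6.symm]
    refine Finsupp.ext fun w => ?_
    simp [e_apply, h2, h2.symm, h3, h4, h5, h6, h3.symm, h4.symm, h5.symm, h6.symm]
    split_ifs <;> simp_all
  by_cases hs : z = s
  · subst hs
    refine ⟨-Units.mk0 b hb, ?_⟩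
    rw [Equiv.swap_apply_right, Equiv.swap_apply_of_ne_of_ne h3.symm h5.symm]
    refine Finsupp.ext fun w => ?_
    simp [e_apply, h2, h2.symm, h3, h4, h5, h6, h3.symm, h4.symm, h5.symm, h6.symm]
    split_ifs <;> simp_all
  · refine ⟨1, ?_⟩
    rw [Equiv.swap_apply_of_ne_of_ne hr hs, Equiv.swap_apply_of_ne_of_ne hp hq, one_smul]
    simp [e_apply, hp, hq, hr, hs]

end Factorization

/-- The `SO_3` version. The coefficient of `e_1` in the image of `e_1` is `(1 - b c)²`, so the
condition is `b c = 1` instead of `b c = -1`. -/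
lemma short_sl2 {b c : k} (hbc : b * c = 1) (z : ℤ) :
    ∃ a : kˣ, rootEnd .SOodd 0 b (oppEnd .SOodd 0 c (rootEnd .SOodd 0 b (e k z))) =
      a • e k (simpleRefl .SOodd 0 z) := by
  have hc : c ≠ 0 := by rintro rfl; simp at hbc
  have hb : b ≠ 0 := by rintro rfl; simp at hbc
  have hcb : c * b = 1 := by rw [mul_comm]; exact hbc
  simp only [rootEnd, oppEnd, LinearMap.add_apply, Module.End.one_apply, LinearMap.smul_apply,
    matUnit_apply, simpleRefl]
  by_cases h1 : z = 1
  · subst h1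
    refine ⟨Units.mk0 (-b ^ 2) (neg_ne_zero.2 (pow_ne_zero _ hb)), ?_⟩
    rw [Equiv.swap_apply_left, Units.smul_mk0]
    refine Finsupp.ext fun w => ?_
    simp [e_apply]
    split_ifs <;> first | omega | grind
  by_cases h0 : z = 0
  · subst h0
    refine ⟨-1, ?_⟩
    rw [Equiv.swap_apply_of_ne_of_ne (by omega) (by omega)]
    refine Finsupp.ext fun w => ?_
    simp [e_apply]
    split_ifs <;> first | omega | grind
  by_cases h2 : z = -1
  · subst h2
    refine ⟨Units.mk0 (-c ^ 2) (neg_ne_zero.2 (pow_ne_zero _ hc)), ?_⟩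
    rw [Equiv.swap_apply_right, Units.smul_mk0]
    refine Finsupp.ext fun w => ?_
    simp [e_apply]
    split_ifs <;> first | omega | grind
  · refine ⟨1, ?_⟩
    rw [Equiv.swap_apply_of_ne_of_ne h1 h2, one_smul]
    simp [e_apply, h0, h1, h2]

lemma simpleRefl_succ {X : Family} (hX : X.HasForm) (i : ℕ) : simpleRefl X (i + 1) =
    Equiv.swap ((i : ℤ) + 1) (i + 2) * Equiv.swap (-((i : ℤ) + 1)) (-((i : ℤ) + 2)) := by
  match X, hX with
  | .SOeven, _ | .SOodd, _ | .Sp, _ => rfl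

lemma simpleRefl_succ_values {X : Family} (hX : X.HasForm) (i : ℕ) :
    simpleRefl X (i + 1) (i + 1) = i + 2 ∧ simpleRefl X (i + 1) (i + 2) = i + 1 ∧
    simpleRefl X (i + 1) (-(i + 1)) = -(i + 2) ∧ simpleRefl X (i + 1) (-(i + 2)) = -(i + 1) := by
  simp only [simpleRefl_succ hX, Equiv.Perm.mul_apply, Equiv.swap_apply_def]
  refine ⟨?_, ?_, ?_, ?_⟩ <;> grind

lemma bilSign_eq_of_pos (X : Family) {z w : ℤ} (hz : 0 < z) (hw : 0 < w) :
    bilSign k X z = bilSign k X w := by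
  match X with
  | .GL | .SL | .SOeven | .SOodd => rfl
  | .Sp => rw [bilSign, bilSign, if_pos hz, if_pos hw]

/-! ### Existence of the element `x` -/

section RankOne

variable {X : Family}

/-- The product of three elements of opposite simple root subgroups represents the reflection. -/
lemma exists_rootEnd_oppEnd (X : Family) (i : ℕ) {c : k} (hc : c ≠ 0) :
    ∃ b : k, ∀ z, ∃ a : kˣ, rootEnd X i b (oppEnd X i c (rootEnd X i b (e k z))) =
      a • e k (simpleRefl X i z) := by
  have hb : -c⁻¹ * c = -1 := by rw [neg_mul, inv_mul_cancel₀ hc]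
  match X, i with
  | .GL, i | .SL, i => exact ⟨-c⁻¹, single_sl2 (by omega) hb⟩
  | .Sp, 0 =>
    refine ⟨-c⁻¹, fun z => ?_⟩
    rw [simpleRefl, Equiv.swap_comm]
    exact single_sl2 (by omega) hb z
  | .SOodd, 0 => exact ⟨c⁻¹, short_sl2 (inv_mul_cancel₀ hc)⟩
  | .SOeven, 0 =>
    refine ⟨-c⁻¹, fun z => ?_⟩
    rw [simpleRefl, Equiv.swap_comm 1, Equiv.swap_comm 2]
    exact double_sl2 (by omega) (by omega) (by omega) (by omega) (by omega) (by omega) hb z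
  | .SOeven, i + 1 | .SOodd, i + 1 | .Sp, i + 1 =>
    refine ⟨-c⁻¹, fun z => ?_⟩
    rw [simpleRefl_succ (by trivial), Equiv.swap_comm (-((i : ℤ) + 1))]
    exact double_sl2 (by omega) (by omega) (by omega) (by omega) (by omega) (by omega) hb z

lemma act_inv_e {n : Ginf X k} {σ : Equiv.Perm ℤ} {a : ℤ → kˣ}
    (ha : ∀ z, act n (e k z) = a z • e k (σ z)) (z : ℤ) :
    act n⁻¹ (e k (σ z)) = (a z)⁻¹ • e k z := by
  have h := act_inv_act n (e k z)
  rw [ha, Units.smul_def, map_smul, ← Units.smul_def] at h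
  rw [← h, smul_smul, inv_mul_cancel, one_smul]

lemma conj_matUnit {n : Ginf X k} {σ : Equiv.Perm ℤ} {a : ℤ → kˣ}
    (ha : ∀ z, act n (e k z) = a z • e k (σ z)) (p q : ℤ) :
    n.1.1 * matUnit k p q * n⁻¹.1.1 = ((a p : k) * ↑(a q)⁻¹) • matUnit k (σ p) (σ q) := by
  refine hom_ext_e fun z => ?_
  obtain ⟨w, rfl⟩ := σ.surjective z
  rw [Module.End.mul_apply, Module.End.mul_apply]
  change act n (matUnit k p q (act n⁻¹ (e k (σ w)))) = _
  rw [act_inv_e ha, Units.smul_def, map_smul, map_smul, matUnit_apply, map_smul, ha,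
    LinearMap.smul_apply, matUnit_apply, e_apply, e_apply]
  by_cases h : w = q
  · subst h
    simp [Units.smul_def, smul_smul, mul_comm]
  · simp [h]

lemma conj_one (n : Ginf X k) : n.1.1 * (1 : Module.End k (V k)) * n⁻¹.1.1 = 1 := by
  rw [mul_one]
  exact n.1.mul_inv

/-- Invariance of the form at `(e_z, e_{-z})`. The sign hypothesis excludes symplectic elements that
take `z` to the other sign, for which the product is `-1`. -/
lemma mono_coeff_mul (hX : X.HasForm) {n : Ginf X k} {σ : Equiv.Perm ℤ} {a : ℤ → kˣ}
    (ha : ∀ z, act n (e k z) = a z • e k (σ z)) {z : ℤ} (hz : z ≠ 0)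
    (hs : bilSign k X (σ z) = bilSign k X z) : (a z : k) * a (-z) = 1 := by
  have hn : IsMono n σ := fun z => ⟨a z, ha z⟩
  have h := bil_act n (e k z) (e k (-z))
  have h0 : σ z ≠ 0 := by
    rw [← hn.map_zero hX]
    exact fun h => hz (σ.injective h)
  rw [ha, ha, hn.map_neg hX, Units.smul_def, Units.smul_def, bil_smul_left, bil_smul_right,
    bil_e_e hX hz, bil_e_e hX h0, hs, ← mul_assoc] at h
  exact mul_right_cancel₀ (bilSign k X z).ne_zero (h.trans (one_mul _).symm)

lemma mono_coeff_succ (hX : X.HasForm) {n : Ginf X k} {i : ℕ} {α : ℤ → kˣ}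
    (hα : ∀ z, act n (e k z) = α z • e k (simpleRefl X (i + 1) z)) :
    (↑(α (i + 2))⁻¹ : k) = α (-(i + 2)) ∧ (↑(α (-(i + 1)))⁻¹ : k) = α (i + 1) ∧
    simpleRefl X (i + 1) (i + 1) = i + 2 ∧ simpleRefl X (i + 1) (i + 2) = i + 1 ∧
    simpleRefl X (i + 1) (-(i + 1)) = -(i + 2) ∧ simpleRefl X (i + 1) (-(i + 2)) = -(i + 1) := by
  have he := simpleRefl_succ_values hX i
  have h1 := mono_coeff_mul hX hα (z := i + 1) (by omega)
    (by rw [he.1]; exact bilSign_eq_of_pos _ (by omega) (by omega))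
  have h2 := mono_coeff_mul hX hα (z := i + 2) (by omega)
    (by rw [he.2.1]; exact bilSign_eq_of_pos _ (by omega) (by omega))
  exact ⟨Units.inv_eq_of_mul_eq_one_right h2, Units.inv_eq_of_mul_eq_one_left h1, he⟩

lemma mono_coeff_zero_sq {n : Ginf .SOodd k} {σ : Equiv.Perm ℤ} {a : ℤ → kˣ}
    (ha : ∀ z, act n (e k z) = a z • e k (σ z)) : (a 0 : k) ^ 2 = 1 := by
  have hn : IsMono n σ := fun z => ⟨a z, ha z⟩
  have h : half k (act n (e k 0)) (act n (e k 0)) + (act n (e k 0) 0) ^ 2 =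
      half k (e k 0) (e k 0) + e k 0 0 ^ 2 := isoOf n (e k 0)
  rw [ha, hn.map_zero (by trivial), Units.smul_def, map_smul, map_smul, LinearMap.smul_apply,
    half_e_self, Finsupp.smul_apply, e_apply] at h
  simpa using h

/-- Conjugation by a representative of the reflection maps the simple root subgroup to its
opposite. -/
lemma exists_conj_eq_oppEnd {n : Ginf X k} {i : ℕ} (hn : Represents n i) {a : k} (ha : a ≠ 0) :
    ∃ c : k, c ≠ 0 ∧ (n * rootElt X i a * n⁻¹).1.1 = oppEnd X i c := by
  choose α hα using hn.2
  have hne : ∀ p q, a * ((α p : k) * ↑(α q)⁻¹) ≠ 0 := fun p q =>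
    mul_ne_zero ha (mul_ne_zero (α p).ne_zero (α q)⁻¹.ne_zero)
  have h0 : (n * rootElt X i a * n⁻¹).1.1 = n.1.1 * rootEnd X i a * n⁻¹.1.1 := rfl
  rw [h0]
  match X, i, n, hα with
  | .GL, i, n, hα =>
    refine ⟨_, hne (i + 1) (i + 2), ?_⟩
    simp only [rootEnd, oppEnd, mul_add, add_mul, conj_one, mul_smul_comm, smul_mul_assoc,
      conj_matUnit hα, smul_smul]
    rw [simpleRefl, Equiv.swap_apply_left, Equiv.swap_apply_right]
  | .SL, i, n, hα =>
    refine ⟨_, hne (i + 1) (i + 2), ?_⟩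
    simp only [rootEnd, oppEnd, mul_add, add_mul, conj_one, mul_smul_comm, smul_mul_assoc,
      conj_matUnit hα, smul_smul]
    rw [simpleRefl, Equiv.swap_apply_left, Equiv.swap_apply_right]
  | .Sp, 0, n, hα =>
    refine ⟨_, hne (-1) 1, ?_⟩
    simp only [rootEnd, oppEnd, mul_add, add_mul, conj_one, mul_smul_comm, smul_mul_assoc,
      conj_matUnit hα, smul_smul]
    rw [simpleRefl, Equiv.swap_apply_left, Equiv.swap_apply_right]
  | .SOodd, 0, n, hα =>
    refine ⟨_, hne 0 1, ?_⟩
    have h1 : (α 1 : k) * α (-1) = 1 := mono_coeff_mul (X := .SOodd) trivial hα one_ne_zero rfl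
    have h2 := mono_coeff_zero_sq hα
    have h3 : (↑(α 1)⁻¹ : k) = α (-1) := by
      exact Units.inv_eq_of_mul_eq_one_right h1
    have h4 : (↑(α 0)⁻¹ : k) = α 0 := by
      exact Units.inv_eq_of_mul_eq_one_right (by rw [← sq]; exact h2)
    simp only [rootEnd, oppEnd, mul_add, add_mul, conj_one, mul_smul_comm, smul_mul_assoc,
      conj_matUnit hα, smul_smul]
    have e1 : simpleRefl .SOodd 0 1 = -1 := Equiv.swap_apply_left _ _
    have e2 : simpleRefl .SOodd 0 (-1) = 1 := Equiv.swap_apply_right _ _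
    have e3 : simpleRefl .SOodd 0 0 = 0 := Equiv.swap_apply_of_ne_of_ne (by omega) (by omega)
    rw [e1, e2, e3, h3, h4]
    congr 2
    · congr 1
      ring
    -- The coefficients quadratic in `a` agree because the scalar of `n` at `e_0` squares to one.
    · linear_combination (-a ^ 2 * (α (-1) : k) ^ 2) * (-h2)
  | .SOeven, 0, n, hα =>
    refine ⟨_, hne (-2) 1, ?_⟩
    have h1 : (α 1 : k) * α (-1) = 1 := mono_coeff_mul (X := .SOeven) trivial hα one_ne_zero rfl
    have h2 : (α 2 : k) * α (-2) = 1 := mono_coeff_mul (X := .SOeven) trivial hα two_ne_zero rfl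
    have h3 : (↑(α 1)⁻¹ : k) = α (-1) := by
      exact Units.inv_eq_of_mul_eq_one_right h1
    have h4 : (↑(α 2)⁻¹ : k) = α (-2) := by
      exact Units.inv_eq_of_mul_eq_one_right h2
    simp only [rootEnd, oppEnd, mul_add, add_mul, conj_one, mul_smul_comm, smul_mul_assoc,
      conj_matUnit hα, smul_smul]
    have e1 : simpleRefl .SOeven 0 1 = -2 := by
      simp [simpleRefl, Equiv.swap_apply_def]
    have e2 : simpleRefl .SOeven 0 (-1) = 2 := by
      simp [simpleRefl, Equiv.swap_apply_def]
    have e3 : simpleRefl .SOeven 0 2 = -1 := by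
      simp [simpleRefl, Equiv.swap_apply_def]
    have e4 : simpleRefl .SOeven 0 (-2) = 1 := by
      simp [simpleRefl, Equiv.swap_apply_def]
    rw [e1, e2, e3, e4, h3, h4]
    congr 2
    ring
  | .SOeven, i + 1, n, hα | .SOodd, i + 1, n, hα | .Sp, i + 1, n, hα =>
    refine ⟨_, hne (i + 1) (i + 2), ?_⟩
    obtain ⟨h3, h4, e1, e2, e3, e4⟩ := mono_coeff_succ (by trivial) hα
    simp only [rootEnd, oppEnd, mul_add, add_mul, conj_one, mul_smul_comm, smul_mul_assoc,
      conj_matUnit hα, smul_smul]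
    rw [e1, e2, e3, e4, h3, h4]
    congr 2
    ring

/-- The rank one relation. -/
lemma exists_rank_one {n : Ginf X k} {i : ℕ} (hn : Represents n i) {w : Ginf X k}
    (hw : w ∈ Usub n) (hw1 : w ≠ 1) : ∃ x ∈ Usub n, ∃ t ∈ T X k, ∃ y ∈ Usub n,
      n * w * n⁻¹ = x * n * t * y := by
  obtain ⟨a, rfl⟩ := (mem_Usub_iff hn).1 hw
  have ha : a ≠ 0 := by
    rintro rfl
    exact hw1 (rootElt_zero X i)
  obtain ⟨c, hc, hL⟩ := exists_conj_eq_oppEnd hn ha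
  obtain ⟨b, hb⟩ := exists_rootEnd_oppEnd X i hc
  -- The conjugate `n w n⁻¹` is an opposite root element, so multiplying it by a suitable `rootElt X
  -- i b` on both sides gives a second representative of the reflection. It differs from `n` by an
  -- element of `T`, and moving the root elements across gives `x = y = rootElt X i (-b)`.
  have hm : IsMono (rootElt X i b * (n * rootElt X i a * n⁻¹) * rootElt X i b)
      (simpleRefl X i) := by
    intro z
    obtain ⟨d, hd⟩ := hb z
    refine ⟨d, ?_⟩
    rw [← hd, act_mul, act_mul, act_rootElt, act_rootElt, act, hL]
  have ht := hn.isMono.inv.mul hm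
  rw [inv_mul_cancel] at ht
  refine ⟨rootElt X i (-b), rootElt_mem_Usub hn _, _, ht, rootElt X i (-b),
    rootElt_mem_Usub hn _, ?_⟩
  rw [← rootElt_inv]
  group

lemma existsUnique_rank_one {n : Ginf X k} {i : ℕ} (hn : Represents n i) {w : Ginf X k}
    (hw : w ∈ Usub n) (hw1 : w ≠ 1) : ∃! x, x ∈ Usub n ∧ ∃ t ∈ T X k, ∃ y ∈ Usub n,
      n * w * n⁻¹ = x * n * t * y := by
  obtain ⟨x, hx, t, ht, y, hy, h⟩ := exists_rank_one hn hw hw1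
  refine ⟨x, ⟨hx, t, ht, y, hy, h⟩, ?_⟩
  rintro x' ⟨hx', t', ht', y', hy', h'⟩
  exact eq_of_mul_eq_mul hn hx' hx ht' ht hy' hy (h'.symm.trans h)

end RankOne

/-! ### Generation by `T`, `U` and representatives of the simple reflections -/

section Flag

variable {X : Family}

/-- `g` stabilizes the span of the `e_z`, `z ≤ l`. -/
def Fixes (g : Ginf X k) (l : ℤ) : Prop :=
  ∀ x, act g x ∈ spanOf k (Set.Iic l) ↔ x ∈ spanOf k (Set.Iic l)

lemma mem_Iic_iff {x : V k} {l : ℤ} : x ∈ spanOf k (Set.Iic l) ↔ ∀ z, l < z → x z = 0 := by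
  rw [mem_spanOf]
  simp only [Set.mem_Iic, not_le]

lemma mem_Iic_sub_one_iff {x : V k} {l : ℤ} :
    x ∈ spanOf k (Set.Iic (l - 1)) ↔ x ∈ spanOf k (Set.Iic l) ∧ x l = 0 := by
  rw [mem_Iic_iff, mem_Iic_iff]
  constructor
  · exact fun h => ⟨fun z hz => h z (by omega), h l (by omega)⟩
  · rintro ⟨h1, h2⟩ z hz
    rcases eq_or_ne z l with rfl | h
    · exact h2
    · exact h1 z (by omega)

lemma Fixes.mul {g h : Ginf X k} {l : ℤ} (hg : Fixes g l) (hh : Fixes h l) : Fixes (g * h) l :=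
  fun x => by rw [act_mul, hg, hh]

lemma mem_B_of_forall_fixes {g : Ginf X k} (h : ∀ l, Fixes g l) : g ∈ B X k := by
  rw [mem_B_iff]
  intro i j hij
  exact mem_Iic_iff.1 ((h j _).2 (e_mem_spanOf (Set.mem_Iic.2 le_rfl))) i hij

lemma fixes_of_mem_B {b : Ginf X k} (hb : b ∈ B X k) (l : ℤ) : Fixes b l :=
  fun x => act_mem_spanOf_iff b id Function.injective_id ((mem_B_iff b).1 hb)
    (coef_diag_ne_zero_of_triangular b ((mem_B_iff b).1 hb)) _
    (fun _ _ h h' => le_trans h h') x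

lemma IsMono.exists_act_apply {n : Ginf X k} {σ : Equiv.Perm ℤ} (hn : IsMono n σ) :
    ∃ a : ℤ → kˣ, ∀ (x : V k) (i : ℤ), act n x (σ i) = a i * x i := by
  choose a ha using hn
  refine ⟨a, fun x i => ?_⟩
  rw [act_apply_eq_sum, Finset.sum_eq_single i]
  · rw [coef, ha, Finsupp.smul_apply, e_apply, if_pos rfl, Units.smul_def, smul_eq_mul,
      mul_one, mul_comm]
  · intro b _ hb
    rw [coef, ha, Finsupp.smul_apply, e_apply, if_neg fun h => hb (σ.injective h), smul_zero,
      mul_zero]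
  · intro h
    rw [Finsupp.notMem_support_iff.1 h, zero_mul]

lemma IsMono.mem_Iic_iff {n : Ginf X k} {σ : Equiv.Perm ℤ} (hn : IsMono n σ) (x : V k) (l : ℤ) :
    act n x ∈ spanOf k (Set.Iic l) ↔ ∀ z, l < σ z → x z = 0 := by
  obtain ⟨a, h2⟩ := hn.exists_act_apply
  rw [FinitaryClassical.mem_Iic_iff, ← σ.forall_congr_right]
  simp [h2]

lemma IsMono.fixes {n : Ginf X k} {σ : Equiv.Perm ℤ} (hn : IsMono n σ) {l : ℤ}
    (h : ∀ z, l < σ z ↔ l < z) : Fixes n l := by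
  intro x
  rw [hn.mem_Iic_iff, FinitaryClassical.mem_Iic_iff]
  simp only [h]

lemma mem_Iic_of_coef {g : Ginf X k} {l : ℤ} (h : ∀ i j, j ≤ l → l < i → coef g i j = 0)
    {x : V k} (hx : x ∈ spanOf k (Set.Iic l)) : act g x ∈ spanOf k (Set.Iic l) := by
  rw [mem_Iic_iff] at *
  intro i hi
  rw [act_apply_eq_sum]
  refine Finset.sum_eq_zero fun j _ => ?_
  rcases le_or_gt j l with hj | hj
  · rw [h i j hj hi, mul_zero]
  · rw [hx j hj, zero_mul]

lemma fixes_of_level {g : Ginf X k} {n : ℕ} (hg : g.1 ∈ level X k n) {l : ℤ}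
    (hl : (∀ z ∈ box X n, z ≤ l) ∨ ∀ z ∈ box X n, l < z) : Fixes g l := by
  have key : ∀ g : Ginf X k, g.1 ∈ level X k n → ∀ x, x ∈ spanOf k (Set.Iic l) →
      act g x ∈ spanOf k (Set.Iic l) := by
    intro g hg x hx
    obtain ⟨h1, h2, -, -⟩ := (mem_level_iff _ _ _).1 hg
    refine mem_Iic_of_coef (fun i j hj hi => ?_) hx
    by_cases hjb : j ∈ box X n
    · rcases hl with hl | hl
      · exact mem_spanOf.1 (h2 j hjb) i fun hib => absurd (hl i hib) (not_le.2 hi)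
      · exact absurd (hl j hjb) (not_lt.2 hj)
    · rw [coef, h1 j hjb, e_apply, if_neg (by omega)]
  intro x
  refine ⟨fun hx => ?_, key g hg x⟩
  have := key g⁻¹ (inv_mem hg) _ hx
  rwa [act_inv_act] at this

/-- The coefficient of `act g (e k l)` at `l` cannot vanish: otherwise `g` would map `e_l` into the
smaller space, whose preimage is itself. So `g` acts invertibly on the one-dimensional quotient. -/
lemma Fixes.succ {g : Ginf X k} {l : ℤ} (h : Fixes g (l - 1))
    (hl : act g (e k l) ∈ spanOf k (Set.Iic l)) : Fixes g l := by
  have hc : act g (e k l) l ≠ 0 := by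
    intro h0
    have h1 := (h _).1 (mem_Iic_sub_one_iff.2 ⟨hl, h0⟩)
    have h2 := mem_Iic_iff.1 h1 l (by omega)
    rw [e_apply, if_pos rfl] at h2
    exact one_ne_zero h2
  have hsub : ∀ x : V k, ∀ c : k, x - c • e k l ∈ spanOf k (Set.Iic (l - 1)) →
      x ∈ spanOf k (Set.Iic l) := by
    intro x c hx
    rw [← sub_add_cancel x (c • e k l)]
    exact add_mem (mem_Iic_sub_one_iff.1 hx).1
      (Submodule.smul_mem _ _ (e_mem_spanOf (Set.mem_Iic.2 le_rfl)))
  intro x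
  constructor
  · intro hx
    apply hsub x (act g x l / act g (e k l) l)
    rw [← h, map_sub, map_smul, mem_Iic_sub_one_iff]
    refine ⟨sub_mem hx (Submodule.smul_mem _ _ hl), ?_⟩
    rw [Finsupp.sub_apply, Finsupp.smul_apply, smul_eq_mul, div_mul_cancel₀ _ hc, sub_self]
  · intro hx
    have h1 : x - x l • e k l ∈ spanOf k (Set.Iic (l - 1)) := by
      rw [mem_Iic_sub_one_iff]
      refine ⟨sub_mem hx (Submodule.smul_mem _ _ (e_mem_spanOf (Set.mem_Iic.2 le_rfl))), ?_⟩
      rw [Finsupp.sub_apply, Finsupp.smul_apply, e_apply, if_pos rfl, smul_eq_mul, mul_one,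
        sub_self]
    have h2 := (mem_Iic_sub_one_iff.1 ((h _).2 h1)).1
    rw [map_sub, map_smul] at h2
    have h3 := add_mem h2 (Submodule.smul_mem _ (x l) hl)
    rwa [sub_add_cancel] at h3

/-- For `SO_{2n+1}` in characteristic two the form is degenerate, but `e_0`, which lies in the
radical, belongs to the space on the left because `0 < m`. -/
lemma mem_Iic_iff_bil (hX : X.HasForm) {m : ℤ} (hm : 0 < m) (x : V k) :
    x ∈ spanOf k (Set.Iic (m - 1)) ↔ ∀ y ∈ spanOf k (Set.Iic (-m)), bil X x y = 0 := by
  constructor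
  · intro hx y hy
    refine bil_eq_zero fun z => ?_
    rcases lt_or_ge z m with h | h
    · rw [mem_Iic_iff.1 hy (-z) (by omega), mul_zero]
    · rw [mem_Iic_iff.1 hx z (by omega), zero_mul]
  · intro h
    rw [mem_Iic_iff]
    intro z hz
    have h1 := h (e k (-z)) (e_mem_spanOf (by rw [Set.mem_Iic]; omega))
    rw [bil_e_right hX (by omega)] at h1
    exact (mul_eq_zero.1 h1).resolve_left (bilSign k X z).ne_zero

/-- An isometry that stabilizes a subspace stabilizes its orthogonal space. -/
lemma Fixes.dual (hX : X.HasForm) {g : Ginf X k} {m : ℤ} (hm : 0 < m) (h : Fixes g (-m)) :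
    Fixes g (m - 1) := by
  intro x
  rw [mem_Iic_iff_bil hX hm, mem_Iic_iff_bil hX hm]
  constructor
  · intro hx y hy
    rw [← bil_act g]
    exact hx _ ((h y).2 hy)
  · intro hx y hy
    rw [← act_act_inv g y, bil_act]
    refine hx _ ?_
    rw [← h, act_act_inv]
    exact hy

end Flag

/-! ### Elimination for the linear families -/

section Generation

variable {X : Family}

/-- The subgroup generated by `T`, `U` and the elements `n_i`. -/
def gen (n : ℕ → Ginf X k) : Subgroup (Ginf X k) :=
  Subgroup.closure (T X k ∪ U X k ∪ Set.range n)

lemma T_le_gen (n : ℕ → Ginf X k) : T X k ≤ gen n := fun _ h =>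
  Subgroup.subset_closure (Or.inl (Or.inl h))

lemma U_le_gen (n : ℕ → Ginf X k) : U X k ≤ gen n := fun _ h =>
  Subgroup.subset_closure (Or.inl (Or.inr h))

lemma mem_gen (n : ℕ → Ginf X k) (i : ℕ) : n i ∈ gen n :=
  Subgroup.subset_closure (Or.inr ⟨i, rfl⟩)

lemma B_le_gen (n : ℕ → Ginf X k) : B X k ≤ gen n := by
  intro b hb
  obtain ⟨t, ht, w, hw, rfl⟩ := exists_eq_mul_of_mem_B hb
  exact mul_mem (T_le_gen n ht) (U_le_gen n hw)

/-- One reduction step: multiplication by an element of the `i`-th rank one group. -/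
lemma exists_reduce {n : ℕ → Ginf X k} (hn : ∀ i, Represents (n i) i) (i : ℕ) (a : k)
    (x : V k) (l : ℤ) (h : ∀ z, l < z → rootEnd X i a x (simpleRefl X i z) = 0) :
    ∃ p ∈ gen n, (∀ l, (∀ z, l < simpleRefl X i z ↔ l < z) → Fixes p l) ∧
      act p x ∈ spanOf k (Set.Iic l) := by
  refine ⟨n i * rootElt X i a, mul_mem (mem_gen n i) (U_le_gen n (rootElt_mem_U X i a)),
    fun l hl => (hn i).isMono.fixes hl |>.mul (fixes_of_mem_B (U_le_B (rootElt_mem_U X i a)) l), ?_⟩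
  rw [act_mul, act_rootElt, (hn i).isMono.mem_Iic_iff]
  intro z hz
  have := h _ hz
  rwa [simpleRefl_simpleRefl] at this

/-- The families `GL` and `SL`. -/
lemma linear_step (hX : ¬ X.HasForm) {n : ℕ → Ginf X k} (hn : ∀ i, Represents (n i) i) (N : ℤ)
    (z : ℤ) (hz : 1 ≤ z) (d : ℕ) : ∀ g : Ginf X k, z + d ≤ N → (∀ l, l < z → Fixes g l) →
    (∀ l, N ≤ l → Fixes g l) → act g (e k z) ∈ spanOf k (Set.Iic (z + d)) →
    ∃ p ∈ gen n, (∀ l, l ≤ z → Fixes (p * g) l) ∧ ∀ l, N ≤ l → Fixes (p * g) l := by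
  induction d with
  | zero =>
    intro g _ h1 h2 h3
    rw [Nat.cast_zero, add_zero] at h3
    refine ⟨1, one_mem _, fun l hl => ?_, fun l hl => by rw [one_mul]; exact h2 l hl⟩
    rw [one_mul]
    rcases hl.lt_or_eq with h | rfl
    · exact h1 l h
    · exact (h1 _ (by omega)).succ h3
  | succ d ih =>
    intro g hN h1 h2 h3
    push_cast at hN h3
    set x := act g (e k z) with hx
    have hred : ∃ p ∈ gen n, ((∀ l, l < z → Fixes p l) ∧ ∀ l, N ≤ l → Fixes p l) ∧
        act p x ∈ spanOf k (Set.Iic (z + d)) := by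
      by_cases h0 : x (z + (d + 1)) = 0
      · refine ⟨1, one_mem _, ⟨fun l _ x => Iff.rfl, fun l _ x => Iff.rfl⟩, ?_⟩
        have := mem_Iic_sub_one_iff.2 ⟨h3, h0⟩
        rwa [show z + (d + 1 : ℤ) - 1 = z + d by omega] at this
      -- The reflection exchanges `i + 1 = z + d` with the top coordinate `i + 2`. The root element
      -- uses the top coordinate to clear the one below it, and `n i` then moves the zero to the
      -- top.
      · obtain ⟨i, hi⟩ : ∃ i : ℕ, (i : ℤ) + 1 = z + d := ⟨(z + d - 1).toNat, by omega⟩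
        have hr : ∀ a, rootEnd X i a = 1 + a • matUnit k (i + 1) (i + 2) := by
          match X, hX with
          | .GL, _ | .SL, _ => exact fun a => rfl
          | .SOeven, h | .SOodd, h | .Sp, h => exact absurd trivial h
        have hs : simpleRefl X i = Equiv.swap ((i : ℤ) + 1) (i + 2) := by
          match X, hX with
          | .GL, _ | .SL, _ => rfl
          | .SOeven, h | .SOodd, h | .Sp, h => exact absurd trivial h
        have h0' : x (i + 2) ≠ 0 := by rwa [show (i : ℤ) + 2 = z + (d + 1) by omega]
        obtain ⟨p, hp, hf, hpx⟩ := exists_reduce hn i (-(x (i + 1)) / x (i + 2)) x (z + d) (by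
          intro w hw
          rw [hr, hs, LinearMap.add_apply, LinearMap.smul_apply, matUnit_apply,
            Module.End.one_apply, Finsupp.add_apply, Finsupp.smul_apply, Finsupp.smul_apply,
            e_apply, Equiv.swap_apply_def, if_neg (by omega)]
          by_cases hwi : w = i + 2
          · rw [if_pos hwi, if_pos rfl, smul_eq_mul, smul_eq_mul, mul_one,
              div_mul_cancel₀ _ h0', add_neg_cancel]
          · rw [if_neg hwi, if_neg (by omega), smul_zero, smul_zero, add_zero]
            exact mem_Iic_iff.1 h3 w (by omega))
        refine ⟨p, hp, ⟨fun l hl => hf l fun w => ?_, fun l hl => hf l fun w => ?_⟩, hpx⟩ <;>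
        · rw [hs, Equiv.swap_apply_def]
          split_ifs <;> omega
    obtain ⟨p, hp, ⟨hf1, hf2⟩, hpx⟩ := hred
    obtain ⟨q, hq, hq1, hq2⟩ := ih (p * g) (by omega) (fun l hl => (hf1 l hl).mul (h1 l hl))
      (fun l hl => (hf2 l hl).mul (h2 l hl)) hpx
    refine ⟨q * p, mul_mem hq hp, fun l hl => ?_, fun l hl => ?_⟩
    · rw [mul_assoc]; exact hq1 l hl
    · rw [mul_assoc]; exact hq2 l hl

/-- Left multiplication by `gen n` makes an element of level `N` stabilize one more step of the flag
at a time; from `N` onwards it stabilizes the flag anyway. The result lies in `B`. -/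
lemma gen_eq_top_of_not_hasForm (hX : ¬ X.HasForm) {n : ℕ → Ginf X k}
    (hn : ∀ i, Represents (n i) i) : gen n = ⊤ := by
  refine (Subgroup.eq_top_iff' _).2 fun g => ?_
  obtain ⟨N, -, hN⟩ := exists_mem_level g 0
  have hc : ∀ z ∈ box X N, 1 ≤ z ∧ z ≤ N := by
    rintro z ⟨h1, -, h3⟩
    match X, hX, h1 with
    | .GL, _, h1 | .SL, _, h1 => exact ⟨h1, h3⟩
    | .SOeven, h, _ | .SOodd, h, _ | .Sp, h, _ => exact absurd trivial h
  have key : ∀ m : ℕ, m ≤ N → ∃ p ∈ gen n, (∀ l, l ≤ (m : ℤ) → Fixes (p * g) l) ∧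
      ∀ l, (N : ℤ) ≤ l → Fixes (p * g) l := by
    intro m
    induction m with
    | zero =>
      intro _
      refine ⟨1, one_mem _, fun l hl => ?_, fun l hl => ?_⟩ <;> rw [one_mul] <;>
        apply fixes_of_level hN
      · exact Or.inr fun z hz => by have := (hc z hz).1; omega
      · exact Or.inl fun z hz => (hc z hz).2.trans hl
    | succ m ih =>
      intro hm
      obtain ⟨p, hp, h1, h2⟩ := ih (by omega)
      obtain ⟨q, hq, h3, h4⟩ := linear_step hX hn N (m + 1) (by omega) (N - (m + 1)) (p * g)
        (by omega) (fun l hl => h1 l (by omega)) h2 (by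
          refine (h2 _ (by omega) _).2 (e_mem_spanOf ?_)
          rw [Set.mem_Iic]
          omega)
      refine ⟨q * p, mul_mem hq hp, fun l hl => ?_, fun l hl => ?_⟩ <;> rw [mul_assoc]
      · exact h3 l (by exact_mod_cast hl)
      · exact h4 l hl
  obtain ⟨p, hp, h1, h2⟩ := key N le_rfl
  have hB : p * g ∈ B X k := mem_B_of_forall_fixes fun l =>
    (le_total l N).elim (h1 l) (h2 l)
  have := mul_mem (inv_mem hp) (B_le_gen n hB)
  rwa [inv_mul_cancel_left] at this

end Generation

/-! ### Elimination for the isometry groups -/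

section FormGeneration

variable {X : Family}

/-- Supplies the additional equation needed when a coordinate crosses from the positive to the
nonpositive side. -/
lemma isotropic_of_act (g : Ginf X k) (m : ℤ) (hm : m ≠ 0) (x : V k) (hx : x = act g (e k m)) :
    (X = .SOeven → half k x x = 0) ∧ (X = .SOodd → half k x x + x 0 ^ 2 = 0) := by
  have h := isoOf g
  constructor
  · rintro rfl
    rw [hx, h, half_e_self]
  · rintro rfl
    rw [hx, h, half_e_self, e_apply, if_neg hm]
    ring

lemma rootEnd_succ (hX : X.HasForm) (i : ℕ) (a : k) : rootEnd X (i + 1) a =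
    1 + a • matUnit k (i + 1) (i + 2) + (-a) • matUnit k (-(i + 2)) (-(i + 1)) := by
  match X, hX with
  | .SOeven, _ | .SOodd, _ | .Sp, _ => rfl

lemma simpleRefl_succ_apply (hX : X.HasForm) (i : ℕ) (z : ℤ) : simpleRefl X (i + 1) z =
    if z = i + 1 then (i : ℤ) + 2 else if z = i + 2 then (i : ℤ) + 1 else
    if z = -((i : ℤ) + 1) then -((i : ℤ) + 2) else
    if z = -((i : ℤ) + 2) then -((i : ℤ) + 1) else z := by
  rw [simpleRefl_succ hX, Equiv.Perm.mul_apply, Equiv.swap_apply_def, Equiv.swap_apply_def]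
  split_ifs <;> omega

/-- On a vector without positive coordinates the quadratic form of `SO_{2n+1}` is `x_0²`, so no
reflection is needed to remove the coordinate `0`. In the other families this coordinate never
occurs. -/
lemma act_zero_apply_eq_zero (hX : X.HasForm) {g : Ginf X k} {m : ℤ} (hm : m ≠ 0)
    (h : act g (e k m) ∈ spanOf k (Set.Iic 0)) : act g (e k m) 0 = 0 := by
  rw [mem_Iic_iff] at h
  have hz : ∀ X : Family, (∀ z, z ∈ coords X ↔ z ≠ 0) → ∀ g : Ginf X k,
      act g (e k m) 0 = 0 := by
    intro X hX g
    have := coef_of_notMem_left g (i := 0) (by rw [hX]; exact fun h => h rfl) m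
    rw [coef] at this
    rw [this, e_apply, if_neg hm]
  match X, hX with
  | .SOeven, _ => exact hz .SOeven (fun z => Iff.rfl) g
  | .Sp, _ => exact hz .Sp (fun z => Iff.rfl) g
  | .SOodd, _ =>
    have h1 := (isotropic_of_act g m hm _ rfl).2 rfl
    rw [half_eq_zero fun z hz => by rw [h z hz, zero_mul], zero_add] at h1
    exact pow_eq_zero_iff (two_ne_zero) |>.1 h1

/-- As in the linear case. The hypothesis on `m` keeps the coordinates moved by the reflection at or
above `-m`, so the flag below `-m` is not disturbed. -/
lemma form_reduce_of_two_le (hX : X.HasForm) {n : ℕ → Ginf X k}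
    (hn : ∀ i, Represents (n i) i) {m : ℤ} (i : ℕ) (him : i + 2 ≤ m) (x : V k)
    (hx : x ∈ spanOf k (Set.Iic ((i : ℤ) + 2))) (h0 : x (i + 2) ≠ 0) :
    ∃ p ∈ gen n, (∀ l, l < -m → Fixes p l) ∧ act p x ∈ spanOf k (Set.Iic ((i : ℤ) + 1)) := by
  rw [mem_Iic_iff] at hx
  obtain ⟨p, hp, hf, hpx⟩ := exists_reduce hn (i + 1) (-(x (i + 1)) / x (i + 2)) x (i + 1) (by
    intro w hw
    rw [rootEnd_succ hX, simpleRefl_succ_apply hX, LinearMap.add_apply, LinearMap.add_apply,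
      LinearMap.smul_apply, LinearMap.smul_apply, matUnit_apply, matUnit_apply,
      Module.End.one_apply, Finsupp.add_apply, Finsupp.add_apply, Finsupp.smul_apply,
      Finsupp.smul_apply, Finsupp.smul_apply, Finsupp.smul_apply, e_apply, e_apply,
      if_neg (by omega)]
    simp only [smul_eq_mul]
    by_cases hwi : w = i + 2
    · rw [if_pos hwi, if_pos rfl, if_neg (by omega), mul_one,
        div_mul_cancel₀ _ h0]
      ring
    · rw [if_neg hwi, if_neg (by omega), if_neg (by omega), if_neg (by omega), if_neg (by omega),
        hx w (by omega)]
      ring)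
  refine ⟨p, hp, fun l hl => hf l fun w => ?_, hpx⟩
  rw [simpleRefl_succ_apply hX]
  split_ifs <;> omega

/-- The same reflections act on the negative coordinates. The positive half of the root element does
nothing here because the vector has no positive coordinates. -/
lemma form_reduce_of_neg (hX : X.HasForm) {n : ℕ → Ginf X k}
    (hn : ∀ i, Represents (n i) i) {m : ℤ} (i : ℕ) (him : i + 2 ≤ m) (x : V k)
    (hx : x ∈ spanOf k (Set.Iic (-((i : ℤ) + 1)))) (h0 : x (-(i + 1)) ≠ 0) :
    ∃ p ∈ gen n, (∀ l, l < -m → Fixes p l) ∧ act p x ∈ spanOf k (Set.Iic (-((i : ℤ) + 2))) := by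
  rw [mem_Iic_iff] at hx
  obtain ⟨p, hp, hf, hpx⟩ := exists_reduce hn (i + 1) (x (-(i + 2)) / x (-(i + 1))) x
      (-(i + 2)) (by
    intro w hw
    rw [rootEnd_succ hX, simpleRefl_succ_apply hX, LinearMap.add_apply, LinearMap.add_apply,
      LinearMap.smul_apply, LinearMap.smul_apply, matUnit_apply, matUnit_apply,
      Module.End.one_apply, Finsupp.add_apply, Finsupp.add_apply, Finsupp.smul_apply,
      Finsupp.smul_apply, Finsupp.smul_apply, Finsupp.smul_apply, e_apply, e_apply]
    simp only [smul_eq_mul]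
    rw [hx (i + 2) (by omega)]
    by_cases hwi : w = -(i + 1)
    · rw [if_neg (show ¬ w = i + 1 by omega), if_neg (show ¬ w = i + 2 by omega), if_pos hwi,
        if_pos rfl, mul_one, neg_mul, div_mul_cancel₀ _ h0]
      ring
    · rw [hx _ (by split_ifs <;> omega), if_neg (show ¬ (-(i + 2) : ℤ) = _ by
        split_ifs <;> omega)]
      ring)
  refine ⟨p, hp, fun l hl => hf l fun w => ?_, hpx⟩
  rw [simpleRefl_succ_apply hX]
  split_ifs <;> omega

/-- The reflection `s_0` takes the top coordinate `1` to the negative side. In the symplectic case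
the root element alone clears the coordinate brought to `1`; in the orthogonal cases singularity of
the vector is needed too. -/
lemma form_reduce_of_one (hX : X.HasForm) {n : ℕ → Ginf X k}
    (hn : ∀ i, Represents (n i) i) {m : ℤ} (hm : 1 ≤ m) (hm2 : X = .SOeven → 2 ≤ m) (x : V k)
    (hq : (X = .SOeven → half k x x = 0) ∧ (X = .SOodd → half k x x + x 0 ^ 2 = 0))
    (hx : x ∈ spanOf k (Set.Iic 1)) (h0 : x 1 ≠ 0) :
    ∃ p ∈ gen n, (∀ l, l < -m → Fixes p l) ∧ act p x ∈ spanOf k (Set.Iic 0) := by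
  rw [mem_Iic_iff] at hx
  have hh : half k x x = x 1 * x (-1) := half_eq_single one_pos fun z hz hz1 => by
    rw [hx z (by omega), zero_mul]
  match X, hX with
  | .Sp, _ =>
    obtain ⟨p, hp, hf, hpx⟩ := exists_reduce hn 0 (-x (-1) / x 1) x 0 (by
      intro w hw
      rw [rootEnd, simpleRefl, LinearMap.add_apply, LinearMap.smul_apply, matUnit_apply,
        Module.End.one_apply, Finsupp.add_apply, Finsupp.smul_apply, Finsupp.smul_apply,
        e_apply, Equiv.swap_apply_def]
      simp only [smul_eq_mul]
      by_cases hw1 : w = 1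
      · rw [if_pos hw1, if_pos rfl, mul_one, div_mul_cancel₀ _ h0]
        ring
      · rw [if_neg hw1, if_neg (by omega), if_neg (by omega), hx w (by omega)]
        ring)
    refine ⟨p, hp, fun l hl => hf l fun w => ?_, hpx⟩
    rw [simpleRefl, Equiv.swap_apply_def]
    split_ifs <;> omega
  | .SOodd, _ =>
    -- The parameter clears the coordinate `0`; that the coordinate `-1` disappears as well is
    -- exactly this equation.
    have hq2 : x 1 * x (-1) + x 0 ^ 2 = 0 := by rw [← hh]; exact hq.2 rfl
    obtain ⟨p, hp, hf, hpx⟩ := exists_reduce hn 0 (-x 0 / x 1) x 0 (by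
      intro w hw
      rw [rootEnd, simpleRefl, LinearMap.add_apply, LinearMap.add_apply, LinearMap.add_apply,
        LinearMap.smul_apply, LinearMap.smul_apply, LinearMap.smul_apply, matUnit_apply,
        matUnit_apply, matUnit_apply,
        Module.End.one_apply, Finsupp.add_apply, Finsupp.add_apply, Finsupp.add_apply,
        Finsupp.smul_apply, Finsupp.smul_apply, Finsupp.smul_apply, Finsupp.smul_apply,
        Finsupp.smul_apply, Finsupp.smul_apply, e_apply, e_apply, Equiv.swap_apply_def]
      simp only [smul_eq_mul]
      by_cases hw1 : w = 1
      · rw [if_pos hw1, if_pos rfl, if_neg (by omega)]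
        field_simp
        linear_combination hq2
      · rw [if_neg hw1, if_neg (by omega), if_neg (by omega), if_neg (by omega), hx w (by omega)]
        ring)
    refine ⟨p, hp, fun l hl => hf l fun w => ?_, hpx⟩
    rw [simpleRefl, Equiv.swap_apply_def]
    split_ifs <;> omega
  | .SOeven, _ =>
    have hm2 := hm2 rfl
    -- The reflection brings the coordinates `-2` and `-1` to `1` and `2`. The root element clears
    -- the former, singularity the latter.
    have hq1 : x (-1) = 0 := by
      have := hq.1 rfl
      rw [hh] at this
      exact (mul_eq_zero.1 this).resolve_left h0
    have hx2 := hx 2 (by omega)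
    obtain ⟨p, hp, hf, hpx⟩ := exists_reduce hn 0 (-x (-2) / x 1) x 0 (by
      intro w hw
      rw [rootEnd, simpleRefl, LinearMap.add_apply, LinearMap.add_apply,
        LinearMap.smul_apply, LinearMap.smul_apply, matUnit_apply, matUnit_apply,
        Module.End.one_apply, Finsupp.add_apply, Finsupp.add_apply,
        Finsupp.smul_apply, Finsupp.smul_apply, Finsupp.smul_apply, Finsupp.smul_apply,
        e_apply, e_apply, hx2]
      simp only [smul_eq_mul]
      by_cases hw1 : w = 1
      · subst hw1
        rw [show (Equiv.swap (1 : ℤ) (-2) * Equiv.swap (2 : ℤ) (-1) : Equiv.Perm ℤ) 1 = -2 by decide, if_pos rfl,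
          mul_one, div_mul_cancel₀ _ h0]
        ring
      by_cases hw2 : w = 2
      · subst hw2
        rw [show (Equiv.swap (1 : ℤ) (-2) * Equiv.swap (2 : ℤ) (-1) : Equiv.Perm ℤ) 2 = -1 by decide, hq1,
          if_neg (by omega)]
        ring
      · rw [Equiv.Perm.mul_apply, Equiv.swap_apply_of_ne_of_ne hw2 (by omega),
          Equiv.swap_apply_of_ne_of_ne hw1 (by omega), hx w (by omega), if_neg (by omega)]
        ring)
    refine ⟨p, hp, fun l hl => hf l fun w => ?_, hpx⟩
    rw [simpleRefl, Equiv.Perm.mul_apply, Equiv.swap_apply_def, Equiv.swap_apply_def]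
    split_ifs <;> omega

lemma form_reduce (hX : X.HasForm) {n : ℕ → Ginf X k} (hn : ∀ i, Represents (n i) i) {m : ℤ}
    (hm : 1 ≤ m) (hm2 : X = .SOeven → 2 ≤ m) (g : Ginf X k) (t : ℤ) (ht : -m < t) (ht' : t ≤ m)
    (hx : act g (e k (-m)) ∈ spanOf k (Set.Iic t)) :
    ∃ p ∈ gen n, (∀ l, l < -m → Fixes p l) ∧
      act (p * g) (e k (-m)) ∈ spanOf k (Set.Iic (t - 1)) := by
  simp only [act_mul]
  by_cases h0 : act g (e k (-m)) t = 0
  · exact ⟨1, one_mem _, fun l _ x => Iff.rfl, mem_Iic_sub_one_iff.2 ⟨hx, h0⟩⟩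
  rcases lt_trichotomy t 0 with h | rfl | h
  · obtain ⟨i, rfl⟩ : ∃ i : ℕ, t = -((i : ℤ) + 1) := ⟨(-t - 1).toNat, by omega⟩
    have := form_reduce_of_neg hX hn (m := m) i (by omega) _ hx h0
    rwa [show -((i : ℤ) + 2) = -((i : ℤ) + 1) - 1 by ring] at this
  · exact absurd (act_zero_apply_eq_zero hX (by omega) hx) h0
  · rcases eq_or_ne t 1 with rfl | h1
    · exact form_reduce_of_one hX hn hm hm2 _ (isotropic_of_act g (-m) (by omega) _ rfl) hx h0
    · obtain ⟨i, rfl⟩ : ∃ i : ℕ, t = (i : ℤ) + 2 := ⟨(t - 2).toNat, by omega⟩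
      have := form_reduce_of_two_le hX hn (m := m) i (by omega) _ hx h0
      rwa [show ((i : ℤ) + 1) = ((i : ℤ) + 2) - 1 by ring] at this

/-- Induction on the distance from `-m` to a bound for the coordinates of `act g (e k (-m))`; each
reduction lowers the bound by one. -/
lemma form_step (hX : X.HasForm) {n : ℕ → Ginf X k} (hn : ∀ i, Represents (n i) i) {m : ℤ}
    (hm : 1 ≤ m) (hm2 : X = .SOeven → 2 ≤ m) (d : ℕ) : ∀ g : Ginf X k, -m + d ≤ m →
    (∀ l, l < -m → Fixes g l) → act g (e k (-m)) ∈ spanOf k (Set.Iic (-m + d)) →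
    ∃ p ∈ gen n, ∀ l, l ≤ -m → Fixes (p * g) l := by
  induction d with
  | zero =>
    intro g _ h1 h2
    rw [Nat.cast_zero, add_zero] at h2
    refine ⟨1, one_mem _, fun l hl => ?_⟩
    rw [one_mul]
    rcases hl.lt_or_eq with h | rfl
    · exact h1 l h
    · exact (h1 _ (by omega)).succ h2
  | succ d ih =>
    intro g hd h1 h2
    push_cast at hd h2
    obtain ⟨p, hp, hf, hpx⟩ := form_reduce hX hn hm hm2 g _ (by omega) hd h2
    rw [show -m + (d + 1 : ℤ) - 1 = -m + d by omega] at hpx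
    obtain ⟨q, hq, hq1⟩ := ih (p * g) (by omega) (fun l hl => (hf l hl).mul (h1 l hl)) hpx
    exact ⟨q * p, mul_mem hq hp, fun l hl => by rw [mul_assoc]; exact hq1 l hl⟩

/-- The diagonal blocks of a block triangular isometry are inverse transposes of each other. -/
lemma det_eq_one_of_toBlocks₂₁_eq_zero {n : ℕ} {P : Matrix (Fin n ⊕ Fin n) (Fin n ⊕ Fin n) k}
    (h : ∀ x, evenForm k n (P.mulVec x) = evenForm k n x) (h0 : P.toBlocks₂₁ = 0) :
    P.det = 1 := by
  obtain ⟨-, -, hJ⟩ := evenForm_blocks h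
  rw [← Matrix.fromBlocks_toBlocks P, h0] at hJ ⊢
  simp only [Matrix.fromBlocks_transpose, Matrix.fromBlocks_multiply, Matrix.fromBlocks_inj,
    Matrix.mul_zero, Matrix.mul_one, zero_add, add_zero] at hJ
  have h2 := hJ.2.1
  simp only [Matrix.transpose_zero, Matrix.zero_mul, zero_add] at h2
  rw [Matrix.det_fromBlocks_zero₂₁, ← Matrix.det_transpose P.toBlocks₁₁, ← Matrix.det_mul, h2,
    Matrix.det_one]

lemma dickson_eq_zero_of_toBlocks₂₁_eq_zero {n : ℕ}
    {P : Matrix (Fin n ⊕ Fin n) (Fin n ⊕ Fin n) k} (h0 : P.toBlocks₂₁ = 0) : dickson P = 0 := by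
  rw [dickson_eq_trace, h0, Matrix.mul_zero, Matrix.trace_zero]

/-- A proper rotation does not become block triangular when the two rows of one hyperbolic plane
are exchanged. -/
lemma toBlocks₂₁_submatrix_ne_zero {n : ℕ} {P : Matrix (Fin n ⊕ Fin n) (Fin n ⊕ Fin n) k}
    (h : ∀ x, evenForm k n (P.mulVec x) = evenForm k n x) (hdet : P.det = 1)
    (hD : (2 : k) = 0 → dickson P = 0) (a : Fin n) :
    (P.submatrix (Equiv.swap (Sum.inl a) (Sum.inr a)) id).toBlocks₂₁ ≠ 0 := by
  intro h0
  set s : Equiv.Perm (Fin n ⊕ Fin n) := Equiv.swap (Sum.inl a) (Sum.inr a) with hs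
  have hform : ∀ Q : Matrix (Fin n ⊕ Fin n) (Fin n ⊕ Fin n) k,
      (∀ x, evenForm k n (Q.mulVec x) = evenForm k n x) →
      ∀ x, evenForm k n ((Q.submatrix s id).mulVec x) = evenForm k n x := by
    intro Q hQ x
    rw [← hQ x]
    have : (Q.submatrix s id).mulVec x = Q.mulVec x ∘ s := rfl
    rw [this]
    refine Finset.sum_congr rfl fun i _ => ?_
    rw [Function.comp_apply, Function.comp_apply]
    rcases eq_or_ne i a with rfl | hi
    · rw [hs, Equiv.swap_apply_left, Equiv.swap_apply_right, mul_comm]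
    · rw [hs, Equiv.swap_apply_of_ne_of_ne (by simpa using hi) (by simp),
        Equiv.swap_apply_of_ne_of_ne (by simp) (by simpa using hi)]
  -- Block triangularity would give determinant one, but exchanging two rows has changed the sign;
  -- only characteristic two survives.
  have h1 := det_eq_one_of_toBlocks₂₁_eq_zero (hform P h) h0
  rw [Matrix.det_permute, hs, Equiv.Perm.sign_swap (by simp), hdet] at h1
  have h2 : (2 : k) = 0 := by
    have : (-1 : k) = 1 := by simpa using h1
    linear_combination -this
  have h3 := dickson_eq_zero_of_toBlocks₂₁_eq_zero h0
  -- In characteristic two the row exchange is itself an isometry with Dickson invariant one, so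
  -- additivity of the invariant gives the contradiction.
  have h4 : P.submatrix s id = (1 : Matrix _ _ k).submatrix s id * P := by
    ext i j
    simp [Matrix.mul_apply, Matrix.one_apply]
  have hone : ∀ x, evenForm k n ((1 : Matrix (Fin n ⊕ Fin n) (Fin n ⊕ Fin n) k).mulVec x) =
    evenForm k n x := fun x => by rw [Matrix.one_mulVec]
  rw [h4, dickson_mul h2 (hform 1 hone) h, hD h2, add_zero] at h3
  have h5 : dickson ((1 : Matrix (Fin n ⊕ Fin n) (Fin n ⊕ Fin n) k).submatrix s id) = 1 := by
    rw [dickson, Finset.sum_eq_single a, Finset.sum_eq_single a]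
    · rw [Matrix.submatrix_apply, Matrix.submatrix_apply, hs, Equiv.swap_apply_left,
        Equiv.swap_apply_right, id, id, Matrix.one_apply_eq, Matrix.one_apply_eq, mul_one]
    · intro b _ hb
      rw [Matrix.submatrix_apply, hs, Equiv.swap_apply_left]
      simp [hb.symm]
    · simp
    · intro b _ hb
      refine Finset.sum_eq_zero fun j _ => ?_
      simp only [Matrix.submatrix_apply]
      rw [hs, Equiv.swap_apply_of_ne_of_ne (by simpa using hb) (by simp)]
      simp
    · simp
  rw [h5] at h3
  exact one_ne_zero h3

/-- No simple reflection of `SO_{2n}` exchanges just `1` and `-1`, so this step rests on properness.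
The image of `e_{-1}` is singular, hence its coordinates at `1` and `-1` are not both nonzero. If
the one at `1` were nonzero, exchanging the rows `1` and `-1` would make the matrix of `g` block
triangular. -/
lemma fixes_neg_one_SOeven {g : Ginf .SOeven k} (h : ∀ l, l < -1 → Fixes g l) : Fixes g (-1) := by
  have hv : act g (e k (-1)) ∈ spanOf k (Set.Iic 1) := by
    have := Fixes.dual (X := .SOeven) trivial (m := 2) (by norm_num) (h (-2) (by norm_num))
    exact (this _).2 (e_mem_spanOf (by rw [Set.mem_Iic]; omega))
  have hq := (isotropic_of_act g (-1) (by norm_num) _ rfl).1 rfl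
  have hv' := mem_Iic_iff.1 hv
  rw [half_eq_single one_pos fun z hz hz1 => by rw [hv' z (by omega), zero_mul]] at hq
  have h1 : act g (e k (-1)) 1 = 0 := by
    by_contra h1
    have hm1 := (mul_eq_zero.1 hq).resolve_left h1
    obtain ⟨N, hN, hg⟩ := exists_mem_level g 1
    obtain ⟨f1, f2, f3, f4⟩ := (mem_level_iff _ _ _).1 hg
    rw [show box .SOeven N = Set.range (coordD N) from (range_coordD N).symm] at f1 f2
    have hf : ∀ y, evenForm k N ((matOf (coordD N) g.1.1).mulVec y) = evenForm k N y := by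
      rw [← iso_SOeven_embed, embed_matOf _ _ f1 f2]
      exact f3
    refine toBlocks₂₁_submatrix_ne_zero hf f4.1 f4.2 ⟨0, hN⟩ ?_
    refine Matrix.ext fun i j => ?_
    rw [Matrix.toBlocks₂₁, Matrix.of_apply, Matrix.submatrix_apply, id, matOf_apply, coordD_inl,
      Matrix.zero_apply]
    have hrow : coordD N (Equiv.swap (Sum.inl ⟨0, hN⟩) (Sum.inr ⟨0, hN⟩) (Sum.inr i)) =
        if i = ⟨0, hN⟩ then -1 else (i : ℤ) + 1 := by
      rw [Equiv.swap_apply_def, if_neg (by simp)]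
      simp only [Sum.inr.injEq]
      split_ifs with h0
      · rfl
      · rfl
    rw [hrow]
    have hi0 : i ≠ ⟨0, hN⟩ → 1 ≤ (i : ℕ) := fun h => by
      rw [Ne, Fin.ext_iff] at h
      exact Nat.one_le_iff_ne_zero.2 h
    rcases Nat.eq_zero_or_pos (j : ℕ) with hj | hj
    · rw [hj, Nat.cast_zero, zero_add]
      split_ifs with h0
      · exact hm1
      · have := hi0 h0
        exact hv' _ (by omega)
    · have := (h (-((j : ℤ) + 1)) (by omega) _).2 (e_mem_spanOf (Set.mem_Iic.2 le_rfl))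
      refine mem_Iic_iff.1 this _ ?_
      split_ifs <;> omega
  refine (h _ (by norm_num : (-1 : ℤ) - 1 < -1)).succ ?_
  have h0 := mem_Iic_sub_one_iff.2 ⟨hv, h1⟩
  rw [sub_self] at h0
  exact mem_Iic_sub_one_iff.2 ⟨h0, act_zero_apply_eq_zero (X := .SOeven) trivial (by norm_num) h0⟩

/-- Only the spaces spanned up to negative coordinates are treated by elimination; the others are
their orthogonal spaces. For `SO_{2n}` elimination stops before `-1`, because `s_0` involves the
coordinates `±2`. -/
lemma gen_eq_top_of_hasForm (hX : X.HasForm) {n : ℕ → Ginf X k}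
    (hn : ∀ i, Represents (n i) i) : gen n = ⊤ := by
  refine (Subgroup.eq_top_iff' _).2 fun g => ?_
  obtain ⟨N, hN2, hN⟩ := exists_mem_level g 2
  have key : ∀ d : ℕ, d ≤ N → (X = .SOeven → d + 1 ≤ N) → ∃ p ∈ gen n,
      ∀ l, l < -(N : ℤ) + d → Fixes (p * g) l := by
    intro d
    induction d with
    | zero =>
      intro _ _
      refine ⟨1, one_mem _, fun l hl => ?_⟩
      rw [one_mul]
      exact fixes_of_level hN (Or.inr fun z hz => by have := hz.2.1; push_cast at hl; omega)
    | succ d ih =>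
      intro hd hd2
      obtain ⟨p, hp, h1⟩ := ih (by omega) (fun h => by have := hd2 h; omega)
      -- Duality turns stability just below `-(N - d)` into stability up to `N - d`, which bounds
      -- the image of the next basis vector from above.
      have h2 : Fixes (p * g) ((N : ℤ) - d) := by
        have := Fixes.dual hX (g := p * g) (m := (N : ℤ) - d + 1) (by omega) (h1 _ (by omega))
        rwa [add_sub_cancel_right] at this
      obtain ⟨q, hq, h3⟩ := form_step hX hn (m := (N : ℤ) - d) (by omega)
        (fun h => by have := hd2 h; omega) (2 * (N - d)) (p * g) (by omega)
        (fun l hl => h1 l (by omega)) (by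
          rw [show -((N : ℤ) - d) + (2 * (N - d) : ℕ) = N - d by omega]
          exact (h2 _).2 (e_mem_spanOf (by rw [Set.mem_Iic]; omega)))
      exact ⟨q * p, mul_mem hq hp, fun l hl => by
        rw [mul_assoc]; exact h3 l (by push_cast at hl; omega)⟩
  have hfin : ∃ p ∈ gen n, ∀ l, l < 0 → Fixes (p * g) l := by
    by_cases hE : X = .SOeven
    · obtain ⟨p, hp, h1⟩ := key (N - 1) (by omega) (fun _ => by omega)
      refine ⟨p, hp, fun l hl => ?_⟩
      have h2 : ∀ l, l < -1 → Fixes (p * g) l := fun l hl => h1 l (by omega)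
      rcases lt_or_ge l (-1) with h | h
      · exact h2 l h
      · obtain rfl : l = -1 := by omega
        subst hE
        exact fixes_neg_one_SOeven h2
    · obtain ⟨p, hp, h1⟩ := key N le_rfl (fun h => absurd h hE)
      exact ⟨p, hp, fun l hl => h1 l (by omega)⟩
  obtain ⟨p, hp, h1⟩ := hfin
  have hB : p * g ∈ B X k := mem_B_of_forall_fixes fun l => by
    rcases lt_or_ge l 0 with h | h
    · exact h1 l h
    · have := Fixes.dual hX (g := p * g) (m := l + 1) (by omega) (h1 _ (by omega))
      rwa [add_sub_cancel_right] at this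
  have := mul_mem (inv_mem hp) (B_le_gen n hB)
  rwa [inv_mul_cancel_left] at this

/-- `G_∞` is generated by `T`, `U` and representatives of the simple reflections. -/
lemma gen_eq_top {n : ℕ → Ginf X k} (hn : ∀ i, Represents (n i) i) : gen n = ⊤ := by
  by_cases hX : X.HasForm
  · exact gen_eq_top_of_hasForm hX hn
  · exact gen_eq_top_of_not_hasForm hX hn

end FormGeneration

/-! ### Signs of finitary permutations and of elements of the Weyl group -/

section FinitarySign

variable {α : Type*} [DecidableEq α]

open Classical in
/-- The sign of a permutation with finite support. -/
def fsign (σ : Equiv.Perm α) : ℤˣ :=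
  if h : ∃ s : Finset α, ∃ τ : Equiv.Perm s, σ = Equiv.Perm.ofSubtype τ then
    Equiv.Perm.sign h.choose_spec.choose else 1

/-- The sign is determined by the moved points, on which the two permutations agree. Hence `fsign`
does not depend on the chosen finite set. -/
lemma sign_eq_of_ofSubtype_eq {s s' : Finset α} {τ : Equiv.Perm s} {τ' : Equiv.Perm s'}
    (h' : Equiv.Perm.ofSubtype τ = Equiv.Perm.ofSubtype τ') :
    Equiv.Perm.sign τ' = Equiv.Perm.sign τ := by
  have h1 : ∀ x : s', ((τ' x : s') : α) = Equiv.Perm.ofSubtype τ x := fun x => by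
    rw [h', Equiv.Perm.ofSubtype_apply_coe]
  have h2 : ∀ x : s, ((τ x : s) : α) = Equiv.Perm.ofSubtype τ' x := fun x => by
    rw [← h', Equiv.Perm.ofSubtype_apply_coe]
  have hm : ∀ x : s', τ' x ≠ x → (x : α) ∈ s := by
    intro x hx
    by_contra hs
    apply hx
    ext
    rw [h1, Equiv.Perm.ofSubtype_apply_of_not_mem _ hs]
  refine Equiv.Perm.sign_bij (fun x hx => ⟨x, hm x hx⟩) ?_ ?_ ?_
  · intro x hx hx'
    ext
    change ((τ' x : s') : α) = _
    rw [h1, ← Equiv.Perm.ofSubtype_apply_coe]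
  · intro x y hx hy hxy
    ext
    simpa using hxy
  · intro y hy
    have hy' : (y : α) ∈ s' := by
      by_contra hs
      apply hy
      ext
      rw [h2, Equiv.Perm.ofSubtype_apply_of_not_mem _ hs]
    refine ⟨⟨y, hy'⟩, fun hh => hy ?_, rfl⟩
    ext
    rw [h2]
    have := congrArg Subtype.val hh
    rwa [← Equiv.Perm.ofSubtype_apply_coe] at this

lemma fsign_ofSubtype (s : Finset α) (τ : Equiv.Perm s) :
    fsign (Equiv.Perm.ofSubtype τ) = Equiv.Perm.sign τ := by
  have h : ∃ s' : Finset α, ∃ τ' : Equiv.Perm s',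
    Equiv.Perm.ofSubtype τ = Equiv.Perm.ofSubtype τ' := ⟨s, τ, rfl⟩
  rw [fsign, dif_pos h]
  exact sign_eq_of_ofSubtype_eq h.choose_spec.choose_spec

lemma exists_eq_ofSubtype {σ : Equiv.Perm α} {s : Finset α} (h : ∀ x, x ∉ s → σ x = x) :
    ∃ τ : Equiv.Perm s, σ = Equiv.Perm.ofSubtype τ := by
  have h1 : ∀ x, σ x ∈ s ↔ x ∈ s := by
    intro x
    by_cases hx : x ∈ s
    · refine ⟨fun _ => hx, fun _ => ?_⟩
      by_contra hs
      exact hs (by rwa [σ.injective (h _ hs)])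
    · rw [h x hx]
  refine ⟨σ.subtypePerm h1, Equiv.ext fun x => ?_⟩
  by_cases hx : x ∈ s
  · exact (Equiv.Perm.ofSubtype_apply_of_mem (σ.subtypePerm h1) hx).symm
  · rw [h x hx, Equiv.Perm.ofSubtype_apply_of_not_mem _ hx]

lemma fsign_mul {σ τ : Equiv.Perm α} {s : Finset α} (hσ : ∀ x, x ∉ s → σ x = x)
    (hτ : ∀ x, x ∉ s → τ x = x) : fsign (σ * τ) = fsign σ * fsign τ := by
  obtain ⟨σ, rfl⟩ := exists_eq_ofSubtype hσ
  obtain ⟨τ, rfl⟩ := exists_eq_ofSubtype hτ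
  rw [← map_mul, fsign_ofSubtype, fsign_ofSubtype, fsign_ofSubtype, map_mul]

lemma fsign_swap {a b : α} (h : a ≠ b) : fsign (Equiv.swap a b) = -1 := by
  have h1 : Equiv.swap a b = Equiv.Perm.ofSubtype (Equiv.swap (⟨a, by simp⟩ : ({a, b} : Finset α))
      ⟨b, by simp⟩) := by
    rw [Equiv.Perm.ofSubtype_swap_eq]
  rw [h1, fsign_ofSubtype, Equiv.Perm.sign_swap (by simpa using h)]

lemma fsign_one : fsign (1 : Equiv.Perm α) = 1 := by
  have h := fsign_ofSubtype (α := α) ∅ 1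
  rwa [map_one, map_one] at h

end FinitarySign

/-- The permutation of the absolute values that is induced by an odd permutation of `ℤ`. -/
def absPerm (σ : Equiv.Perm ℤ) (h : ∀ z, σ (-z) = -σ z) : Equiv.Perm ℕ where
  toFun i := (σ i).natAbs
  invFun i := (σ⁻¹ i).natAbs
  left_inv i := by
    change (σ⁻¹ ((σ i).natAbs : ℕ)).natAbs = i
    rcases Int.natAbs_eq (σ i) with h1 | h1
    · rw [← h1]
      simp
    · have h2 : (((σ i).natAbs : ℕ) : ℤ) = σ (-i) := by rw [h]; omega
      rw [h2]
      simp
  right_inv i := by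
    change (σ ((σ⁻¹ i).natAbs : ℕ)).natAbs = i
    rcases Int.natAbs_eq (σ⁻¹ i) with h1 | h1
    · rw [← h1]
      simp
    · have h2 : (((σ⁻¹ i).natAbs : ℕ) : ℤ) = -σ⁻¹ i := by omega
      rw [h2, h]
      simp

lemma absPerm_mul {σ τ : Equiv.Perm ℤ} (hσ : ∀ z, σ (-z) = -σ z) (hτ : ∀ z, τ (-z) = -τ z)
    (h : ∀ z, (σ * τ) (-z) = -(σ * τ) z) : absPerm (σ * τ) h = absPerm σ hσ * absPerm τ hτ := by
  refine Equiv.ext fun i => ?_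
  change (σ (τ i)).natAbs = (σ ((τ i).natAbs : ℕ)).natAbs
  rcases Int.natAbs_eq (τ i) with h1 | h1
  · rw [← h1]
  · rw [show (((τ i).natAbs : ℕ) : ℤ) = -τ i by omega, hσ, Int.natAbs_neg]

section WeylSign

open Classical in
/-- The parity of the length of an element of the Weyl group. -/
def weylSign (X : Family) (σ : Equiv.Perm ℤ) : ℤˣ :=
  -- For a signed permutation `fsign σ` is the parity of the number of sign changes and the second
  -- factor is the sign of the permutation of absolute values. Their product is `-1` on every simple
  -- reflection, with or without sign changes.
  if h : X.HasForm ∧ ∀ z, σ (-z) = -σ z then fsign σ * fsign (absPerm σ h.2) else fsign σ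

lemma weylSign_mul {X : Family} {σ τ : Equiv.Perm ℤ} {N : ℕ}
    (hσ : ∀ z, (N : ℤ) < |z| → σ z = z) (hτ : ∀ z, (N : ℤ) < |z| → τ z = z)
    (hσ' : X.HasForm → ∀ z, σ (-z) = -σ z) (hτ' : X.HasForm → ∀ z, τ (-z) = -τ z) :
    weylSign X (σ * τ) = weylSign X σ * weylSign X τ := by
  have h1 : fsign (σ * τ) = fsign σ * fsign τ :=
    fsign_mul (s := Finset.Icc (-N : ℤ) N)
      (fun z hz => hσ z (by rw [Finset.mem_Icc, ← abs_le] at hz; omega))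
      (fun z hz => hτ z (by rw [Finset.mem_Icc, ← abs_le] at hz; omega))
  by_cases hX : X.HasForm
  · have h2 : ∀ z, (σ * τ) (-z) = -(σ * τ) z := fun z => by
      rw [Equiv.Perm.mul_apply, hτ' hX, hσ' hX, Equiv.Perm.mul_apply]
    rw [weylSign, weylSign, weylSign, dif_pos ⟨hX, h2⟩, dif_pos ⟨hX, hσ' hX⟩,
      dif_pos ⟨hX, hτ' hX⟩, h1, absPerm_mul (hσ' hX) (hτ' hX),
      fsign_mul (s := Finset.range (N + 1)), mul_mul_mul_comm]
    · intro i hi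
      rw [Finset.mem_range] at hi
      change (σ i).natAbs = i
      rw [hσ i (by rw [Nat.abs_cast]; omega)]
      simp
    · intro i hi
      rw [Finset.mem_range] at hi
      change (τ i).natAbs = i
      rw [hτ i (by rw [Nat.abs_cast]; omega)]
      simp
  · rw [weylSign, weylSign, weylSign, dif_neg (fun h => hX h.1), dif_neg (fun h => hX h.1),
      dif_neg (fun h => hX h.1), h1]

lemma simpleRefl_SOeven_zero_apply (z : ℤ) : simpleRefl .SOeven 0 z =
    if z = 1 then -2 else if z = -2 then 1 else if z = 2 then -1 else if z = -1 then 2 else z := by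
  rw [simpleRefl, Equiv.Perm.mul_apply]
  split_ifs with h1 h2 h3 h4
  · subst h1; decide
  · subst h2; decide
  · subst h3; decide
  · subst h4; decide
  · rw [Equiv.swap_apply_of_ne_of_ne h3 h4, Equiv.swap_apply_of_ne_of_ne h1 h2]

lemma simpleRefl_eq_self (X : Family) (i : ℕ) {z : ℤ} (h : (i : ℤ) + 2 < |z|) :
    simpleRefl X i z = z := by
  rw [lt_abs] at h
  match X, i with
  | .GL, i | .SL, i =>
    rw [simpleRefl, Equiv.swap_apply_def]
    split_ifs <;> omega
  | .Sp, 0 | .SOodd, 0 =>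
    rw [simpleRefl, Equiv.swap_apply_def]
    split_ifs <;> omega
  | .SOeven, 0 =>
    rw [simpleRefl_SOeven_zero_apply]
    split_ifs <;> omega
  | .Sp, i + 1 | .SOodd, i + 1 | .SOeven, i + 1 =>
    rw [simpleRefl_succ_apply (by trivial)]
    split_ifs <;> omega

lemma simpleRefl_neg {X : Family} (hX : X.HasForm) (i : ℕ) (z : ℤ) :
    simpleRefl X i (-z) = -simpleRefl X i z := by
  match X, hX, i with
  | .Sp, _, 0 | .SOodd, _, 0 =>
    rw [simpleRefl, Equiv.swap_apply_def, Equiv.swap_apply_def]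
    split_ifs <;> omega
  | .SOeven, _, 0 =>
    rw [simpleRefl_SOeven_zero_apply, simpleRefl_SOeven_zero_apply]
    split_ifs <;> omega
  | .Sp, _, i + 1 | .SOodd, _, i + 1 | .SOeven, _, i + 1 =>
    rw [simpleRefl_succ_apply (by trivial), simpleRefl_succ_apply (by trivial)]
    split_ifs <;> omega

lemma fsign_swap_mul_swap {a b c d : ℤ} (h : a ≠ b) (h' : c ≠ d) :
    fsign (Equiv.swap a b * Equiv.swap c d) = 1 := by
  rw [fsign_mul (s := {a, b, c, d}), fsign_swap h, fsign_swap h']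
  · rfl
  · intro x hx
    simp only [Finset.mem_insert, Finset.mem_singleton, not_or] at hx
    exact Equiv.swap_apply_of_ne_of_ne hx.1 hx.2.1
  · intro x hx
    simp only [Finset.mem_insert, Finset.mem_singleton, not_or] at hx
    exact Equiv.swap_apply_of_ne_of_ne hx.2.2.1 hx.2.2.2

/-- With a form, exactly one factor is `-1`: the sign on `ℤ` for `s_0` of `Sp_{2n}` and `SO_{2n+1}`,
and the sign on absolute values in all other cases. -/
lemma weylSign_simpleRefl (X : Family) (i : ℕ) : weylSign X (simpleRefl X i) = -1 := by
  have hlin : ∀ X : Family, ¬ X.HasForm → simpleRefl X i = Equiv.swap ((i : ℤ) + 1) (i + 2) →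
      weylSign X (simpleRefl X i) = -1 := by
    intro X hX h
    rw [weylSign, dif_neg fun h => hX h.1, h, fsign_swap (by omega)]
  have hform : ∀ X : Family, X.HasForm → ∀ i (a b : ℤˣ), fsign (simpleRefl X i) = a →
      (∀ h, fsign (absPerm (simpleRefl X i) h) = b) → a * b = -1 →
      weylSign X (simpleRefl X i) = -1 := by
    intro X hX i a b ha hb hab
    rw [weylSign, dif_pos ⟨hX, simpleRefl_neg hX i⟩, ha, hb, hab]
  match X, i with
  | .GL, i => exact hlin .GL id rfl
  | .SL, i => exact hlin .SL id rfl
  | .Sp, 0 | .SOodd, 0 =>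
    refine hform _ (by trivial) 0 (-1) 1 (fsign_swap (by omega)) (fun h => ?_) rfl
    rw [show absPerm _ h = 1 from Equiv.ext fun i => ?_, fsign_one]
    change ((Equiv.swap (1 : ℤ) (-1)) i).natAbs = i
    rw [Equiv.swap_apply_def]
    split_ifs <;> first | contradiction | omega
  | .SOeven, 0 =>
    refine hform _ (by trivial) 0 1 (-1) (fsign_swap_mul_swap (by omega) (by omega))
      (fun h => ?_) rfl
    rw [show absPerm _ h = Equiv.swap 1 2 from Equiv.ext fun i => ?_, fsign_swap (by omega)]
    change (simpleRefl .SOeven 0 i).natAbs = _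
    rw [simpleRefl_SOeven_zero_apply, Equiv.swap_apply_def]
    split_ifs <;> first | contradiction | omega
  | .Sp, i + 1 | .SOodd, i + 1 | .SOeven, i + 1 =>
    refine hform _ (by trivial) (i + 1) 1 (-1)
      (fsign_swap_mul_swap (by omega) (by omega)) (fun h => ?_) rfl
    rw [show absPerm _ h = Equiv.swap (i + 1) (i + 2) from Equiv.ext fun j => ?_,
      fsign_swap (by omega)]
    change (simpleRefl _ (i + 1) j).natAbs = _
    rw [simpleRefl_succ_apply (by trivial), Equiv.swap_apply_def]
    split_ifs <;> omega

lemma IsMono.exists_abs {X : Family} {g : Ginf X k} {σ : Equiv.Perm ℤ} (hg : IsMono g σ) :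
    ∃ N : ℕ, ∀ z, (N : ℤ) < |z| → σ z = z := by
  obtain ⟨N, hN⟩ := hg.exists_forall_eq
  refine ⟨N, fun z hz => hN z fun h => ?_⟩
  have := abs_le.2 h.2
  omega

lemma weylSign_simpleRefl_mul {X : Family} (i : ℕ) {g : Ginf X k} {σ : Equiv.Perm ℤ}
    (hg : IsMono g σ) : weylSign X (simpleRefl X i * σ) = -weylSign X σ := by
  obtain ⟨N, hN⟩ := hg.exists_abs
  rw [weylSign_mul (N := N + (i + 2)), weylSign_simpleRefl, neg_one_mul]
  · exact fun z hz => simpleRefl_eq_self X i (by push_cast at hz; omega)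
  · exact fun z hz => hN z (by push_cast at hz; omega)
  · exact fun hX => simpleRefl_neg hX i
  · exact fun hX => hg.map_neg hX

end WeylSign

/-! ### The alternating function on the big cell -/

section Eta

variable {X : Family} (K : Type v) [Field K]

/-- The action of a group on the functions on it by left translation. -/
def leftReg (H : Type u) [Group H] : Representation K H (H → K) where
  toFun g := LinearMap.funLeft K K fun h => g⁻¹ * h
  map_one' := by
    refine LinearMap.ext fun f => funext fun h => ?_
    simp [LinearMap.funLeft_apply]
  map_mul' g g' := by
    refine LinearMap.ext fun f => funext fun h => ?_
    simp [LinearMap.funLeft_apply, mul_assoc]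

lemma leftReg_apply {H : Type u} [Group H] (g h : H) (f : H → K) :
    leftReg K H g f h = f (g⁻¹ * h) := rfl

variable {K}

open Classical in
/-- The function on `G` with value `φ σ` at `v b`, for `b ∈ B` and `v` monomial with
permutation `σ`, and with value `0` outside of `N B`. -/
def bruhatFun (φ : Equiv.Perm ℤ → K) (h : Ginf X k) : K :=
  if H : ∃ σ v b, IsMono v σ ∧ b ∈ B X k ∧ h = v * b then φ H.choose else 0

/-- The value is well defined: two factorizations differ by a monomial element of `B`, whose
permutation is trivial. -/
lemma bruhatFun_mul (φ : Equiv.Perm ℤ → K) {v b : Ginf X k} {σ : Equiv.Perm ℤ}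
    (hv : IsMono v σ) (hb : b ∈ B X k) : bruhatFun φ (v * b) = φ σ := by
  have H : ∃ σ' v' b', IsMono v' σ' ∧ b' ∈ B X k ∧ v * b = v' * b' := ⟨σ, v, b, hv, hb, rfl⟩
  rw [bruhatFun, dif_pos H]
  obtain ⟨v', b', hv', hb', h⟩ := H.choose_spec
  have h1 : v'⁻¹ * v = b' * b⁻¹ := by
    rw [eq_mul_inv_iff_mul_eq, mul_assoc, h, inv_mul_cancel_left]
  have h2 := (hv'.inv.mul hv).eq_one_of_mem_B (by rw [h1]; exact mul_mem hb' (inv_mem hb))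
  rw [inv_mul_eq_one.1 h2]

lemma bruhatFun_cases (h : Ginf X k) : (∃ σ v b, IsMono v σ ∧ b ∈ B X k ∧ h = v * b) ∨
    ∀ φ : Equiv.Perm ℤ → K, bruhatFun φ h = 0 := by
  by_cases H : ∃ σ v b, IsMono v σ ∧ b ∈ B X k ∧ h = v * b
  · exact Or.inl H
  · exact Or.inr fun φ => by rw [bruhatFun, dif_neg H]

/-- A monomial element permutes the cosets `v B` and preserves the complement of their union. -/
lemma leftReg_bruhatFun (φ φ' : Equiv.Perm ℤ → K) {m : Ginf X k} {τ : Equiv.Perm ℤ}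
    (hm : IsMono m τ) (h : ∀ (v : Ginf X k) (σ : Equiv.Perm ℤ), IsMono v σ →
      φ (τ⁻¹ * σ) = φ' σ) :
    leftReg K (Ginf X k) m (bruhatFun φ) = bruhatFun φ' := by
  refine funext fun x => ?_
  rw [leftReg_apply]
  rcases bruhatFun_cases (K := K) x with ⟨σ, v, b, hv, hb, rfl⟩ | hx
  · rw [← mul_assoc, bruhatFun_mul _ (hm.inv.mul hv) hb, bruhatFun_mul _ hv hb, h v σ hv]
  · rw [hx]
    rcases bruhatFun_cases (K := K) (m⁻¹ * x) with ⟨σ, v, b, hv, hb, hx'⟩ | hx'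
    · have := bruhatFun_mul (fun _ => (1 : K)) (hm.mul hv) hb
      rw [mul_assoc, ← hx', mul_inv_cancel_left, hx] at this
      exact absurd this zero_ne_one
    · exact hx' _

variable (X K) in
/-- The sign of an element of the Weyl group as an element of `K`. -/
def signK (σ : Equiv.Perm ℤ) : K := ((weylSign X σ : ℤ) : K)

variable (X k K) in
/-- The function that is `± 1` on `N B` and `0` elsewhere. -/
def eta : Ginf X k → K := bruhatFun (signK X K)

open Classical in
variable (k K) in
/-- The restriction of `eta` to the cells `v B` for which `s_i v` is longer than `v`. -/
def etaPos (X : Family) (i : ℕ) : Ginf X k → K := bruhatFun fun σ =>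
  if σ⁻¹ (marker X i).1 < σ⁻¹ (marker X i).2 then signK X K σ else 0

lemma signK_simpleRefl_mul (i : ℕ) {g : Ginf X k} {σ : Equiv.Perm ℤ} (hg : IsMono g σ) :
    signK X K (simpleRefl X i * σ) = -signK X K σ := by
  rw [signK, signK, weylSign_simpleRefl_mul i hg]
  simp

lemma signK_ne_zero (σ : Equiv.Perm ℤ) : signK X K σ ≠ 0 := by
  rcases Int.units_eq_one_or (weylSign X σ) with h | h <;> rw [signK, h] <;> simp

lemma leftReg_eta_T {t : Ginf X k} (ht : t ∈ T X k) :
    leftReg K (Ginf X k) t (eta k X K) = eta k X K :=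
  leftReg_bruhatFun _ _ (isMono_one_iff.2 ht) fun v σ _ => by rw [inv_one, one_mul]

lemma leftReg_etaPos_T {t : Ginf X k} (ht : t ∈ T X k) (i : ℕ) :
    leftReg K (Ginf X k) t (etaPos k K X i) = etaPos k K X i :=
  leftReg_bruhatFun _ _ (isMono_one_iff.2 ht) fun v σ _ => by rw [inv_one, one_mul]

lemma leftReg_eta_refl {n : Ginf X k} {i : ℕ} (hn : Represents n i) :
    leftReg K (Ginf X k) n (eta k X K) = -eta k X K := by
  rw [eta, leftReg_bruhatFun _ (fun σ => -signK X K σ) hn.isMono fun v σ hv => by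
    rw [simpleRefl_inv, signK_simpleRefl_mul i hv]]
  refine funext fun x => ?_
  rw [Pi.neg_apply]
  rcases bruhatFun_cases (K := K) x with ⟨σ, v, b, hv, hb, rfl⟩ | hx
  · rw [bruhatFun_mul _ hv hb, bruhatFun_mul _ hv hb]
  · rw [hx, hx, neg_zero]

/-- Exactly one of `v` and `s_i v` is the shorter one. -/
lemma marker_lt_simpleRefl_mul_iff (i : ℕ) {v : Ginf X k} {σ : Equiv.Perm ℤ} (hv : IsMono v σ) :
    (simpleRefl X i * σ)⁻¹ (marker X i).1 < (simpleRefl X i * σ)⁻¹ (marker X i).2 ↔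
      ¬ σ⁻¹ (marker X i).1 < σ⁻¹ (marker X i).2 := by
  have hσ : ∀ {p q}, p ≠ q → σ⁻¹ p ≠ σ⁻¹ q := fun h h' => h (σ⁻¹.injective h')
  rw [mul_inv_rev, simpleRefl_inv, Equiv.Perm.mul_apply, Equiv.Perm.mul_apply]
  have hgen : ∀ {p q : ℤ}, p ≠ q → (σ⁻¹ q < σ⁻¹ p ↔ ¬ σ⁻¹ p < σ⁻¹ q) := fun h => by
    have := hσ h
    omega
  match X, v, hv, i with
  | .GL, _, _, i | .SL, _, _, i =>
    simp only [marker, simpleRefl, Equiv.swap_apply_left, Equiv.swap_apply_right]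
    exact hgen (by omega)
  | .Sp, _, hv, 0 =>
    simp only [marker, simpleRefl, Equiv.swap_apply_left, Equiv.swap_apply_right]
    exact hgen (by omega)
  | .SOodd, v, hv, 0 =>
    -- The reflection does not exchange the marker coordinates `0` and `1`; it sends `1` to `-1`.
    -- Since `σ⁻¹` is odd, the condition only concerns the sign of `σ⁻¹ 1`.
    have h0 : σ⁻¹ 0 = 0 := hv.inv.map_zero (X := .SOodd) trivial
    have h1 : σ⁻¹ (-1) = -σ⁻¹ 1 := hv.inv.map_neg (X := .SOodd) trivial 1
    have h2 := hσ (p := 0) (q := 1) (by omega)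
    simp only [marker, simpleRefl, Equiv.swap_apply_left]
    rw [Equiv.swap_apply_of_ne_of_ne (by omega) (by omega)]
    omega
  | .SOeven, _, hv, 0 =>
    have h1 : simpleRefl .SOeven 0 (-2) = 1 := by decide
    have h2 : simpleRefl .SOeven 0 1 = -2 := by decide
    simp only [marker, h1, h2]
    exact hgen (by omega)
  | .Sp, _, hv, i + 1 | .SOodd, _, hv, i + 1 | .SOeven, _, hv, i + 1 =>
    simp only [marker]
    rw [(simpleRefl_succ_values (by trivial) i).1, (simpleRefl_succ_values (by trivial) i).2.1]
    exact hgen (by omega)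

/-- Left multiplication by `s_i` pairs the cosets kept in `etaPos` with the remaining ones and
changes the sign. -/
lemma eta_eq {n : Ginf X k} {i : ℕ} (hn : Represents n i) :
    eta k X K = etaPos k K X i - leftReg K (Ginf X k) n (etaPos k K X i) := by
  classical
  rw [etaPos, leftReg_bruhatFun _ (fun σ => if σ⁻¹ (marker X i).1 < σ⁻¹ (marker X i).2 then 0
    else -signK X K σ) hn.isMono fun v σ hv => ?_]
  · refine funext fun x => ?_
    rw [Pi.sub_apply]
    rcases bruhatFun_cases (K := K) x with ⟨σ, v, b, hv, hb, rfl⟩ | hx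
    · rw [eta, bruhatFun_mul _ hv hb, bruhatFun_mul _ hv hb, bruhatFun_mul _ hv hb]
      split_ifs <;> simp
    · rw [eta, hx, hx, hx, sub_zero]
  · rw [simpleRefl_inv, signK_simpleRefl_mul i hv]
    simp only [marker_lt_simpleRefl_mul_iff i hv, ite_not]

/-- A cell `v B` in the support of `etaPos` is stable under the simple root subgroup. -/
lemma conj_rootElt_mem_B (i : ℕ) (a : k) {v : Ginf X k} {σ : Equiv.Perm ℤ} (hv : IsMono v σ)
    (h : σ⁻¹ (marker X i).1 < σ⁻¹ (marker X i).2) : v⁻¹ * rootElt X i a * v ∈ B X k := by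
  have hr : ∀ p q, rootSupp X i p q → σ⁻¹ p < σ⁻¹ q := by
    intro p q hpq
    match X, v, hv, i with
    | .GL, _, _, i | .SL, _, _, i =>
      obtain ⟨rfl, rfl⟩ := hpq
      exact h
    | .Sp, _, hv, 0 =>
      obtain ⟨rfl, rfl⟩ := hpq
      exact h
    | .SOodd, v, hv, 0 =>
      have h0 : σ⁻¹ 0 = 0 := hv.inv.map_zero (X := .SOodd) trivial
      have h1 : σ⁻¹ (-1) = -σ⁻¹ 1 := hv.inv.map_neg (X := .SOodd) trivial 1
      simp only [marker] at h
      rcases hpq with ⟨rfl, rfl⟩ | ⟨rfl, rfl⟩ | ⟨rfl, rfl⟩ <;> omega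
    | .SOeven, _, hv, 0 =>
      have h1 := hv.inv.map_neg (X := .SOeven) trivial 1
      have h2 := hv.inv.map_neg (X := .SOeven) trivial 2
      simp only [marker] at h
      rcases hpq with ⟨rfl, rfl⟩ | ⟨rfl, rfl⟩ <;> omega
    | .Sp, _, hv, i + 1 | .SOodd, _, hv, i + 1 | .SOeven, _, hv, i + 1 =>
      have h1 := hv.inv.map_neg (by trivial) (i + 1)
      have h2 := hv.inv.map_neg (by trivial) (i + 2)
      simp only [marker] at h
      rcases hpq with ⟨rfl, rfl⟩ | ⟨rfl, rfl⟩
      · exact h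
      · rw [h1, h2]
        omega
  rw [mem_B_iff]
  intro p q hqp
  obtain ⟨p, rfl⟩ := (σ⁻¹).surjective p
  obtain ⟨q, rfl⟩ := (σ⁻¹).surjective q
  have := hv.inv.conj_coef_eq_zero_iff (rootElt X i a) p q
  rw [inv_inv] at this
  rw [this, coef, act_rootElt, rootEnd_coef_eq, e_apply, if_neg]
  · rintro rfl
    exact lt_irrefl _ hqp
  · exact fun hs => lt_asymm (hr p q hs) hqp

/-- Every coset in the support is fixed by `U_i`, since `v⁻¹ U_i v ⊆ B`. Applying this to `w` and to
`w⁻¹` shows that the complement of the support is preserved too. -/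
lemma leftReg_etaPos_Usub {n : Ginf X k} {i : ℕ} (hn : Represents n i) {w : Ginf X k}
    (hw : w ∈ Usub n) : leftReg K (Ginf X k) w (etaPos k K X i) = etaPos k K X i := by
  classical
  have key : ∀ w ∈ Usub n, ∀ x, etaPos k K X i x ≠ 0 →
      etaPos k K X i (w * x) = etaPos k K X i x := by
    intro w hw x hx
    obtain ⟨a, rfl⟩ := (mem_Usub_iff hn).1 hw
    rcases bruhatFun_cases (K := K) x with ⟨σ, v, b, hv, hb, rfl⟩ | hx'
    · rw [etaPos, bruhatFun_mul _ hv hb] at hx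
      have h1 : σ⁻¹ (marker X i).1 < σ⁻¹ (marker X i).2 := by
        by_contra h1
        exact hx (if_neg h1)
      have h2 : rootElt X i a * (v * b) = v * (v⁻¹ * rootElt X i a * v * b) := by group
      rw [h2, etaPos, bruhatFun_mul _ hv (mul_mem (conj_rootElt_mem_B i a hv h1) hb),
        bruhatFun_mul _ hv hb]
    · exact absurd (hx' _) hx
  refine funext fun x => ?_
  rw [leftReg_apply]
  by_cases h : etaPos k K X i x = 0
  · by_contra h1
    rw [h] at h1
    have := key w hw _ h1
    rw [mul_inv_cancel_left, h] at this
    exact h1 this.symm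
  · exact key _ (inv_mem hw) x h

lemma Represents.sq_mem_T {n : Ginf X k} {i : ℕ} (hn : Represents n i) : n * n ∈ T X k := by
  have := hn.isMono.mul hn.isMono
  rwa [show simpleRefl X i * simpleRefl X i = 1 from Equiv.ext (simpleRefl_simpleRefl X i)] at this

/-- The formula for the action of `n_i` on a nontrivial element of the simple root subgroup. -/
lemma leftReg_eta_Usub {n : Ginf X k} {i : ℕ} (hn : Represents n i) {w x t y : Ginf X k}
    (hw : w ∈ Usub n) (hx : x ∈ Usub n) (ht : t ∈ T X k) (hy : y ∈ Usub n)
    (h : n * w * n⁻¹ = x * n * t * y) :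
    leftReg K (Ginf X k) n (leftReg K (Ginf X k) w (eta k X K)) =
      leftReg K (Ginf X k) x (eta k X K) - eta k X K := by
  set L := leftReg K (Ginf X k) with hL
  set f := etaPos k K X i
  have hU : ∀ z ∈ Usub n, L z f = f := fun z hz => leftReg_etaPos_Usub hn hz
  have hT : ∀ z ∈ T X k, L z f = f := fun z hz => leftReg_etaPos_T hz i
  have hmul : ∀ a b f, L a (L b f) = L (a * b) f := fun a b f => by
    rw [map_mul, Module.End.mul_apply]
  -- The relation gives `n w n = x n t y n²`, and `t`, `y` and `n² ∈ T` all fix `f`.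
  have h1 : L n (L w (L n f)) = L x (L n f) := by
    have h2 : n * (w * n) = x * (n * (t * (y * (n * n)))) := by
      calc n * (w * n) = (n * w * n⁻¹) * (n * n) := by group
        _ = _ := by rw [h]; group
    rw [hmul, hmul, mul_assoc, h2, ← hmul, ← hmul, ← hmul, ← hmul, hT _ hn.sq_mem_T, hU y hy, hT t ht]
  rw [eta_eq hn]
  simp only [map_sub]
  rw [hU w hw, h1, hU x hx]
  abel

end Eta

/-! ### Monomial elements that reverse the order of the coordinates -/

section Reversal

variable {J : Type} [Fintype J] [DecidableEq J]

/-- The monomial matrix with entry `d j` at `(π j, j)`. -/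
def monoMat (π : Equiv.Perm J) (d : J → k) : Matrix J J k :=
  (1 : Matrix J J k).submatrix id π * Matrix.diagonal d

lemma monoMat_apply (π : Equiv.Perm J) (d : J → k) (i j : J) :
    monoMat π d i j = if i = π j then d j else 0 := by
  rw [monoMat, Matrix.mul_diagonal, Matrix.submatrix_apply, id, Matrix.one_apply]
  split_ifs <;> simp

lemma det_monoMat (π : Equiv.Perm J) (d : J → k) :
    (monoMat π d).det = ((Equiv.Perm.sign π : ℤ) : k) * ∏ j, d j := by
  rw [monoMat, Matrix.det_mul, Matrix.det_permute', Matrix.det_one, mul_one, Matrix.det_diagonal]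

lemma monoMat_mulVec (π : Equiv.Perm J) (d : J → k) (x : J → k) (j : J) :
    (monoMat π d).mulVec x (π j) = d j * x j := by
  rw [Matrix.mulVec, dotProduct, Finset.sum_eq_single j]
  · rw [monoMat_apply, if_pos rfl]
  · intro b _ hb
    rw [monoMat_apply, if_neg fun h => hb (π.injective h).symm, zero_mul]
  · simp

lemma embed_monoMat (c : J ↪ ℤ) (π : Equiv.Perm J) (d : J → k) (j : J) :
    embed c (monoMat π d) (e k (c j)) = d j • e k (c (π j)) := by
  rw [embed_apply_mem, Finset.sum_eq_single (π j)]
  · rw [monoMat_apply, if_pos rfl]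
  · intro b _ hb
    rw [monoMat_apply, if_neg hb, zero_smul]
  · simp

lemma exists_isMono_of_monoMat {X : Family} {N : ℕ} (c : J ↪ ℤ) (hc : Set.range c = box X N)
    (π : Equiv.Perm J) (d : J → kˣ) (hI : Iso X (embed c (monoMat π fun j => (d j : k))))
    (hD : DetCond X N (embed c (monoMat π fun j => (d j : k)))) :
    ∃ v : Ginf X k, IsMono v (π.viaEmbedding c) := by
  have hdet : IsUnit (monoMat π fun j => (d j : k)).det := by
    rw [det_monoMat, isUnit_iff_ne_zero]
    refine mul_ne_zero ?_ (Finset.prod_ne_zero_iff.2 fun j _ => (d j).ne_zero)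
    rcases Int.units_eq_one_or (Equiv.Perm.sign π) with h | h <;> rw [h] <;> simp
  let g : GLV k := Units.map (embed (k := k) c) (Matrix.nonsingInvUnit _ hdet)
  have hg : g.1 = embed c (monoMat π fun j => (d j : k)) := rfl
  have hlev : g ∈ level X k N := by
    rw [mem_level_iff, hg, ← hc]
    exact ⟨fun z hz => embed_fix _ _ hz, fun z hz => embed_mem_spanOf _ _ hz, hI, hD⟩
  refine ⟨⟨g, mem_Ginf_iff.2 ⟨N, hlev⟩⟩, fun z => ?_⟩
  by_cases hz : z ∈ Set.range c
  · obtain ⟨j, rfl⟩ := hz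
    refine ⟨d j, ?_⟩
    rw [Equiv.Perm.viaEmbedding_apply, Units.smul_def]
    exact embed_monoMat c π _ j
  · refine ⟨1, ?_⟩
    rw [Equiv.Perm.viaEmbedding_apply_of_notMem _ _ _ hz, one_smul]
    exact embed_fix _ _ hz

/-- The permutation matrix is a product of unipotent block matrices and the block diagonal matrix of
`-1` and `1`. The determinant of the latter is one since the block size is even. -/
lemma sign_sumComm_even (m : ℕ) :
    Equiv.Perm.sign (Equiv.sumComm (Fin (m + m)) (Fin (m + m))) = 1 := by
  have h1 : ((1 : Matrix (Fin (m + m) ⊕ Fin (m + m)) (Fin (m + m) ⊕ Fin (m + m)) ℤ).submatrix id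
      (Equiv.sumComm (Fin (m + m)) (Fin (m + m)))) =
      Matrix.fromBlocks 1 1 0 1 * Matrix.fromBlocks 1 0 (-1) 1 * Matrix.fromBlocks 1 1 0 1 *
        Matrix.fromBlocks (-1) 0 0 1 := by
    rw [Matrix.fromBlocks_multiply, Matrix.fromBlocks_multiply, Matrix.fromBlocks_multiply]
    ext i j
    rcases i with i | i <;> rcases j with j | j <;> simp [Matrix.one_apply]
  have h2 := congrArg Matrix.det h1
  rw [Matrix.det_permute', Matrix.det_mul, Matrix.det_mul, Matrix.det_mul,
    Matrix.det_fromBlocks_zero₂₁, Matrix.det_fromBlocks_zero₂₁, Matrix.det_fromBlocks_zero₁₂,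
    Matrix.det_neg] at h2
  simp only [Matrix.det_one, mul_one, Fintype.card_fin, Even.neg_one_pow ⟨m, rfl⟩] at h2
  exact Units.ext h2

/-- The exchange of opposite coordinates. -/
abbrev swapD (n : ℕ) : Equiv.Perm (Fin n ⊕ Fin n) := Equiv.sumComm _ _

lemma evenForm_monoMat (n : ℕ) (x : Fin n ⊕ Fin n → k) :
    evenForm k n ((monoMat (swapD n) fun _ => ((1 : kˣ) : k)).mulVec x) = evenForm k n x := by
  refine Finset.sum_congr rfl fun i _ => ?_
  have h1 := monoMat_mulVec (swapD n) (fun _ => ((1 : kˣ) : k)) x (Sum.inl i)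
  have h2 := monoMat_mulVec (swapD n) (fun _ => ((1 : kˣ) : k)) x (Sum.inr i)
  simp only [Equiv.sumComm_apply, Sum.swap_inl, Sum.swap_inr, Units.val_one, one_mul] at h1 h2 ⊢
  rw [h1, h2, mul_comm]

/-- Evenness of the rank makes the determinant one and, in characteristic two, kills the Dickson
invariant, which counts the exchanged pairs. -/
lemma exists_reversal_SOeven (m : ℕ) : ∃ v : Ginf .SOeven k,
    IsMono v ((swapD (m + m)).viaEmbedding (coordD (m + m))) := by
  refine exists_isMono_of_monoMat (X := .SOeven) (N := m + m) (coordD (m + m)) (range_coordD _) _ (fun _ => 1) ?_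
    ⟨?_, ?_⟩
  · rw [iso_SOeven_embed]
    exact evenForm_monoMat _
  · rw [matOf_embed, det_monoMat, sign_sumComm_even]
    simp
  · intro h2
    rw [matOf_embed, dickson]
    simp only [monoMat_apply]
    simp only [Equiv.sumComm_apply, Sum.swap_inl, Sum.swap_inr, Sum.inl.injEq, Sum.inr.injEq,
      Units.val_one, mul_ite, mul_one, mul_zero]
    simp only [Finset.sum_ite_eq, Finset.mem_univ, if_true, Finset.sum_const, Finset.card_univ,
      Fintype.card_fin, nsmul_eq_mul, mul_one, Nat.cast_add]
    linear_combination (m : k) * h2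

lemma exists_reversal_SOodd (m : ℕ) : ∃ v : Ginf .SOodd k,
    IsMono v (Equiv.Perm.viaEmbedding (Equiv.Perm.sumCongr (swapD (m + m)) 1)
      (coordB (m + m))) := by
  refine exists_isMono_of_monoMat (N := m + m) (coordB (m + m)) (range_coordB _) _ (fun _ => 1) ?_
    ?_
  · rw [iso_SOodd_embed]
    intro y
    have h : ∀ j, (monoMat (Equiv.Perm.sumCongr (swapD (m + m)) (1 : Equiv.Perm Unit))
        fun _ => ((1 : kˣ) : k)).mulVec y (Equiv.Perm.sumCongr (swapD (m + m)) 1 j) = y j :=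
      fun j => by rw [monoMat_mulVec, Units.val_one, one_mul]
    rw [oddForm, oddForm]
    congr 1
    · refine Finset.sum_congr rfl fun i _ => ?_
      have h1 := h (Sum.inl (Sum.inl i))
      have h2 := h (Sum.inl (Sum.inr i))
      simp only [Equiv.Perm.sumCongr_apply, Sum.map_inl, Equiv.sumComm_apply, Sum.swap_inl,
        Sum.swap_inr] at h1 h2
      rw [h1, h2, mul_comm]
    · exact congrArg (· ^ 2) (h (Sum.inr ()))
  · rw [DetCond, matOf_embed, det_monoMat, Equiv.Perm.sign_sumCongr, sign_sumComm_even]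
    simp

/-- With the sign on the second half, the monomial matrix is the matrix of the symplectic form. -/
lemma exists_reversal_Sp (m : ℕ) : ∃ v : Ginf .Sp k,
    IsMono v ((swapD m).viaEmbedding (coordD m)) := by
  refine exists_isMono_of_monoMat (N := m) (coordD m) (range_coordD _) _
    (Sum.elim (fun _ => 1) fun _ => -1) ?_ trivial
  rw [iso_Sp_embed]
  convert SymplecticGroup.J_mem (l := Fin m) (R := k) using 1
  ext i j
  rw [monoMat_apply, Matrix.J]
  rcases i with i | i <;> rcases j with j | j <;> simp [Matrix.one_apply, neg_ite]

lemma exists_reversal_linear {X : Family} (hX : X = .GL ∨ X = .SL) (m : ℕ) : ∃ v : Ginf X k,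
    IsMono v (Fin.revPerm.viaEmbedding (coordA (m + 1))) := by
  -- A single entry carries the sign of the reversal, so that the determinant is one and the same
  -- matrix serves `GL` and `SL`.
  let d : Fin (m + 1) → kˣ := fun j => if j = 0 then
    Units.map (Int.castRingHom k).toMonoidHom (Equiv.Perm.sign (Fin.revPerm (n := m + 1))) else 1
  have hdet : (monoMat Fin.revPerm fun j => (d j : k)).det = 1 := by
    rw [det_monoMat, Finset.prod_eq_single 0]
    · simp only [d, if_true]
      rcases Int.units_eq_one_or (Equiv.Perm.sign (Fin.revPerm (n := m + 1))) with h | h <;>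
        rw [h] <;> simp
    · intro b _ hb
      simp only [d, if_neg hb, Units.val_one]
    · simp
  rcases hX with rfl | rfl
  · exact exists_isMono_of_monoMat (X := .GL) (N := m + 1) _ (range_coordA _) _ d trivial trivial
  · exact exists_isMono_of_monoMat (X := .SL) (N := m + 1) _ (range_coordA _) _ d trivial
      (by rw [DetCond, matOf_embed, hdet])

variable (k) in
/-- Monomial elements that reverse the order of arbitrarily many coordinates. -/
lemma exists_reversal (X : Family) (N : ℕ) : ∃ n, N ≤ n ∧ ∃ (v : Ginf X k) (σ : Equiv.Perm ℤ),
    IsMono v σ ∧ ∀ p ∈ box X n, ∀ q ∈ box X n, σ p ≤ σ q → q ≤ p := by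
  have hlin : ∀ X : Family, (X = .GL ∨ X = .SL) → (∀ n, box X n = Set.range (coordA n)) →
      ∃ n, N ≤ n ∧ ∃ (v : Ginf X k) (σ : Equiv.Perm ℤ),
        IsMono v σ ∧ ∀ p ∈ box X n, ∀ q ∈ box X n, σ p ≤ σ q → q ≤ p := by
    intro X hX hb
    obtain ⟨v, hv⟩ := exists_reversal_linear (k := k) hX N
    refine ⟨N + 1, by omega, v, _, hv, ?_⟩
    rw [hb]
    rintro _ ⟨i, rfl⟩ _ ⟨j, rfl⟩ h
    rw [Equiv.Perm.viaEmbedding_apply, Equiv.Perm.viaEmbedding_apply] at h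
    simp only [coordA_apply, Fin.revPerm_apply, Fin.val_rev] at h ⊢
    omega
  have hneg : ∀ (n : ℕ) (j : Fin n ⊕ Fin n), coordD n (swapD n j) = -coordD n j := by
    rintro n (j | j)
    · rw [coordD_inl, neg_neg]
      rfl
    · rfl
  match X with
  | .GL => exact hlin .GL (Or.inl rfl) fun n => (range_coordA n).symm
  | .SL => exact hlin .SL (Or.inr rfl) fun n => (range_coordA n).symm
  | .SOeven =>
    obtain ⟨v, hv⟩ := exists_reversal_SOeven (k := k) N
    refine ⟨N + N, by omega, v, _, hv, ?_⟩
    rw [show box .SOeven (N + N) = Set.range (coordD (N + N)) from (range_coordD _).symm]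
    rintro _ ⟨i, rfl⟩ _ ⟨j, rfl⟩ h
    rw [Equiv.Perm.viaEmbedding_apply, Equiv.Perm.viaEmbedding_apply, hneg, hneg] at h
    omega
  | .SOodd =>
    obtain ⟨v, hv⟩ := exists_reversal_SOodd (k := k) N
    refine ⟨N + N, by omega, v, _, hv, ?_⟩
    rw [← range_coordB]
    have hneg' : ∀ j, coordB (N + N) (Equiv.Perm.sumCongr (swapD (N + N)) 1 j) =
        -coordB (N + N) j := by
      rintro (j | j)
      · exact hneg _ j
      · rfl
    rintro _ ⟨i, rfl⟩ _ ⟨j, rfl⟩ h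
    rw [Equiv.Perm.viaEmbedding_apply, Equiv.Perm.viaEmbedding_apply, hneg', hneg'] at h
    omega
  | .Sp =>
    obtain ⟨v, hv⟩ := exists_reversal_Sp (k := k) N
    refine ⟨N, le_rfl, v, _, hv, ?_⟩
    rw [← range_coordD]
    rintro _ ⟨i, rfl⟩ _ ⟨j, rfl⟩ h
    rw [Equiv.Perm.viaEmbedding_apply, Equiv.Perm.viaEmbedding_apply, hneg, hneg] at h
    omega

variable {X : Family}

lemma coef_of_notMem_box {w : Ginf X k} {n : ℕ} (hw : w.1 ∈ level X k n) {p q : ℤ}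
    (h : ¬ (p ∈ box X n ∧ q ∈ box X n)) : coef w p q = e k q p := by
  obtain ⟨h1, h2, -, -⟩ := (mem_level_iff _ _ _).1 hw
  by_cases hq : q ∈ box X n
  · have hp : p ∉ box X n := fun hp => h ⟨hp, hq⟩
    rw [coef, mem_spanOf.1 (h2 q hq) p hp, e_apply, if_neg]
    rintro rfl
    exact hp hq
  · rw [coef, h1 q hq]

lemma conj_mem_Uminus_of_reversal {n : ℕ} {v w : Ginf X k} {σ : Equiv.Perm ℤ} (hv : IsMono v σ)
    (hσ : ∀ p ∈ box X n, ∀ q ∈ box X n, σ p ≤ σ q → q ≤ p) (hw : w ∈ U X k)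
    (hwn : w.1 ∈ level X k n) : v * w * v⁻¹ ∈ Uminus X k := by
  rw [mem_Uminus_iff]
  intro p q hpq
  obtain ⟨p, rfl⟩ := σ.surjective p
  obtain ⟨q, rfl⟩ := σ.surjective q
  rw [hv.conj_coef_eq_iff]
  by_cases h : p ∈ box X n ∧ q ∈ box X n
  · exact (mem_U_iff w).1 hw p q (hσ p h.1 q h.2 hpq)
  · exact coef_of_notMem_box hwn h

/-- A finitary permutation that decreases no coordinate is trivial. -/
lemma perm_eq_one_of_le {σ : Equiv.Perm ℤ} {N : ℕ} (hN : ∀ z, (N : ℤ) < |z| → σ z = z)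
    (h : ∀ z, z ≤ σ z) : σ = 1 := by
  -- Downward induction from the fixed coordinates above `N`: a moved coordinate goes to a larger
  -- one, which is already known to be fixed.
  have key : ∀ d : ℕ, ∀ z : ℤ, (N : ℤ) + 1 - d ≤ z → σ z = z := by
    intro d
    induction d with
    | zero =>
      intro z hz
      exact hN z (by rw [lt_abs]; push_cast at hz; omega)
    | succ d ih =>
      intro z hz
      by_contra hne
      have h1 : σ (σ z) = σ z := ih _ (by have := h z; push_cast at hz; omega)
      exact hne (σ.injective h1)
  exact Equiv.ext fun z => key ((N : ℤ) + 1 - z).toNat z (by omega)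

/-- A lower unitriangular element in `v B`, for `v` monomial, is trivial. -/
lemma eq_one_of_mem_Uminus_of_eq_mul {l m b : Ginf X k} {σ : Equiv.Perm ℤ}
    (hl : l ∈ Uminus X k) (hm : IsMono m σ) (hb : b ∈ B X k) (h : l = m * b) : l = 1 := by
  obtain ⟨N, hN⟩ := hm.exists_abs
  -- The coefficient of `m b` at `(σ z, z)` is a nonzero scalar times a diagonal coefficient of `b`,
  -- hence nonzero. For a lower triangular element this requires `z ≤ σ z`.
  have hσ : σ = 1 := by
    refine perm_eq_one_of_le hN fun z => ?_
    by_contra hz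
    rw [not_le] at hz
    have h1 := (mem_Uminus_iff l).1 hl (σ z) z hz.le
    rw [e_apply, if_neg hz.ne'] at h1
    obtain ⟨a, ha⟩ := hm.exists_act_apply
    rw [coef, h, act_mul, ha] at h1
    exact mul_ne_zero (a z).ne_zero
      (coef_diag_ne_zero_of_triangular b ((mem_B_iff b).1 hb) z) h1
  subst hσ
  refine eq_one_of_mem_B_of_mem_Uminus ?_ hl
  rw [h]
  exact mul_mem (T_le_B (isMono_one_iff.1 hm)) hb

end Reversal

/-! ### The Steinberg module -/

section SteinbergModule

variable {X : Family} {K : Type v} [Field K]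

lemma xi_mul_xi {a b : Ginf X k} (ha : a ∈ U X k) (hb : b ∈ U X k) :
    xi K a ha * xi K b hb = xi K (a * b) (mul_mem ha hb) := by
  rw [xi, xi, MonoidAlgebra.single_mul_single, mul_one]
  rfl

lemma xi_one : xi K (1 : Ginf X k) (one_mem _) = 1 := rfl

lemma St.hom_ext {W : Type*} [AddCommGroup W] [Module K W] {f g : St X k K →ₗ[K] W}
    (h : ∀ u hu, f (xi K u hu) = g (xi K u hu)) : f = g :=
  MonoidAlgebra.lhom_ext' fun u => LinearMap.ext_ring (h u.1 u.2)

variable (X k K) in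
/-- The map from `K U ξ` to the functions on `G` that sends `u ξ` to the translate of `eta`. -/
def psi : St X k K →ₗ[K] (Ginf X k → K) :=
  Finsupp.linearCombination K (fun u : U X k => leftReg K (Ginf X k) u.1 (eta k X K)) ∘ₗ
    (MonoidAlgebra.coeffLinearEquiv K).toLinearMap

lemma psi_apply (f : St X k K) (h : Ginf X k) :
    psi k X K f h = ∑ u ∈ f.coeff.support, f.coeff u * eta k X K (u.1⁻¹ * h) := by
  change (Finsupp.linearCombination K
    (fun u : U X k => leftReg K (Ginf X k) u.1 (eta k X K)) f.coeff) h = _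
  rw [Finsupp.linearCombination_apply, Finsupp.sum, Finset.sum_apply]
  rfl

lemma psi_xi (u : Ginf X k) (hu : u ∈ U X k) :
    psi k X K (xi K u hu) = leftReg K (Ginf X k) u (eta k X K) := by
  change Finsupp.linearCombination K _ (Finsupp.single _ 1) = _
  rw [Finsupp.linearCombination_single, one_smul]

lemma exists_forall_mem_level (s : Finset (Ginf X k)) : ∃ N, ∀ g ∈ s, g.1 ∈ level X k N := by
  classical
  induction s using Finset.induction_on with
  | empty => exact ⟨0, by simp⟩
  | insert g s _ ih =>
    obtain ⟨N, hN⟩ := ih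
    obtain ⟨n, hn, hg⟩ := exists_mem_level g N
    refine ⟨n, fun h hh => ?_⟩
    rcases Finset.mem_insert.1 hh with rfl | hh
    · exact hg
    · exact level_mono X hn (hN h hh)

/-- The translates of `eta` under `U` are linearly independent. -/
lemma psi_injective : Function.Injective (psi k X K) := by
  classical
  rw [injective_iff_map_eq_zero]
  intro f hf
  by_contra hne
  obtain ⟨u₀, hu₀⟩ : ∃ u, f.coeff u ≠ 0 := by
    by_contra hall
    push Not at hall
    exact hne (MonoidAlgebra.coeff_injective (Finsupp.ext hall))
  -- Only finitely many quotients `u⁻¹ u₀` matter, so one reversing element handles them all.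
  obtain ⟨N, hN⟩ := exists_forall_mem_level
    (f.coeff.support.image fun u : U X k => u.1⁻¹ * u₀.1)
  obtain ⟨n, hn, v, σ, hv, hσ⟩ := exists_reversal k X N
  -- At `u₀ v⁻¹` the translate by `u₀` takes the value of `eta` at the monomial element `v⁻¹`, a
  -- sign; all other translates vanish there.
  have h1 := congrFun hf (u₀.1 * v⁻¹)
  rw [psi_apply, Finset.sum_eq_single u₀] at h1
  · rw [inv_mul_cancel_left] at h1
    have h2 := bruhatFun_mul (signK X K) hv.inv (one_mem (B X k))
    rw [mul_one] at h2
    rw [eta, h2] at h1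
    exact mul_ne_zero hu₀ (signK_ne_zero _) h1
  · intro u hu hne
    have hlev := level_mono X hn (hN _ (Finset.mem_image_of_mem _ hu))
    have hU := conj_mem_Uminus_of_reversal hv hσ (mul_mem (inv_mem u.2) u₀.2) hlev
    rw [← mul_assoc]
    rcases bruhatFun_cases (K := K) (u.1⁻¹ * u₀.1 * v⁻¹) with ⟨τ, m, b, hm, hb, h⟩ | h
    · have h3 := eq_one_of_mem_Uminus_of_eq_mul hU (hv.mul hm) hb (by
        rw [mul_assoc, h, mul_assoc])
      rw [conj_eq_one_iff, inv_mul_eq_one] at h3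
      exact absurd (Subtype.ext h3) hne
    · rw [eta, h, mul_zero]
  · intro h
    exact absurd (Finsupp.notMem_support_iff.1 h) hu₀

lemma leftReg_mul (a b : Ginf X k) (f : Ginf X k → K) : leftReg K (Ginf X k) (a * b) f =
    leftReg K (Ginf X k) a (leftReg K (Ginf X k) b f) := by
  rw [map_mul, Module.End.mul_apply]

lemma leftReg_T_psi {t u : Ginf X k} (ht : t ∈ T X k) (hu : u ∈ U X k) :
    leftReg K (Ginf X k) t (psi k X K (xi K u hu)) =
      psi k X K (xi K (t * u * t⁻¹) (conj_mem_of_mem_T ht hu)) := by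
  have h : t * u = t * u * t⁻¹ * t := by group
  rw [psi_xi, psi_xi, ← leftReg_mul, h, leftReg_mul, leftReg_eta_T ht]
  group

lemma leftReg_U_psi {u : Ginf X k} (hu : u ∈ U X k) (f : St X k K) :
    leftReg K (Ginf X k) u (psi k X K f) = psi k X K (xi K u hu * f) := by
  have h : leftReg K (Ginf X k) u ∘ₗ psi k X K =
      psi k X K ∘ₗ LinearMap.mulLeft K (xi K u hu) := by
    refine St.hom_ext fun w hw => ?_
    rw [LinearMap.comp_apply, LinearMap.comp_apply, LinearMap.mulLeft_apply, xi_mul_xi hu hw,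
      psi_xi, psi_xi, leftReg_mul]
  exact LinearMap.congr_fun h f

lemma leftReg_refl_psi {n : Ginf X k} {i : ℕ} (hn : Represents n i) {u : Ginf X k}
    (hu : u ∈ Usub' n) : leftReg K (Ginf X k) n (psi k X K (xi K u hu.1)) =
      psi k X K (-xi K (n * u * n⁻¹) (conj_mem_of_mem_Usub' hu)) := by
  have h : n * u = n * u * n⁻¹ * n := by group
  rw [psi_xi, map_neg, psi_xi, ← leftReg_mul, h, leftReg_mul, leftReg_eta_refl hn, map_neg]
  group

lemma leftReg_refl_psi' {n : Ginf X k} {i : ℕ} (hn : Represents n i) {u w x : Ginf X k}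
    (hu : u ∈ Usub' n) (hw : w ∈ Usub n) (hx : x ∈ Usub n)
    (h : ∃ t ∈ T X k, ∃ y ∈ Usub n, n * w * n⁻¹ = x * n * t * y) :
    leftReg K (Ginf X k) n (psi k X K (xi K (u * w) (mul_mem hu.1 hw.1))) =
      psi k X K (xi K (n * u * n⁻¹) (conj_mem_of_mem_Usub' hu) * (xi K x hx.1 - 1)) := by
  obtain ⟨t, ht, y, hy, h⟩ := h
  have h1 : n * (u * w) = n * u * n⁻¹ * (n * w) := by group
  rw [psi_xi, ← leftReg_U_psi, map_sub, ← xi_one, psi_xi, psi_xi, ← leftReg_mul, h1, leftReg_mul,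
    leftReg_mul n w, leftReg_eta_Usub hn hw hx ht hy h, map_one, Module.End.one_apply]

lemma exists_decomposition {n : Ginf X k} {i : ℕ} (hn : Represents n i) {u : Ginf X k}
    (hu : u ∈ U X k) : ∃ a ∈ Usub' n, ∃ w ∈ Usub n, u = a * w := by
  obtain ⟨⟨a, w⟩, h, -⟩ := existsUnique_factorization hn hu
  exact ⟨a, a.2, w, w.2, h⟩

lemma leftReg_psi_mem_of_forall {g : Ginf X k}
    (h : ∀ u hu, leftReg K (Ginf X k) g (psi k X K (xi K u hu)) ∈ LinearMap.range (psi k X K)) :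
    ∀ f ∈ LinearMap.range (psi k X K),
      leftReg K (Ginf X k) g f ∈ LinearMap.range (psi k X K) := by
  rintro _ ⟨f, rfl⟩
  induction f using MonoidAlgebra.induction_linear with
  | zero => rw [map_zero, map_zero]; exact zero_mem _
  | add a b ha hb => rw [map_add, map_add]; exact add_mem ha hb
  | single u c =>
    have : MonoidAlgebra.single u c = c • xi K u.1 u.2 := by
      rw [xi, MonoidAlgebra.smul_single, smul_eq_mul, mul_one]
    rw [this, map_smul, map_smul]
    exact Submodule.smul_mem _ _ (h u.1 u.2)

/-- The formulas for `T`, `U` and the `n_i` show that each generator maps translates of `eta` into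
their span. -/
lemma leftReg_psi_mem {n : ℕ → Ginf X k} (hn : ∀ i, Represents (n i) i) (g : Ginf X k) :
    ∀ f ∈ LinearMap.range (psi k X K),
      leftReg K (Ginf X k) g f ∈ LinearMap.range (psi k X K) := by
  have hT : ∀ t ∈ T X k, ∀ f ∈ LinearMap.range (psi k X K),
      leftReg K (Ginf X k) t f ∈ LinearMap.range (psi k X K) := fun t ht =>
    leftReg_psi_mem_of_forall fun u hu => ⟨_, (leftReg_T_psi ht hu).symm⟩
  have hU : ∀ w ∈ U X k, ∀ f ∈ LinearMap.range (psi k X K),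
      leftReg K (Ginf X k) w f ∈ LinearMap.range (psi k X K) := fun w hw =>
    leftReg_psi_mem_of_forall fun u hu => ⟨_, (leftReg_U_psi hw _).symm⟩
  have hr : ∀ i, ∀ f ∈ LinearMap.range (psi k X K),
      leftReg K (Ginf X k) (n i) f ∈ LinearMap.range (psi k X K) := by
    intro i
    refine leftReg_psi_mem_of_forall fun u hu => ?_
    obtain ⟨a, ha, w, hw, rfl⟩ := exists_decomposition (hn i) hu
    by_cases hw1 : w = 1
    · subst hw1
      have := leftReg_refl_psi (K := K) (hn i) ha
      simp only [mul_one]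
      exact ⟨_, this.symm⟩
    · obtain ⟨x, ⟨hx, h⟩, -⟩ := existsUnique_rank_one (hn i) hw hw1
      exact ⟨_, (leftReg_refl_psi' (hn i) ha hw hx h).symm⟩
  have hg : g ∈ gen n := by rw [gen_eq_top hn]; trivial
  -- Stability is carried along for `g` and `g⁻¹` together, so that the induction over the generated
  -- subgroup passes through inverses.
  have key : (∀ f ∈ LinearMap.range (psi k X K),
      leftReg K (Ginf X k) g f ∈ LinearMap.range (psi k X K)) ∧
      ∀ f ∈ LinearMap.range (psi k X K),
      leftReg K (Ginf X k) g⁻¹ f ∈ LinearMap.range (psi k X K) := by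
    induction hg using Subgroup.closure_induction with
    | mem g hg =>
      rcases hg with (hg | hg) | ⟨i, rfl⟩
      · exact ⟨hT g hg, hT g⁻¹ (inv_mem hg)⟩
      · exact ⟨hU g hg, hU g⁻¹ (inv_mem hg)⟩
      · refine ⟨hr i, fun f hf => ?_⟩
        -- Since `n_i² ∈ T`, the inverse of `n_i` is again `n_i` up to an element of the torus.
        have h : (n i)⁻¹ = (n i * n i)⁻¹ * n i := by group
        rw [h, leftReg_mul]
        exact hT _ (inv_mem (hn i).sq_mem_T) _ (hr i f hf)
    | one => simp
    | mul a b _ _ ha hb =>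
      refine ⟨fun f hf => ?_, fun f hf => ?_⟩
      · rw [leftReg_mul]
        exact ha.1 _ (hb.1 f hf)
      · rw [mul_inv_rev, leftReg_mul]
        exact hb.2 _ (ha.2 f hf)
    | inv a _ ha =>
      rw [inv_inv]
      exact ha.symm
  exact key.1

/-- The Steinberg representation, transported from the span of the translates of `eta`. -/
def steinberg {n : ℕ → Ginf X k} (hn : ∀ i, Represents (n i) i) :
    Representation K (Ginf X k) (St X k K) where
  toFun g := (LinearEquiv.ofInjective (psi k X K) psi_injective).symm.toLinearMap ∘ₗ
    (leftReg K (Ginf X k) g).restrict (leftReg_psi_mem hn g) ∘ₗ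
    (LinearEquiv.ofInjective (psi k X K) psi_injective).toLinearMap
  map_one' := by
    refine LinearMap.ext fun x => (LinearEquiv.symm_apply_eq _).2 (Subtype.ext ?_)
    simp [LinearMap.restrict_apply]
  map_mul' a b := by
    refine LinearMap.ext fun x => (LinearEquiv.symm_apply_eq _).2 (Subtype.ext ?_)
    simp [LinearMap.restrict_apply]

lemma psi_steinberg {n : ℕ → Ginf X k} (hn : ∀ i, Represents (n i) i) (g : Ginf X k)
    (f : St X k K) : psi k X K (steinberg hn g f) = leftReg K (Ginf X k) g (psi k X K f) :=
  congrArg Subtype.val (LinearEquiv.apply_symm_apply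
    (LinearEquiv.ofInjective (psi k X K) psi_injective) _)

lemma isSteinberg_steinberg {n : ℕ → Ginf X k} (hn : ∀ i, Represents (n i) i) :
    IsSteinberg K n (steinberg hn) where
  extends_U u hu f := psi_injective (by rw [psi_steinberg, leftReg_U_psi])
  torus t ht u hu := psi_injective (by rw [psi_steinberg, leftReg_T_psi ht hu])
  reflection i u hu := psi_injective (by rw [psi_steinberg, leftReg_refl_psi (hn i) hu])
  reflection' i u hu w hw _ x hx h := psi_injective (by
    rw [psi_steinberg, leftReg_refl_psi' (hn i) hu hw hx h])

/-- The formulas prescribe the action of `T`, `U` and each `n_i` on every basis vector `u ξ`, and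
these elements generate the group. -/
lemma IsSteinberg.unique {n : ℕ → Ginf X k} (hn : ∀ i, Represents (n i) i)
    {ρ ρ' : Representation K (Ginf X k) (St X k K)} (h : IsSteinberg K n ρ)
    (h' : IsSteinberg K n ρ') : ρ = ρ' := by
  have hle : gen n ≤ MonoidHom.eqLocus ρ ρ' := by
    refine (Subgroup.closure_le _).2 ?_
    rintro g ((hg | hg) | ⟨i, rfl⟩)
    · exact St.hom_ext fun u hu => by rw [h.torus g hg, h'.torus g hg]
    · exact LinearMap.ext fun f => by rw [h.extends_U g hg, h'.extends_U g hg]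
    · refine St.hom_ext fun u hu => ?_
      obtain ⟨a, ha, w, hw, rfl⟩ := exists_decomposition (hn i) hu
      by_cases hw1 : w = 1
      · subst hw1
        simp only [mul_one]
        rw [h.reflection i a ha, h'.reflection i a ha]
      · obtain ⟨x, ⟨hx, hx'⟩, -⟩ := existsUnique_rank_one (hn i) hw hw1
        rw [h.reflection' i a ha w hw hw1 x hx hx', h'.reflection' i a ha w hw hw1 x hx hx']
  rw [gen_eq_top hn] at hle
  exact MonoidHom.ext fun g => hle trivial

lemma existsUnique_isSteinberg {n : ℕ → Ginf X k} (hn : ∀ i, Represents (n i) i) :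
    ∃! ρ : Representation K (Ginf X k) (St X k K), IsSteinberg K n ρ :=
  ⟨steinberg hn, isSteinberg_steinberg hn, fun _ h => h.unique hn (isSteinberg_steinberg hn)⟩

end SteinbergModule

/-! ### Linear maps out of induced modules -/

section Induced

variable {R G H A W : Type*} [CommRing R] [Group G] [Group H] (φ : G →* H)
  [AddCommGroup A] [Module R A] (ρ : Representation R G A) [AddCommGroup W] [Module R W]

lemma indV_mk_mul (g : G) (h : H) (a : A) : Representation.IndV.mk φ ρ (φ g * h) (ρ g a) =
    Representation.IndV.mk φ ρ h a := by
  have := Representation.Coinvariants.mk_self_apply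
    (Representation.tprod ((Representation.leftRegular R H).comp φ) ρ) g
    (MonoidAlgebra.single h 1 ⊗ₜ a)
  rw [Representation.tprod_apply, TensorProduct.map_tmul] at this
  simpa using this

/-- The linear map out of an induced module given by its values on the cosets. -/
def indLift (F : H → A →ₗ[R] W) (hF : ∀ g h a, F (φ g * h) (ρ g a) = F h a) :
    Representation.IndV φ ρ →ₗ[R] W :=
  Representation.Coinvariants.lift _ (TensorProduct.lift
    ((Finsupp.lift _ _ _ F) ∘ₗ (MonoidAlgebra.coeffLinearEquiv R).toLinearMap)) (by
      intro g
      ext h a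
      simp [hF])

lemma indLift_mk (F : H → A →ₗ[R] W) (hF : ∀ g h a, F (φ g * h) (ρ g a) = F h a) (h : H) (a : A) :
    indLift φ ρ F hF (Representation.IndV.mk φ ρ h a) = F h a := by
  simp [indLift]

end Induced

/-! ### Inflation of characters -/

section Inflation

variable {X : Family} {K : Type v} [Field K]

lemma eq_of_mul_eq_mul_T_U {t t' u u' : Ginf X k} (ht : t ∈ T X k) (ht' : t' ∈ T X k)
    (hu : u ∈ U X k) (hu' : u' ∈ U X k) (h : t * u = t' * u') : t = t' := by
  have h1 : t'⁻¹ * t = u' * u⁻¹ := by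
    rw [eq_mul_inv_iff_mul_eq, mul_assoc, h, inv_mul_cancel_left]
  have h2 : t'⁻¹ * t = 1 := eq_one_of_mem_T_of_mem_U (mul_mem (inv_mem ht') ht)
    (by rw [h1]; exact mul_mem hu' (inv_mem hu))
  exact (inv_mul_eq_one.1 h2).symm

/-- The image of an element of `B` in `T`. -/
def torusPart (b : B X k) : T X k :=
  ⟨(exists_eq_mul_of_mem_B b.2).choose, (exists_eq_mul_of_mem_B b.2).choose_spec.1⟩

lemma torusPart_eq {b : B X k} {t u : Ginf X k} (ht : t ∈ T X k) (hu : u ∈ U X k)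
    (h : (b : Ginf X k) = t * u) : torusPart b = ⟨t, ht⟩ := by
  obtain ⟨ht', u', hu', h'⟩ := (exists_eq_mul_of_mem_B b.2).choose_spec
  exact Subtype.ext (eq_of_mul_eq_mul_T_U ht' ht hu' hu (h'.symm.trans h))

variable (X k) in
/-- The natural homomorphism `B → T`. -/
def toTorus : B X k →* T X k := MonoidHom.mk' torusPart fun a b => by
  obtain ⟨t, ht, u, hu, ha⟩ := exists_eq_mul_of_mem_B a.2
  obtain ⟨t', ht', u', hu', hb⟩ := exists_eq_mul_of_mem_B b.2
  rw [torusPart_eq ht hu ha, torusPart_eq ht' hu' hb]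
  -- Moving `t'` to the left gives `t u t' u' = (t t') (t'⁻¹ u t' u')`.
  refine torusPart_eq (mul_mem ht ht')
    (mul_mem (conj_mem_of_mem_T (inv_mem ht') hu) hu') ?_
  rw [Subgroup.coe_mul, ha, hb]
  group

lemma existsUnique_isInflation (θ : T X k →* Kˣ) : ∃! χ : B X k →* Kˣ, IsInflation θ χ := by
  refine ⟨θ.comp (toTorus k X), ⟨fun t b h => ?_, fun b hb => ?_⟩, fun χ hχ => ?_⟩
  · exact congrArg θ (torusPart_eq t.2 (one_mem _) (by rw [h, mul_one]))
  · rw [MonoidHom.comp_apply]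
    have : toTorus k X b = 1 := torusPart_eq (one_mem _) hb (one_mul _).symm
    rw [this, map_one]
  · refine MonoidHom.ext fun b => ?_
    obtain ⟨t, ht, u, hu, hb⟩ := exists_eq_mul_of_mem_B b.2
    have h1 : b = ⟨t, T_le_B ht⟩ * ⟨u, U_le_B hu⟩ := Subtype.ext hb
    have h2 : toTorus k X b = ⟨t, ht⟩ := torusPart_eq ht hu hb
    rw [MonoidHom.comp_apply, h2, h1, map_mul, hχ.1 ⟨t, ht⟩ _ rfl, hχ.2 _ hu, mul_one]

end Inflation

/-! ### The tensor product of `M(θ)` with the Steinberg module -/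

section IsInduced

variable {G : Type u} [Group G] {K : Type v} [Field K] {V : Type (max u v)} [AddCommGroup V]
  [Module K V]

/-- The universal property of the module induced from a character `θ` of a subgroup; `m g a` is the
class of `g ⊗ a`. -/
structure IsInduced {H : Subgroup G} (θ : H →* Kˣ) (σ : Representation K G V)
    (m : G → K →ₗ[K] V) : Prop where
  -- With this action `m h a` plays the role of `h⁻¹ ⊗ a` in the left module `KG ⊗ K_θ`; hence the
  -- inverses in the formulas that follow.
  act : ∀ g h a, σ g (m h a) = m (h * g⁻¹) a
  mul : ∀ (t : H) g a, m (t * g) (θ t * a) = m g a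
  ext : ∀ {W : Type (max u v)} [AddCommGroup W] [Module K W] (f f' : V →ₗ[K] W),
    (∀ g a, f (m g a) = f' (m g a)) → f = f'
  lift : ∀ {W : Type (max u v)} [AddCommGroup W] [Module K W] (F : G → K →ₗ[K] W),
    (∀ (t : H) g a, F (t * g) (θ t * a) = F g a) → ∃ f : V →ₗ[K] W, ∀ g a, f (m g a) = F g a

lemma isInduced_ind {H : Subgroup G} (θ : H →* Kˣ) :
    IsInduced θ (Representation.ind H.subtype (ofCharacter θ))
      (Representation.IndV.mk H.subtype (ofCharacter θ)) where
  act _ _ _ := Representation.ind_mk _ _ _ _ _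
  mul t g a := indV_mk_mul H.subtype (ofCharacter θ) t g a
  ext _ _ h := Representation.IndV.hom_ext _ _ fun g => LinearMap.ext (h g)
  lift F hF := ⟨indLift H.subtype (ofCharacter θ) F hF, indLift_mk _ _ _ _⟩

end IsInduced

section Tensor

variable {X : Family} {K : Type v} [Field K] {n : ℕ → Ginf X k} {θ : T X k →* Kˣ}
  {χ : B X k →* Kˣ} {ρ : Representation K (Ginf X k) (St X k K)}
  {V W : Type (max u v)} [AddCommGroup V] [Module K V] [AddCommGroup W] [Module K W]
  {σ : Representation K (Ginf X k) V} {m : Ginf X k → K →ₗ[K] V}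
  {τ : Representation K (Ginf X k) W} {p : Ginf X k → K →ₗ[K] W}

lemma IsSteinberg.apply_T_one (hρ : IsSteinberg K n ρ) {t : Ginf X k} (ht : t ∈ T X k) :
    ρ t 1 = 1 := by
  have := hρ.torus t ht 1 (one_mem _)
  simpa only [mul_one, mul_inv_cancel, xi_one] using this

lemma IsSteinberg.apply_U_one (hρ : IsSteinberg K n ρ) {u : Ginf X k} (hu : u ∈ U X k) :
    ρ u 1 = xi K u hu := by
  rw [hρ.extends_U u hu, mul_one]

lemma apply_inv_apply {G : Type*} [Group G] (σ : Representation K G V) (g : G) (x : V) :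
    σ g⁻¹ (σ g x) = x := by
  rw [← Module.End.mul_apply, ← map_mul, inv_mul_cancel, map_one, Module.End.one_apply]

/-- The map `g ⊗ 1 ↦ g (1 ⊗ ξ)`. -/
lemma exists_toTensor (hχ : IsInflation θ χ) (hρ : IsSteinberg K n ρ) (hm : IsInduced θ σ m)
    (hp : IsInduced χ τ p) : ∃ f : V →ₗ[K] W ⊗[K] St X k K,
      (∀ g a, f (m g a) = p g a ⊗ₜ ρ g⁻¹ 1) ∧ ∀ g, f ∘ₗ σ g = (τ.tprod ρ) g ∘ₗ f := by
  -- The relation over `T` is respected because `T` fixes `ξ` and `χ` extends `θ`.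
  obtain ⟨f, hf⟩ := hm.lift (fun g => (TensorProduct.mk K _ _).flip (ρ g⁻¹ 1) ∘ₗ p g) (by
    intro t g a
    have h1 := hp.mul ⟨t.1, T_le_B t.2⟩ g a
    rw [hχ.1 t _ rfl] at h1
    change p (t.1 * g) (θ t * a) ⊗ₜ ρ (t.1 * g)⁻¹ 1 = p g a ⊗ₜ ρ g⁻¹ 1
    rw [h1, mul_inv_rev, map_mul, Module.End.mul_apply, hρ.apply_T_one (inv_mem t.2)])
  have hf' : ∀ g a, f (m g a) = p g a ⊗ₜ ρ g⁻¹ 1 := hf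
  refine ⟨f, hf', fun g => hm.ext _ _ fun h a => ?_⟩
  rw [LinearMap.comp_apply, LinearMap.comp_apply, hm.act, hf', hf', Representation.tprod_apply,
    TensorProduct.map_tmul, hp.act, mul_inv_rev, inv_inv, map_mul, Module.End.mul_apply]

/-- The map `u ξ ↦ u ⊗ 1`. -/
lemma exists_ofSt (hχ : IsInflation θ χ) (hρ : IsSteinberg K n ρ) (hm : IsInduced θ σ m) :
    ∃ β : St X k K →ₗ[K] V, (∀ u hu, β (xi K u hu) = m u⁻¹ 1) ∧
      ∀ (b : B X k) (f : St X k K), (χ b : K) • β (ρ b f) = σ b (β f) := by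
  obtain ⟨β, hβ⟩ : ∃ β : St X k K →ₗ[K] V, ∀ u hu, β (xi K u hu) = m u⁻¹ 1 := by
    refine ⟨Finsupp.linearCombination K (fun u : U X k => m (u : Ginf X k)⁻¹ 1) ∘ₗ
      (MonoidAlgebra.coeffLinearEquiv K).toLinearMap, fun u hu => ?_⟩
    change Finsupp.linearCombination K _ (Finsupp.single _ 1) = _
    rw [Finsupp.linearCombination_single, one_smul]
  refine ⟨β, hβ, fun b f => ?_⟩
  obtain ⟨t, ht, u, hu, hb⟩ := exists_eq_mul_of_mem_B b.2
  have hχb : χ b = θ ⟨t, ht⟩ := by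
    have h1 : b = ⟨t, T_le_B ht⟩ * ⟨u, U_le_B hu⟩ := Subtype.ext hb
    rw [h1, map_mul, hχ.1 ⟨t, ht⟩ _ rfl, hχ.2 _ hu, mul_one]
  -- This says that `β` is `B`-linear from `K_χ ⊗ St` to the induced module. It is checked on the
  -- basis for `b = t u`, where moving `t` past `u w` produces the factor `θ t`.
  have key : (χ b : K) • (β ∘ₗ ρ b) = σ b ∘ₗ β := by
    refine St.hom_ext fun w hw => ?_
    rw [LinearMap.smul_apply, LinearMap.comp_apply, LinearMap.comp_apply, hb, map_mul,
      Module.End.mul_apply, hρ.extends_U u hu, xi_mul_xi, hρ.torus t ht, hβ, hβ, hm.act, hχb,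
      ← map_smul, smul_eq_mul]
    have h2 := hm.mul ⟨t, ht⟩ ((u * w)⁻¹ * t⁻¹) 1
    rw [show (t * (u * w) * t⁻¹)⁻¹ = t * ((u * w)⁻¹ * t⁻¹) by group,
      show w⁻¹ * (t * u)⁻¹ = (u * w)⁻¹ * t⁻¹ by group]
    exact h2
  exact LinearMap.congr_fun key f

/-- `M(θ) ⊗ St` is isomorphic to the module induced from `T`. -/
lemma nonempty_equiv_of_isInduced (hχ : IsInflation θ χ) (hρ : IsSteinberg K n ρ)
    (hm : IsInduced θ σ m) (hp : IsInduced χ τ p) : Nonempty ((τ.tprod ρ).Equiv σ) := by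
  obtain ⟨F, hF, hFe⟩ := exists_toTensor hχ hρ hm hp
  obtain ⟨β, hβ, hβe⟩ := exists_ofSt hχ hρ hm
  -- Extension of `β` to all of `M(θ) ⊗ St`: translate the first factor to the identity coset, apply
  -- `β`, and translate back. The twisted `B`-linearity of `β` makes this independent of the
  -- representative.
  obtain ⟨E, hE⟩ := hp.lift (fun g => LinearMap.toSpanSingleton K (St X k K →ₗ[K] V)
      (σ g⁻¹ ∘ₗ β ∘ₗ ρ g)) (by
    intro b g a
    refine LinearMap.ext fun f => ?_
    change ((χ b : K) * a) • σ (b.1 * g)⁻¹ (β (ρ (b.1 * g) f)) = a • σ g⁻¹ (β (ρ g f))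
    rw [mul_comm, mul_smul, ← map_smul (σ _), map_mul ρ, Module.End.mul_apply, hβe, mul_inv_rev,
      map_mul, Module.End.mul_apply, apply_inv_apply])
  have hE' : ∀ g a f, E (p g a) f = a • σ g⁻¹ (β (ρ g f)) := fun g a f => by
    rw [hE]
    rfl
  -- On the identity coset the two constructions are inverse: `u ξ` goes to `u ⊗ 1` and then to `u
  -- (1 ⊗ ξ) = 1 ⊗ u ξ`, because `χ` is trivial on `U`. Equivariance of `F` carries this to every
  -- coset.
  have hFβ : ∀ f, F (β f) = p 1 1 ⊗ₜ f := by
    have h : F ∘ₗ β = TensorProduct.mk K _ _ (p 1 1) := by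
      refine St.hom_ext fun u hu => ?_
      have h1 := hp.mul ⟨u⁻¹, U_le_B (inv_mem hu)⟩ 1 1
      rw [hχ.2 _ (inv_mem hu), Units.val_one, mul_one, mul_one] at h1
      rw [LinearMap.comp_apply, hβ, hF, inv_inv, hρ.apply_U_one hu, TensorProduct.mk_apply, h1]
    exact LinearMap.congr_fun h
  have h1 : F ∘ₗ TensorProduct.lift E = LinearMap.id := by
    refine TensorProduct.ext (hp.ext _ _ fun g a => LinearMap.ext fun f => ?_)
    change F (E (p g a) f) = p g a ⊗ₜ f
    have h2 := LinearMap.congr_fun (hFe g⁻¹) (β (ρ g f))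
    rw [LinearMap.comp_apply, LinearMap.comp_apply] at h2
    rw [hE', map_smul, h2, hFβ, Representation.tprod_apply, TensorProduct.map_tmul, hp.act,
      inv_inv, one_mul, apply_inv_apply, TensorProduct.smul_tmul', ← map_smul, smul_eq_mul,
      mul_one]
  have h2 : TensorProduct.lift E ∘ₗ F = LinearMap.id := by
    refine hm.ext _ _ fun g a => ?_
    rw [LinearMap.comp_apply, hF, TensorProduct.lift.tmul, hE', ← Module.End.mul_apply, ← map_mul,
      mul_inv_cancel, map_one ρ, Module.End.one_apply, ← xi_one, hβ, hm.act, inv_one, inv_inv,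
      one_mul, ← map_smul, smul_eq_mul, mul_one, LinearMap.id_apply]
  exact ⟨(Representation.Equiv.mk (LinearEquiv.ofLinearMap F (TensorProduct.lift E) h1 h2)
    hFe).symm⟩

lemma nonempty_equiv (hχ : IsInflation θ χ) (hρ : IsSteinberg K n ρ) :
    Nonempty (((M χ).tprod ρ).Equiv
      (Representation.ind (T X k).subtype (ofCharacter θ))) :=
  nonempty_equiv_of_isInduced hχ hρ (isInduced_ind θ) (isInduced_ind χ)

end Tensor

end FinitaryClassical

end

theorem proposition7p4 {k : Type*} [Field k] {K : Type*} [Field K]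
    (X : FinitaryClassical.Family) (n : ℕ → FinitaryClassical.Ginf X k)
    (hn : ∀ i, FinitaryClassical.Represents (n i) i) :
    -- `U = U_i' U_i` with uniqueness
    (∀ i, ∀ u ∈ FinitaryClassical.U X k,
      ∃! p : FinitaryClassical.Usub' (n i) × FinitaryClassical.Usub (n i),
        u = (p.1 : FinitaryClassical.Ginf X k) * p.2) ∧
    -- the element `x` is well defined
    (∀ i, ∀ w ∈ FinitaryClassical.Usub (n i), w ≠ 1 →
      ∃! x, x ∈ FinitaryClassical.Usub (n i) ∧ ∃ t ∈ FinitaryClassical.T X k,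
        ∃ y ∈ FinitaryClassical.Usub (n i), n i * w * (n i)⁻¹ = x * n i * t * y) ∧
    -- existence and uniqueness of the Steinberg module
    (∃! ρ : Representation K (FinitaryClassical.Ginf X k) (FinitaryClassical.St X k K),
      FinitaryClassical.IsSteinberg K n ρ) ∧
    -- `M(θ) ⊗ St ≅ Ind_T^G K_θ`
    ∀ θ : FinitaryClassical.T X k →* Kˣ,
      (∃! χ : FinitaryClassical.B X k →* Kˣ, FinitaryClassical.IsInflation θ χ) ∧
      ∀ χ : FinitaryClassical.B X k →* Kˣ, FinitaryClassical.IsInflation θ χ →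
        ∀ ρ : Representation K (FinitaryClassical.Ginf X k) (FinitaryClassical.St X k K),
          FinitaryClassical.IsSteinberg K n ρ →
          Nonempty (((FinitaryClassical.M χ).tprod ρ).Equiv
            (Representation.ind (FinitaryClassical.T X k).subtype
              (FinitaryClassical.ofCharacter θ))) := by
  refine ⟨fun i u hu => FinitaryClassical.existsUnique_factorization (hn i) hu,
    fun i w hw hw1 => FinitaryClassical.existsUnique_rank_one (hn i) hw hw1,
    FinitaryClassical.existsUnique_isSteinberg hn, fun θ =>
    ⟨FinitaryClassical.existsUnique_isInflation θ, fun χ hχ ρ hρ =>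
      FinitaryClassical.nonempty_equiv hχ hρ⟩⟩
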